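/- **Setting.** Let $\mathbb T^3=(\mathbb R/2\pi\mathbb Z)^3$ with the Lebesgue measure $dx$ normalised to total mass one, $\widehat f(n)=\int_{\mathbb T^3} f(x)e^{-i\langle n,x\rangle}\,dx$ for $n\in\mathbb Z^3$, and $\langle y\rangle=(1+|y|^2)^{1/2}$. Let $0<\beta<3$ and let $V\colon\mathbb T^3\to\mathbb R$ be even, smooth away from the origin, bounded below by a positive constant, and equal to $c\,|x|^{-(3-\beta)}$ for $0<|x|\le 1/10$, for some constant $c>0$. Let $\rho\colon[0,\infty)\to[0,1]$ be non-increasing, smooth on $(0,\infty)$, with $\rho=1$ on $[0,1/4]$, $\rho=0$ on $[4,\infty)$, and $\min(\rho,-\rho')\ge c'>0$ on $[1/2,2]$. For $t\ge 0$ put $\rho_t(n)=\rho(\|n\|_2/\langle t\rangle)$. For dyadic $N=2^k$, $k\ge 0$, let $P_N$ be the Fourier multiplier with symbol $\chi_1=\rho_1$ and $\chi_N=\rho_N-\rho_{N/2}$ for $N\ge 2$. For $s>0$ and $1\le r\le\infty$ let $\mathbb W^{s,r}_x(\mathbb T^3)$ be the completion of the space of real-valued functions in $C^\infty(\mathbb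 T^3)$ under the norm $$\|f\|_{\mathbb W^{s,r}_x}=\big\|N^s\|P_Nf\|_{L^r_x}\big\|_{\ell^r_N}.$$ Let $(W_t^n)_{t\ge 0,\,n\in\mathbb Z^3}$ be a centred jointly Gaussian family of complex random variables on a probability space $(\Omega,\mathcal F,\mathbb P)$ such that, for all $s,t\ge 0$ and $n,m\in\mathbb Z^3$, $W_t^{-n}=\overline{W_t^n}$ almost surely and $$\mathbb E\big[W_s^n\,\overline{W_t^m}\big]=\mathbf 1\{n=m\}\,\frac{\rho_{\min(s,t)}(n)^2}{\langle n\rangle^2}.$$ For $T,t\ge 0$ define the truncated field $W^T_t(x)=\sum_{n\in\mathbb Z^3}\rho_T(n)W_t^n e^{i\langle n,x\rangle}$ and the Fourier multiplier $\mathcal M^T_t$ by $$\widehat{\mathcal M^T_t f}(n)=\Big(\sum_{m\in\mathbb Z^3}\widehat V(n+m)\,\frac{\rho_T(m)^2\rho_t(m)^2}{\langle m\rangle^2}\Big)\widehat f(n).$$ **Proposition 3.8 (random matrix estimate).** Let $\gamma>\max(1-\beta,1/2)$, let $1\le r\le\infty$, let $\frac1r+\frac1{r'}=1$, and define $$\operatorname{Op}^T_t(\gamma,r)=\sup_{\|f_1\|_{\mathbb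 W^{\gamma,r}_x}\le 1,\ \|f_2\|_{\mathbb W^{\gamma,r'}_x}\le 1}\Big[\int_{\mathbb T^3} V*(W^T_tf_1)\;W^T_tf_2\,dx-\int_{\mathbb T^3}(\mathcal M^T_tf_1)\,f_2\,dx\Big].$$ Then there is a constant $C$, depending only on $\beta,V,\rho,\gamma$ and $r$, such that for all $1\le p<\infty$ and all $T,t\ge 0$ the function $\operatorname{Op}^T_t(\gamma,r)$ is (almost everywhere equal to) a random variable and $$\big\|\operatorname{Op}^T_t(\gamma,r)\big\|_{L^p(\Omega)}\le C\,p .$$ -/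

import Mathlib

open MeasureTheory ProbabilityTheory Filter Topology
open scoped ENNReal NNReal ComplexConjugate Real

noncomputable section

namespace RandomMatrix

/-- The torus `𝕋³ = (ℝ / 2πℤ)³`, realised as Mathlib's unit torus `(ℝ / ℤ)³` through
`x ↦ x / 2π`; see `toTorus`. With this identification `UnitAddTorus.mFourier n` is the character
`x ↦ e^{i⟨n,x⟩}`. -/
abbrev Torus3 : Type := UnitAddTorus (Fin 3)

/-- The frequency lattice `ℤ³`. -/
abbrev Freq : Type := Fin 3 → ℤ

/-- The class in `𝕋³ = (ℝ / 2πℤ)³` of a point of `ℝ³`. -/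
def toTorus (x : EuclideanSpace ℝ (Fin 3)) : Torus3 :=
  fun i => ((x i / (2 * π) : ℝ) : UnitAddCircle)

/-- The Lebesgue measure `dx` on `𝕋³`, normalised to have total mass one. -/
def dx : Measure Torus3 := Measure.pi fun _ => AddCircle.haarAddCircle

/-- The Fourier coefficient `∫ f(x) e^{-i⟨n,x⟩} dx` of a real-valued function. -/
def coeff (f : Torus3 → ℝ) (n : Freq) : ℂ :=
  UnitAddTorus.mFourierCoeff (fun x => (f x : ℂ)) n

open scoped ContDiff in
/-- `f ∈ C^∞(𝕋³)`: the periodic function on `ℝ³` that `f` induces is smooth. -/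
def IsSmooth (f : Torus3 → ℝ) : Prop :=
  ContDiff ℝ ∞ fun x : EuclideanSpace ℝ (Fin 3) => f (toTorus x)

/-- The Euclidean norm `‖n‖₂`. -/
def freqNorm (n : Freq) : ℝ := √(∑ i, (n i : ℝ) ^ 2)

/-- The Japanese bracket `⟨y⟩ = (1 + |y|²)^{1/2}` of a real number. -/
def bracket (y : ℝ) : ℝ := √(1 + y ^ 2)

open scoped ContDiff in
/-- The interaction potential: a parameter `β` (with `0 < β < 3` in the theorem) and a function
`V : 𝕋³ → ℝ` which equals `c |x|^{-(3-β)}` near the origin, is bounded below by a positive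
constant, even, and smooth away from the origin. The value at the origin is immaterial. -/
structure IsInteraction (β : ℝ) (V : Torus3 → ℝ) : Prop where
  near_zero : ∃ c : ℝ, 0 < c ∧ ∀ x : EuclideanSpace ℝ (Fin 3),
    x ≠ 0 → ‖x‖ ≤ 1 / 10 → V (toTorus x) = c * ‖x‖ ^ (-(3 - β))
  lower_bound : ∃ c : ℝ, 0 < c ∧ ∀ x : Torus3, x ≠ 0 → c ≤ V x
  even : ∀ x : Torus3, V (-x) = V x
  smooth : ContDiffOn ℝ ∞ (fun x : EuclideanSpace ℝ (Fin 3) => V (toTorus x))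
    {x | toTorus x ≠ 0}

open scoped ContDiff in
/-- The profile `ρ` of the frequency truncations (only its values on `[0, ∞)` matter). -/
structure IsCutoff (ρ : ℝ → ℝ) : Prop where
  smooth : ContDiffOn ℝ ∞ ρ (Set.Ioi 0)
  antitone : AntitoneOn ρ (Set.Ici 0)
  range : ∀ y, 0 ≤ y → ρ y ∈ Set.Icc (0 : ℝ) 1
  eq_one : ∀ y, 0 ≤ y → y ≤ 1 / 4 → ρ y = 1
  eq_zero : ∀ y, 4 ≤ y → ρ y = 0
  lower_bound : ∃ c : ℝ, 0 < c ∧ ∀ y ∈ Set.Icc (1 / 2 : ℝ) 2, c ≤ min (ρ y) (-deriv ρ y)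

/-- `ρ_t(n) = ρ(‖n‖₂ / ⟨t⟩)`. -/
def trunc (ρ : ℝ → ℝ) (t : ℝ) (n : Freq) : ℝ := ρ (freqNorm n / bracket t)

/-- The symbol of the Littlewood-Paley operator `P_N`, `N = 2^k`: it is `χ_1 = ρ_1` and
`χ_N = ρ_N - ρ_{N/2}` for `N ≥ 2`. -/
def chi (ρ : ℝ → ℝ) : ℕ → Freq → ℝ
  | 0, n => trunc ρ 1 n
  | k + 1, n => trunc ρ (2 ^ (k + 1)) n - trunc ρ (2 ^ k) n

/-- The Littlewood-Paley projection `P_N f`, `N = 2^k` (the sum has finitely many terms). -/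
def lpProj (ρ : ℝ → ℝ) (k : ℕ) (f : Torus3 → ℝ) (x : Torus3) : ℂ :=
  ∑' n : Freq, (chi ρ k n : ℂ) * coeff f n * UnitAddTorus.mFourier n x

/-- The norm `‖f‖_{𝕎^{s,r}} = ‖N^s P_N f‖_{ℓ^r_N L^r_x}`, where `N = 2^k`, `k = 0, 1, 2, …`. -/
def sobolevNorm (ρ : ℝ → ℝ) (s : ℝ) (r : ℝ≥0∞) (f : Torus3 → ℝ) : ℝ≥0∞ :=
  eLpNorm (fun k : ℕ => ENNReal.ofReal (((2 : ℝ) ^ k) ^ s) * eLpNorm (lpProj ρ k f) r dx)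
    r Measure.count

/-- The space `𝕎^{s,r}(𝕋³)` for `s > 0`, i.e. the completion of `C^∞(𝕋³)` under the above norm.
Since that norm controls the `L^r` norm when `s > 0`, the completion is the set of all `f ∈ L^r`
which are limits of smooth functions in the norm. -/
def MemSobolev (ρ : ℝ → ℝ) (s : ℝ) (r : ℝ≥0∞) (f : Torus3 → ℝ) : Prop :=
  MemLp f r dx ∧ ∃ g : ℕ → Torus3 → ℝ, (∀ j, IsSmooth (g j)) ∧
    Tendsto (fun j => sobolevNorm ρ s r (f - g j)) atTop (𝓝 0)

open Classical in
/-- The Fourier multiplier with symbol `m`: the integrable function `g`, unique up to null sets,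
with `ĝ(n) = m(n) f̂(n)` for all `n` (and `0` if there is none). -/
def multiplier (m : Freq → ℂ) (f : Torus3 → ℝ) : Torus3 → ℝ :=
  if h : ∃ g : Torus3 → ℝ, Integrable g dx ∧ ∀ n, coeff g n = m n * coeff f n
  then h.choose else 0

/-- The symbol `n ↦ ∑_m V̂(n+m) ρ^T_t(m)² / ⟨m⟩²` of the renormalization multiplier, where
`ρ^T_t = ρ_T ρ_t` (the sum has finitely many terms). -/
def renormSymbol (ρ : ℝ → ℝ) (V : Torus3 → ℝ) (T t : ℝ≥0) (n : Freq) : ℂ :=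
  ∑' m : Freq, coeff V (n + m) *
    (((trunc ρ T m * trunc ρ t m) ^ 2 / bracket (freqNorm m) ^ 2 : ℝ) : ℂ)

/-- The renormalised bilinear form of a field `w`,
`∫ (V * (w f₁)) w f₂ dx - ∫ (𝓜^T_t f₁) f₂ dx`. -/
def renormForm (ρ : ℝ → ℝ) (V : Torus3 → ℝ) (T t : ℝ≥0) (w f₁ f₂ : Torus3 → ℝ) : ℝ :=
  (∫ x, convolution V (w * f₁) (ContinuousLinearMap.mul ℝ ℝ) dx x * (w x * f₂ x) ∂dx)
    - ∫ x, multiplier (renormSymbol ρ V T t) f₁ x * f₂ x ∂dx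

/-- The Gaussian process `(W_t^n)` of Fourier modes, through its law: the family is jointly
Gaussian and centred, `W_t^{-n}` is the complex conjugate of `W_t^n`, and
`𝔼[W_s^n conj (W_t^m)] = 1{n = m} ρ_{min(s,t)}(n)² / ⟨n⟩²`. In particular the increments in `t` are
independent, modes `n ≠ ±m` are independent, and `W_t` has covariance `ρ_t(∇)² (1-Δ)⁻¹`. -/
structure IsFieldProcess (ρ : ℝ → ℝ) {Ω : Type*} [MeasurableSpace Ω] (P : Measure Ω)
    (W : ℝ≥0 → Freq → Ω → ℂ) : Prop where
  gaussian : IsGaussianProcess (fun i : ℝ≥0 × Freq => W i.1 i.2) P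
  centred : ∀ t n, ∫ ω, W t n ω ∂P = 0
  conj_symm : ∀ t n, ∀ᵐ ω ∂P, W t (-n) ω = conj (W t n ω)
  covariance : ∀ s t n m, ∫ ω, W s n ω * conj (W t m ω) ∂P =
    if n = m then ((trunc ρ (min s t : ℝ≥0) n ^ 2 / bracket (freqNorm n) ^ 2 : ℝ) : ℂ) else 0

/-- The truncated field `W^T_t(x) = ∑_n ρ_T(n) W_t^n e^{i⟨n,x⟩}`. The sum has finitely many terms,
and it is almost surely real, so that taking the real part changes nothing. -/
def truncField (ρ : ℝ → ℝ) {Ω : Type*} (W : ℝ≥0 → Freq → Ω → ℂ) (T t : ℝ≥0) (ω : Ω)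
    (x : Torus3) : ℝ :=
  (∑' n : Freq, (trunc ρ T n : ℂ) * W t n ω * UnitAddTorus.mFourier n x).re

/-- The random variable `Op^T_t(γ, r)` with values in `[0, ∞]`, the supremum of the renormalised
bilinear form over the unit balls of `𝕎^{γ,r}` and `𝕎^{γ,r'}`. As `f₁ = f₂ = 0` is admissible,
the supremum is non-negative, and negative values of the form may be replaced by `0`. -/
def opNorm (ρ : ℝ → ℝ) (V : Torus3 → ℝ) (γ : ℝ) (r r' : ℝ≥0∞) {Ω : Type*}
    (W : ℝ≥0 → Freq → Ω → ℂ) (T t : ℝ≥0) (ω : Ω) : ℝ≥0∞ :=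
  ⨆ (f₁ : Torus3 → ℝ) (f₂ : Torus3 → ℝ)
    (_ : MemSobolev ρ γ r f₁ ∧ sobolevNorm ρ γ r f₁ ≤ 1)
    (_ : MemSobolev ρ γ r' f₂ ∧ sobolevNorm ρ γ r' f₂ ≤ 1),
    ENNReal.ofReal (renormForm ρ V T t (truncField ρ W T t ω) f₁ f₂)

end RandomMatrix

end

/-! Let `a_n` be the Fourier modes of the truncated field. The renormalising multiplier is
convolution with `V` times the covariance function of the field, so the form equals `∫ V(z) ∫ K(z,x)
f₁(x-z) f₂(x) dx dz` with the centred kernel `K(z,x) = ∑ (a_n a_m - 𝔼[a_n a_m]) e_n(x-z) e_m(x)`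
(`ofReal_renorm_eq_pairing`). For fixed `z`, Hölder's inequality and translation invariance bound
the inner integral by `sup_x |K(z,x)|` times the `L^r` and `L^{r'}` norms of the functions. Thus all
`r` are treated at once, and only a random function has to be estimated.

At a point, `K` is a Gaussian chaos of order two, whose `2m`-th moment is at most `(C m)^{2m}` times
the `m`-th power of a variance (`lintegral_enorm_chaos_pow_le`). Nikolskii's inequality turns this
into a bound for the supremum. For `m` large its polynomial loss is only a factor `2^{ε(k₁+k₂)}`.

The sizes are balanced after a dyadic decomposition into field frequencies `n`, `m` of sizes
`2^{k₁}`, `2^{k₂}` and function frequencies `a`, `b` of sizes `2^{j₁}`, `2^{j₂}`. Only quadruples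
with `n + a + m + b = 0` contribute, and `V` enters through its coefficient at `n + a`. If a field
frequency of size `2^k` dominates its partner, then `n + a` has size `2^k`, and `V` may be replaced
by a function with the same coefficients there and `L¹` norm of order `2^{-ϑk}`. This holds for `ϑ ≤
1`, `0 < ϑ < β`, because `V` has `L¹` modulus of continuity `|h|^ϑ`; the low frequencies are removed
with a Jackson kernel. If both field frequencies dominate, `n + m = -(a + b)` is also small, which
cuts down the variance. The remaining losses are `2^{(k₁+k₂)/2}` when no field frequency dominates,
which `γ > 1/2` absorbs, and a power `1 - ϑ` of the function frequencies otherwise, where `γ > 1 -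
β` permits a choice with `1 - ϑ < γ` (`exists_localized_kernel`).

What is left decays geometrically in all four indices. Minkowski's inequality sums the moments to
`(C m)^{2m}`, and `m` comparable to `p` gives linear growth. -/

noncomputable section

namespace RandomMatrix

/-! ### Even moments of real and complex Gaussian variables -/

section GaussianMoments

/-- The Taylor term of order `2m` of `e^{|sx|}` controls `x^{2m}`, and exponential moments are
explicit. The choice `s² = 2m` balances `(2m)!/s^{2m} ≤ (2m)^m` against `e^{s²/2} = e^m`. -/
lemma lintegral_enorm_pow_gaussianReal_one_le {m : ℕ} (hm : 1 ≤ m) :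
    ∫⁻ x : ℝ, ‖x‖ₑ ^ (2 * m) ∂(gaussianReal 0 1) ≤ ENNReal.ofReal ((12 * m) ^ m) := by
  have hm' : (0 : ℝ) < 2 * m := by positivity
  set s : ℝ := √(2 * m) with hs
  have hs2 : s ^ 2 = 2 * m := Real.sq_sqrt hm'.le
  have hpt (x : ℝ) : x ^ (2 * m) ≤
      (2 * m) ^ m * (Real.exp (s * x) + Real.exp (-s * x)) := by
    have h1 : |s * x| ^ (2 * m) / (2 * m).factorial ≤ Real.exp |s * x| :=
      Real.pow_div_factorial_le_exp _ (abs_nonneg _) _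
    rw [div_le_iff₀ (by positivity)] at h1
    have h2 : |s * x| ^ (2 * m) = (2 * m : ℝ) ^ m * x ^ (2 * m) := by
      rw [pow_mul, sq_abs, mul_pow, hs2, mul_pow, pow_mul]
    have h3 : Real.exp |s * x| ≤ Real.exp (s * x) + Real.exp (-s * x) := by
      rcases abs_cases (s * x) with ⟨h, -⟩ | ⟨h, -⟩ <;> rw [h]
      · linarith [Real.exp_pos (-s * x)]
      · rw [neg_mul]; linarith [Real.exp_pos (s * x)]
    have h4 : ((2 * m).factorial : ℝ) ≤ (2 * m : ℝ) ^ m * (2 * m : ℝ) ^ m := by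
      have := Nat.factorial_le_pow (2 * m)
      calc ((2 * m).factorial : ℝ) ≤ ((2 * m : ℕ) : ℝ) ^ (2 * m) := by exact_mod_cast this
        _ = _ := by push_cast; ring
    rw [h2] at h1
    have h5 := h1.trans (mul_le_mul h3 h4 (by positivity) (by positivity))
    have : (0 : ℝ) < (2 * m : ℝ) ^ m := by positivity
    refine le_of_mul_le_mul_left (h5.trans (le_of_eq ?_)) this
    ring
  have hexp (t : ℝ) : ∫⁻ x : ℝ, ENNReal.ofReal (Real.exp (t * x)) ∂(gaussianReal 0 1)
      = ENNReal.ofReal (Real.exp (t ^ 2 / 2)) := by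
    rw [← ofReal_integral_eq_lintegral_ofReal (integrable_exp_mul_gaussianReal t)
      (ae_of_all _ fun x => (Real.exp_pos _).le)]
    have := congr_fun (mgf_fun_id_gaussianReal (μ := 0) (v := 1)) t
    simp only [mgf, zero_mul, NNReal.coe_one, one_mul, zero_add] at this
    rw [this]
  calc ∫⁻ x : ℝ, ‖x‖ₑ ^ (2 * m) ∂(gaussianReal 0 1)
      ≤ ∫⁻ x : ℝ, ENNReal.ofReal ((2 * m) ^ m) * (ENNReal.ofReal (Real.exp (s * x))
          + ENNReal.ofReal (Real.exp (-s * x))) ∂(gaussianReal 0 1) := by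
        refine lintegral_mono fun x => ?_
        rw [← ENNReal.ofReal_add (Real.exp_pos _).le (Real.exp_pos _).le,
          ← ENNReal.ofReal_mul (by positivity), ← ofReal_norm, ← ENNReal.ofReal_pow (norm_nonneg _)]
        refine ENNReal.ofReal_le_ofReal ?_
        rw [Real.norm_eq_abs, pow_mul, sq_abs, ← pow_mul]
        exact hpt x
    _ = ENNReal.ofReal ((2 * m) ^ m * (Real.exp m + Real.exp m)) := by
        rw [lintegral_const_mul _ (by fun_prop), lintegral_add_left (by fun_prop), hexp, hexp,
          ← ENNReal.ofReal_add (Real.exp_pos _).le (Real.exp_pos _).le,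
          ← ENNReal.ofReal_mul (by positivity)]
        rw [neg_sq, hs2]
        congr 4 <;> ring
    _ ≤ _ := by
        refine ENNReal.ofReal_le_ofReal ?_
        have he : Real.exp m ≤ 3 ^ m := by
          rw [← mul_one (m : ℝ), Real.exp_nat_mul]
          exact pow_le_pow_left₀ (Real.exp_pos _).le (by linarith [Real.exp_one_lt_d9]) _
        have h2 : (2 : ℝ) ≤ 2 ^ m := by
          simpa using pow_le_pow_right₀ (by norm_num : (1 : ℝ) ≤ 2) hm
        calc (2 * m : ℝ) ^ m * (Real.exp m + Real.exp m) ≤ (2 * m) ^ m * (2 ^ m * 3 ^ m) := by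
              gcongr; nlinarith [pow_pos (by norm_num : (0 : ℝ) < 3) m]
          _ = _ := by rw [← mul_pow, ← mul_pow]; congr 1; ring

lemma lintegral_enorm_pow_gaussianReal_le {m : ℕ} (hm : 1 ≤ m) (v : ℝ≥0) :
    ∫⁻ x : ℝ, ‖x‖ₑ ^ (2 * m) ∂(gaussianReal 0 v) ≤ ENNReal.ofReal ((12 * m * v) ^ m) := by
  have h : gaussianReal 0 v = (gaussianReal 0 1).map (√v * ·) := by
    rw [gaussianReal_map_const_mul, mul_zero]
    congr 1
    ext
    simp
  rw [h, lintegral_map (by fun_prop) (by fun_prop)]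
  simp_rw [enorm_mul, mul_pow]
  rw [lintegral_const_mul _ (by fun_prop)]
  refine (mul_le_mul_right (lintegral_enorm_pow_gaussianReal_one_le hm) _).trans (le_of_eq ?_)
  rw [← ofReal_norm, ← ENNReal.ofReal_pow (norm_nonneg _), ← ENNReal.ofReal_mul (by positivity),
    Real.norm_eq_abs, pow_mul, sq_abs, Real.sq_sqrt v.coe_nonneg, mul_comm, ← mul_pow]
  rw [mul_pow, mul_pow]

variable {Ω : Type*} [MeasurableSpace Ω] {P : Measure Ω}

lemma lintegral_enorm_pow_le_of_hasGaussianLaw_real {X : Ω → ℝ} (hX : HasGaussianLaw X P)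
    (h0 : ∫ ω, X ω ∂P = 0) {m : ℕ} (hm : 1 ≤ m) :
    ∫⁻ ω, ‖X ω‖ₑ ^ (2 * m) ∂P ≤ ENNReal.ofReal ((12 * m * ∫ ω, X ω ^ 2 ∂P) ^ m) := by
  have := hX.isProbabilityMeasure
  have h := lintegral_enorm_pow_gaussianReal_le hm (Var[X; P]).toNNReal
  have hlaw := hX.map_eq_gaussianReal
  rw [h0] at hlaw
  rw [← hlaw, lintegral_map' (by fun_prop) hX.aemeasurable,
    Real.coe_toNNReal _ (variance_nonneg _ _),
    variance_of_integral_eq_zero hX.aemeasurable h0] at h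
  exact h

/-- Real and imaginary parts are real Gaussian, each with variance at most that of `Z`; their
dependence is irrelevant. Convexity and the two summands each cost at most `2^m`, whence `48 = 4 ·
12`. -/
lemma lintegral_enorm_pow_le_of_hasGaussianLaw {Z : Ω → ℂ} (hZ : HasGaussianLaw Z P)
    (h0 : ∫ ω, Z ω ∂P = 0) {m : ℕ} (hm : 1 ≤ m) :
    ∫⁻ ω, ‖Z ω‖ₑ ^ (2 * m) ∂P ≤ ENNReal.ofReal ((48 * m * ∫ ω, ‖Z ω‖ ^ 2 ∂P) ^ m) := by
  have := hZ.isProbabilityMeasure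
  have hint : Integrable Z P := hZ.integrable
  have hL2 : Integrable (fun ω => ‖Z ω‖ ^ 2) P := hZ.memLp_two.integrable_norm_pow two_ne_zero
  have hre0 : ∫ ω, (Z ω).re ∂P = 0 := by
    have := integral_re (𝕜 := ℂ) hint
    simpa [h0] using this
  have him0 : ∫ ω, (Z ω).im ∂P = 0 := by
    have := integral_im (𝕜 := ℂ) hint
    simpa [h0] using this
  have hre : HasGaussianLaw (fun ω => (Z ω).re) P := hZ.map_fun Complex.reCLM
  have him : HasGaussianLaw (fun ω => (Z ω).im) P := hZ.map_fun Complex.imCLM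
  set v := ∫ ω, ‖Z ω‖ ^ 2 ∂P with hv
  have hv0 : 0 ≤ v := integral_nonneg fun _ => by positivity
  have hsq (z : ℂ) : ‖z‖ ^ 2 = z.re ^ 2 + z.im ^ 2 := by
    rw [← Complex.normSq_eq_norm_sq, Complex.normSq_apply]; ring
  have hvre : ∫ ω, (Z ω).re ^ 2 ∂P ≤ v :=
    integral_mono hre.memLp_two.integrable_sq hL2 fun ω => by
      simp only [hsq]; nlinarith [sq_nonneg (Z ω).im]
  have hvim : ∫ ω, (Z ω).im ^ 2 ∂P ≤ v :=
    integral_mono him.memLp_two.integrable_sq hL2 fun ω => by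
      simp only [hsq]; nlinarith [sq_nonneg (Z ω).re]
  have bound {X : Ω → ℝ} (hX : HasGaussianLaw X P) (h0 : ∫ ω, X ω ∂P = 0)
      (hXv : ∫ ω, X ω ^ 2 ∂P ≤ v) :
      ∫⁻ ω, ‖X ω‖ₑ ^ (2 * m) ∂P ≤ ENNReal.ofReal ((12 * m * v) ^ m) := by
    refine (lintegral_enorm_pow_le_of_hasGaussianLaw_real hX h0 hm).trans
      (ENNReal.ofReal_le_ofReal ?_)
    have : 0 ≤ ∫ ω, X ω ^ 2 ∂P := integral_nonneg fun _ => by positivity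
    gcongr
  have hpt (z : ℂ) : ‖z‖ₑ ^ (2 * m) ≤
      2 ^ m * (‖z.re‖ₑ ^ (2 * m) + ‖z.im‖ₑ ^ (2 * m)) := by
    rw [← ofReal_norm, ← ofReal_norm, ← ofReal_norm, ← ENNReal.ofReal_pow (norm_nonneg _),
      ← ENNReal.ofReal_pow (norm_nonneg _), ← ENNReal.ofReal_pow (norm_nonneg _),
      ← ENNReal.ofReal_add (by positivity) (by positivity),
      show (2 : ℝ≥0∞) ^ m = ENNReal.ofReal (2 ^ m) by
        rw [ENNReal.ofReal_pow (by norm_num)]; simp,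
      ← ENNReal.ofReal_mul (by positivity)]
    refine ENNReal.ofReal_le_ofReal ?_
    rw [pow_mul, hsq, Real.norm_eq_abs, Real.norm_eq_abs, pow_mul, pow_mul, sq_abs, sq_abs]
    refine (add_pow_le (sq_nonneg _) (sq_nonneg _) m).trans ?_
    gcongr
    · norm_num
    · omega
  calc ∫⁻ ω, ‖Z ω‖ₑ ^ (2 * m) ∂P
      ≤ ∫⁻ ω, 2 ^ m * (‖(Z ω).re‖ₑ ^ (2 * m) + ‖(Z ω).im‖ₑ ^ (2 * m)) ∂P :=
        lintegral_mono fun ω => hpt _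
    _ ≤ 2 ^ m * (ENNReal.ofReal ((12 * m * v) ^ m) + ENNReal.ofReal ((12 * m * v) ^ m)) := by
        have hm1 : AEMeasurable (fun ω => ‖(Z ω).re‖ₑ ^ (2 * m)) P :=
          hre.aemeasurable.enorm.pow_const _
        have hm2 : AEMeasurable (fun ω => ‖(Z ω).im‖ₑ ^ (2 * m)) P :=
          him.aemeasurable.enorm.pow_const _
        rw [lintegral_const_mul' _ _ (by finiteness), lintegral_add_left' hm1]
        gcongr
        · exact bound hre hre0 hvre
        · exact bound him him0 hvim
    _ ≤ _ := by
        rw [← two_mul, show (2 : ℝ≥0∞) = ENNReal.ofReal 2 by simp,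
          ← ENNReal.ofReal_pow (by norm_num), ← ENNReal.ofReal_mul (by norm_num),
          ← ENNReal.ofReal_mul (by positivity)]
        refine ENNReal.ofReal_le_ofReal ?_
        have h2 : (2 : ℝ) ≤ 2 ^ m := by
          simpa using pow_le_pow_right₀ (by norm_num : (1 : ℝ) ≤ 2) hm
        calc (2 : ℝ) ^ m * (2 * (12 * m * v) ^ m) ≤ 2 ^ m * (2 ^ m * (12 * m * v) ^ m) := by
              gcongr
          _ = _ := by rw [← mul_pow, ← mul_pow]; congr 1; ring

end GaussianMoments

/-! ### Jensen and Minkowski inequalities for natural powers -/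

section Minkowski

variable {α : Type*} [MeasurableSpace α] {μ : Measure α}

/-- Jensen's inequality with the total mass kept, since it will be applied to measures `|U(z)| dz`
that are not normalised. -/
lemma lintegral_pow_le_of_measure {f : α → ℝ≥0∞} (hf : AEMeasurable f μ) {m : ℕ} (hm : 1 ≤ m) :
    (∫⁻ x, f x ∂μ) ^ m ≤ μ Set.univ ^ (m - 1) * ∫⁻ x, f x ^ m ∂μ := by
  have hm0 : (m : ℝ) ≠ 0 := by positivity
  have h := eLpNorm'_le_eLpNorm'_mul_rpow_measure_univ (p := 1) (q := m) one_pos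
    (by exact_mod_cast hm) (hf.aestronglyMeasurable)
  simp only [eLpNorm', enorm_eq_self, ENNReal.rpow_one, ENNReal.rpow_natCast, div_one] at h
  calc (∫⁻ x, f x ∂μ) ^ m
      ≤ ((∫⁻ x, f x ^ m ∂μ) ^ (1 / (m : ℝ)) * μ Set.univ ^ (1 - 1 / (m : ℝ))) ^ m := by
        gcongr
    _ = _ := by
        rw [mul_pow, ← ENNReal.rpow_natCast, ← ENNReal.rpow_natCast, ← ENNReal.rpow_mul,
          ← ENNReal.rpow_mul, one_div_mul_cancel hm0, ENNReal.rpow_one, mul_comm, sub_mul,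
          one_div_mul_cancel hm0, one_mul, ← ENNReal.rpow_natCast]
        congr 2
        rw [Nat.cast_sub hm, Nat.cast_one]

lemma lintegral_sum_pow_le {ι : Type*} (s : Finset ι) {f : ι → α → ℝ≥0∞}
    (hf : ∀ i, AEMeasurable (f i) μ) {A : ι → ℝ≥0∞} {m : ℕ} (hm : 1 ≤ m)
    (h : ∀ i ∈ s, ∫⁻ x, f i x ^ m ∂μ ≤ A i ^ m) :
    ∫⁻ x, (∑ i ∈ s, f i x) ^ m ∂μ ≤ (∑ i ∈ s, A i) ^ m := by
  have hm0 : (m : ℝ) ≠ 0 := by positivity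
  have h1 := eLpNorm'_sum_le (s := s) (f := f) (μ := μ) (q := m)
    (fun i _ => (hf i).aestronglyMeasurable) (by exact_mod_cast hm)
  simp only [eLpNorm', enorm_eq_self, ENNReal.rpow_natCast, Finset.sum_apply] at h1
  have h2 : ∀ i ∈ s, (∫⁻ x, f i x ^ m ∂μ) ^ (1 / (m : ℝ)) ≤ A i := fun i hi => by
    rw [one_div, ENNReal.rpow_inv_le_iff (by positivity), ENNReal.rpow_natCast]
    exact h i hi
  have h3 := h1.trans (Finset.sum_le_sum h2)
  rwa [one_div, ENNReal.rpow_inv_le_iff (by positivity), ENNReal.rpow_natCast] at h3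

/-- Minkowski's inequality passes from finite to countable sums by monotone convergence along the
directed family of finite subsets. -/
lemma lintegral_tsum_pow_le {ι : Type*} [Countable ι] {f : ι → α → ℝ≥0∞}
    (hf : ∀ i, AEMeasurable (f i) μ) {A : ι → ℝ≥0∞} {m : ℕ} (hm : 1 ≤ m)
    (h : ∀ i, ∫⁻ x, f i x ^ m ∂μ ≤ A i ^ m) :
    ∫⁻ x, (∑' i, f i x) ^ m ∂μ ≤ (∑' i, A i) ^ m := by
  have hmono : Monotone fun y : ℝ≥0∞ => y ^ m := fun a b hab => by dsimp only; gcongr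
  have hx (x : α) : (∑' i, f i x) ^ m = ⨆ s : Finset ι, (∑ i ∈ s, f i x) ^ m := by
    rw [ENNReal.tsum_eq_iSup_sum]
    exact hmono.map_iSup_of_continuousAt (ENNReal.continuous_pow m).continuousAt
      (by simp [Nat.ne_of_gt hm])
  simp_rw [hx]
  rw [lintegral_iSup_directed
    fun s => (Finset.aemeasurable_fun_sum s fun i _ => hf i).pow_const m]
  · refine iSup_le fun s => (lintegral_sum_pow_le s hf hm fun i _ => h i).trans ?_
    gcongr
    exact ENNReal.sum_le_tsum s
  · classical
    refine directed_of_isDirected_le fun s t hst x => ?_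
    dsimp only
    gcongr

end Minkowski

/-- The square of a centred Gaussian measure is invariant under the rotation by `π / 4`. -/
lemma lintegral_prod_rotation {E : Type*} [NormedAddCommGroup E] [NormedSpace ℝ E]
    [CompleteSpace E] [SecondCountableTopology E] [MeasurableSpace E] [BorelSpace E]
    (μ : Measure E) [IsGaussian μ] (h0 : ∫ x, x ∂μ = 0) (f : E × E → ℝ≥0∞) (hf : Measurable f) :
    ∫⁻ p, f p ∂(μ.prod μ) = ∫⁻ p, f ((√2)⁻¹ • (p.1 + p.2), (√2)⁻¹ • (p.2 - p.1)) ∂(μ.prod μ) := by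
  conv_lhs => rw [← IsGaussian.map_rotation_eq_self (μ := μ) h0 (π / 4)]
  rw [lintegral_map hf (by fun_prop)]
  refine lintegral_congr fun p => ?_
  have h2 : √2 / 2 = (√2)⁻¹ := by
    rw [div_eq_iff two_ne_zero, eq_comm, inv_mul_eq_iff_eq_mul₀ (by positivity)]
    simp
  rw [ContinuousLinearMap.rotation_apply, Real.cos_pi_div_four, Real.sin_pi_div_four, h2]
  congr 2
  · rw [smul_add]
  · rw [smul_sub, neg_smul]; abel

/-! ### Gaussian chaos of order two -/

section Chaos

variable {ι : Type*} [Fintype ι] {μ : Measure (ι → ℂ)} [IsGaussian μ]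

lemma memLp_two_eval (i : ι) : MemLp (fun w : ι → ℂ => w i) 2 μ :=
  (IsGaussian.hasGaussianLaw_id (μ := μ)).map_fun
    (ContinuousLinearMap.proj (R := ℝ) (φ := fun _ : ι => ℂ) i) |>.memLp_two

lemma integrable_eval_mul_eval (i j : ι) : Integrable (fun w : ι → ℂ => w i * w j) μ :=
  (memLp_two_eval i).integrable_mul (memLp_two_eval j)

lemma integrable_eval_mul_conj_eval (i j : ι) :
    Integrable (fun w : ι → ℂ => w i * conj (w j)) μ :=
  (memLp_two_eval i).integrable_mul (memLp_two_eval j).star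

lemma integral_eval_eq_zero (h0 : ∫ w, w ∂μ = 0) (i : ι) : ∫ w, w i ∂μ = 0 := by
  have h := (ContinuousLinearMap.proj (R := ℝ) (φ := fun _ : ι => ℂ) i).integral_comp_comm
    (IsGaussian.integrable_id (μ := μ))
  simpa [h0] using h

variable [DecidableEq ι] {s : ι → ℝ}

lemma integral_norm_sq_linear
    (hcov : ∀ i j, ∫ w, w i * conj (w j) ∂μ = if i = j then (s i : ℂ) else 0) (c : ι → ℂ) :
    ∫ w, ‖∑ i, c i * w i‖ ^ 2 ∂μ = ∑ i, s i * ‖c i‖ ^ 2 := by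
  have h (w : ι → ℂ) : ((‖∑ i, c i * w i‖ ^ 2 : ℝ) : ℂ)
      = ∑ i, ∑ j, c i * conj (c j) * (w i * conj (w j)) := by
    rw [← Complex.normSq_eq_norm_sq, ← Complex.mul_conj, map_sum, Finset.sum_mul_sum]
    refine Finset.sum_congr rfl fun i _ => Finset.sum_congr rfl fun j _ => ?_
    rw [map_mul]; ring
  have h2 : ((∫ w, ‖∑ i, c i * w i‖ ^ 2 ∂μ : ℝ) : ℂ) = ((∑ i, s i * ‖c i‖ ^ 2 : ℝ) : ℂ) := by
    rw [← integral_complex_ofReal]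
    simp_rw [h]
    rw [integral_finsetSum _ fun i _ => integrable_finsetSum _ fun j _ =>
      (integrable_eval_mul_conj_eval i j).const_mul _]
    push_cast
    refine Finset.sum_congr rfl fun i _ => ?_
    rw [integral_finsetSum _ fun j _ => (integrable_eval_mul_conj_eval i j).const_mul _]
    simp_rw [integral_const_mul, hcov]
    simp [Complex.mul_conj, Complex.normSq_eq_norm_sq, mul_comm]
  exact_mod_cast h2

lemma lintegral_enorm_linear_pow_le (h0 : ∫ w, w ∂μ = 0)
    (hcov : ∀ i j, ∫ w, w i * conj (w j) ∂μ = if i = j then (s i : ℂ) else 0) (c : ι → ℂ)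
    {m : ℕ} (hm : 1 ≤ m) :
    ∫⁻ w, ‖∑ i, c i * w i‖ₑ ^ (2 * m) ∂μ
      ≤ ENNReal.ofReal (48 * m * ∑ i, s i * ‖c i‖ ^ 2) ^ m := by
  have hs : 0 ≤ ∑ i, s i * ‖c i‖ ^ 2 := by
    rw [← integral_norm_sq_linear hcov]
    exact integral_nonneg fun _ => by positivity
  have hlaw : HasGaussianLaw (fun w : ι → ℂ => ∑ i, c i * w i) μ := by
    have := (IsGaussian.hasGaussianLaw_id (μ := μ)).map_fun
      (∑ i, (c i) • (ContinuousLinearMap.proj (R := ℝ) (φ := fun _ : ι => ℂ) i))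
    simpa using this
  have hz : ∫ w : ι → ℂ, ∑ i, c i * w i ∂μ = 0 := by
    rw [integral_finsetSum _ fun i _ =>
      ((memLp_two_eval i).integrable one_le_two).const_mul _]
    simp [integral_const_mul, integral_eval_eq_zero h0]
  refine (lintegral_enorm_pow_le_of_hasGaussianLaw hlaw hz hm).trans (le_of_eq ?_)
  rw [integral_norm_sq_linear hcov, ENNReal.ofReal_pow (by positivity)]

/-- Moment bound for a decoupled Gaussian chaos of order two. -/
lemma lintegral_enorm_bilinear_pow_le (h0 : ∫ w, w ∂μ = 0) (hs : ∀ i, 0 ≤ s i)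
    (hcov : ∀ i j, ∫ w, w i * conj (w j) ∂μ = if i = j then (s i : ℂ) else 0) (b : ι → ι → ℂ)
    {m : ℕ} (hm : 1 ≤ m) :
    ∫⁻ v, ∫⁻ u, ‖∑ i, ∑ j, b i j * u i * v j‖ₑ ^ (2 * m) ∂μ ∂μ
      ≤ ENNReal.ofReal ((48 * m) ^ 2 * ∑ i, ∑ j, s i * s j * ‖b i j‖ ^ 2) ^ m := by
  have h1 (v : ι → ℂ) : ∫⁻ u, ‖∑ i, ∑ j, b i j * u i * v j‖ₑ ^ (2 * m) ∂μ
      ≤ (∑ i, ENNReal.ofReal (48 * m * s i) * ‖∑ j, b i j * v j‖ₑ ^ 2) ^ m := by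
    -- For frozen `v` the form is a linear Gaussian variable in `u`, and its variance is a weighted
    -- sum of squares of linear forms in `v`.
    have := lintegral_enorm_linear_pow_le h0 hcov (fun i => ∑ j, b i j * v j) hm
    simp_rw [Finset.sum_mul] at this
    have e (u : ι → ℂ) (i j : ι) : b i j * v j * u i = b i j * u i * v j := by ring
    simp_rw [e] at this
    refine this.trans (le_of_eq ?_)
    congr 1
    rw [Finset.mul_sum, ENNReal.ofReal_sum_of_nonneg fun i _ => by have := hs i; positivity]
    refine Finset.sum_congr rfl fun i _ => ?_
    rw [← mul_assoc, ENNReal.ofReal_mul (by have := hs i; positivity),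
      ENNReal.ofReal_pow (norm_nonneg _), ofReal_norm]
  refine (lintegral_mono h1).trans ?_
  -- Minkowski's inequality in `L^m` for these squares: each summand only needs the `2m`-th moment
  -- of a linear form in `v`.
  refine (lintegral_sum_pow_le (A := fun i => ENNReal.ofReal (48 * m * s i) *
    ENNReal.ofReal (48 * m * ∑ j, s j * ‖b i j‖ ^ 2)) Finset.univ (fun i => ?_) hm
    fun i _ => ?_).trans ?_
  · have : Continuous fun v : ι → ℂ => ∑ j, b i j * v j := by fun_prop
    exact ((this.measurable.enorm.pow_const 2).const_mul _).aemeasurable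
  · simp_rw [mul_pow, ← pow_mul]
    rw [lintegral_const_mul' _ _ (by finiteness)]
    gcongr
    exact lintegral_enorm_linear_pow_le h0 hcov _ hm
  · refine le_of_eq ?_
    congr 1
    rw [Finset.mul_sum, ENNReal.ofReal_sum_of_nonneg fun i _ => mul_nonneg (by positivity)
      (Finset.sum_nonneg fun j _ => by have := hs i; have := hs j; positivity)]
    refine Finset.sum_congr rfl fun i _ => ?_
    rw [← ENNReal.ofReal_mul (by have := hs i; positivity)]
    congr 1
    simp_rw [mul_assoc (s i), ← Finset.mul_sum]
    ring

/-- Moment bound for a Gaussian chaos of order two. -/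
lemma lintegral_enorm_chaos_pow_le (h0 : ∫ w, w ∂μ = 0) (hs : ∀ i, 0 ≤ s i)
    (hcov : ∀ i j, ∫ w, w i * conj (w j) ∂μ = if i = j then (s i : ℂ) else 0) (b : ι → ι → ℂ)
    {m : ℕ} (hm : 1 ≤ m) :
    ∫⁻ w, ‖∑ i, ∑ j, b i j * (w i * w j - ∫ w', w' i * w' j ∂μ)‖ₑ ^ (2 * m) ∂μ
      ≤ ENNReal.ofReal ((192 * m) ^ 2 * ∑ i, ∑ j, s i * s j * ‖b i j‖ ^ 2) ^ m := by
  set B : (ι → ℂ) → (ι → ℂ) → ℂ := fun u v => ∑ i, ∑ j, b i j * u i * v j with hB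
  have hBc : Continuous fun p : (ι → ℂ) × (ι → ℂ) => B p.1 p.2 := by fun_prop
  have hQint : Integrable (fun w => B w w) μ := by
    refine integrable_finsetSum _ fun i _ => integrable_finsetSum _ fun j _ => ?_
    simp_rw [mul_assoc]
    exact (integrable_eval_mul_eval i j).const_mul _
  -- Centring is averaging over an independent copy, so that Jensen's inequality reduces matters to
  -- `B(w,w) - B(w',w')`.
  have hsub (w : ι → ℂ) : ∑ i, ∑ j, b i j * (w i * w j - ∫ w', w' i * w' j ∂μ)
      = ∫ w', (B w w - B w' w') ∂μ := by
    rw [integral_sub (integrable_const _) hQint]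
    simp only [hB, integral_const, probReal_univ, one_smul]
    rw [integral_finsetSum _ fun i _ => integrable_finsetSum _ fun j _ => by
      simp_rw [mul_assoc]; exact (integrable_eval_mul_eval i j).const_mul _]
    rw [← Finset.sum_sub_distrib]
    refine Finset.sum_congr rfl fun i _ => ?_
    rw [integral_finsetSum _ fun j _ => by
      simp_rw [mul_assoc]; exact (integrable_eval_mul_eval i j).const_mul _,
      ← Finset.sum_sub_distrib]
    refine Finset.sum_congr rfl fun j _ => ?_
    simp_rw [mul_assoc]
    rw [integral_const_mul, mul_sub]
  have hjensen (w : ι → ℂ) :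
      ‖∑ i, ∑ j, b i j * (w i * w j - ∫ w', w' i * w' j ∂μ)‖ₑ ^ (2 * m)
      ≤ ∫⁻ w', ‖B w w - B w' w'‖ₑ ^ (2 * m) ∂μ := by
    rw [hsub]
    have h1 : ‖∫ w', (B w w - B w' w') ∂μ‖ₑ ≤ ∫⁻ w', ‖B w w - B w' w'‖ₑ ∂μ :=
      enorm_integral_le_lintegral_enorm _
    have h2 := lintegral_pow_le_of_measure (μ := μ) (f := fun w' => ‖B w w - B w' w'‖ₑ)
      (by fun_prop) (m := 2 * m) (by omega)
    rw [measure_univ, one_pow, one_mul] at h2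
    exact (pow_le_pow_left₀ zero_le h1 _).trans h2
  -- Decoupling: after the rotation by `π / 4`, which preserves the joint law, the difference of the
  -- two diagonal terms has only cross terms in independent variables.
  have hpolar (u v : ι → ℂ) : B ((√2)⁻¹ • (u + v)) ((√2)⁻¹ • (u + v))
      - B ((√2)⁻¹ • (v - u)) ((√2)⁻¹ • (v - u)) = B u v + B v u := by
    have h2 : ((√2 : ℝ) : ℂ)⁻¹ * ((√2 : ℝ) : ℂ)⁻¹ = 2⁻¹ := by
      rw [← mul_inv, ← Complex.ofReal_mul, Real.mul_self_sqrt (by norm_num)]; norm_num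
    simp only [hB, ← Finset.sum_sub_distrib, ← Finset.sum_add_distrib]
    refine Finset.sum_congr rfl fun i _ => Finset.sum_congr rfl fun j _ => ?_
    simp only [Pi.smul_apply, Pi.add_apply, Pi.sub_apply, Complex.real_smul, Complex.ofReal_inv]
    linear_combination (b i j * ((u i + v i) * (u j + v j) - (v i - u i) * (v j - u j))) * h2
  have hadd (a b : ℝ≥0∞) : (a + b) ^ (2 * m) ≤ 2 ^ (2 * m) * (a ^ (2 * m) + b ^ (2 * m)) := by
    rcases le_total a b with h | h
    · have h1 : a + b ≤ 2 * b := by rw [two_mul b]; gcongr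
      refine (pow_le_pow_left₀ zero_le h1 _).trans ?_
      rw [mul_pow]; gcongr; exact le_add_self
    · have h1 : a + b ≤ 2 * a := by rw [two_mul a]; gcongr
      refine (pow_le_pow_left₀ zero_le h1 _).trans ?_
      rw [mul_pow]; gcongr; exact le_self_add
  have hBm : Measurable fun p : (ι → ℂ) × (ι → ℂ) => ‖B p.1 p.2‖ₑ ^ (2 * m) :=
    (hBc.measurable.enorm).pow_const _
  have hmain := lintegral_enorm_bilinear_pow_le h0 hs hcov b hm
  calc ∫⁻ w, ‖∑ i, ∑ j, b i j * (w i * w j - ∫ w', w' i * w' j ∂μ)‖ₑ ^ (2 * m) ∂μ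
      ≤ ∫⁻ w, ∫⁻ w', ‖B w w - B w' w'‖ₑ ^ (2 * m) ∂μ ∂μ := lintegral_mono hjensen
    _ = ∫⁻ p, ‖B p.1 p.1 - B p.2 p.2‖ₑ ^ (2 * m) ∂(μ.prod μ) := by
        rw [lintegral_prod _ (by fun_prop)]
    _ = ∫⁻ p, ‖B p.1 p.2 + B p.2 p.1‖ₑ ^ (2 * m) ∂(μ.prod μ) := by
        rw [lintegral_prod_rotation μ h0 _ (by fun_prop)]
        simp_rw [hpolar]
    _ ≤ ∫⁻ p, 2 ^ (2 * m) * (‖B p.1 p.2‖ₑ ^ (2 * m) + ‖B p.2 p.1‖ₑ ^ (2 * m)) ∂(μ.prod μ) :=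
        lintegral_mono fun p => (pow_le_pow_left₀ zero_le (enorm_add_le _ _) _).trans (hadd _ _)
    _ = 2 ^ (2 * m) * (2 * ∫⁻ v, ∫⁻ u, ‖B u v‖ₑ ^ (2 * m) ∂μ ∂μ) := by
        rw [lintegral_const_mul' _ _ (by finiteness), lintegral_add_left hBm,
          lintegral_prod_symm _ hBm.aemeasurable,
          lintegral_prod (fun p => ‖B p.2 p.1‖ₑ ^ (2 * m))
            (hBm.comp measurable_swap).aemeasurable]
        exact congrArg _ (two_mul _).symm
    -- The two cross terms together cost at most `4^{2m}`, which turns `48` into `192`.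
    _ ≤ 2 ^ (2 * m) * (2 ^ (2 * m) *
          ENNReal.ofReal ((48 * m) ^ 2 * ∑ i, ∑ j, s i * s j * ‖b i j‖ ^ 2) ^ m) := by
        gcongr
        · simpa using pow_le_pow_right₀ (by norm_num : (1 : ℝ≥0∞) ≤ 2) (by omega : 1 ≤ 2 * m)
    _ = _ := by
        rw [pow_mul, show (2 : ℝ≥0∞) ^ 2 = ENNReal.ofReal (2 ^ 2) by
          rw [ENNReal.ofReal_pow (by norm_num)]; simp, ← mul_pow, ← mul_pow,
          ← ENNReal.ofReal_mul (by positivity), ← ENNReal.ofReal_mul (by positivity)]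
        congr 2
        ring

end Chaos

/-! ### Trigonometric polynomials and Nikolskii's inequality -/

section Torus

open UnitAddTorus

instance : IsProbabilityMeasure dx :=
  inferInstanceAs (IsProbabilityMeasure (Measure.pi fun _ : Fin 3 => AddCircle.haarAddCircle))

instance : dx.IsAddHaarMeasure :=
  inferInstanceAs
    (Measure.IsAddHaarMeasure (Measure.pi fun _ : Fin 3 => (AddCircle.haarAddCircle (T := 1))))

lemma integral_mFourier (n : Freq) : ∫ x, mFourier n x ∂dx = if n = 0 then 1 else 0 := by
  simp only [mFourier, ContinuousMap.coe_mk, dx]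
  rw [integral_fintype_prod_eq_prod (𝕜 := ℂ) (f := fun i x => fourier (n i) x)]
  have h (k : ℤ) : ∫ t : UnitAddCircle, fourier k t ∂AddCircle.haarAddCircle
      = if k = 0 then 1 else 0 := by
    split_ifs with hk
    · subst hk; simp
    · have := fourierCoeff_toLp (T := 1) (fourier k) 0
      have h2 := integral_eq_zero_of_add_right_eq_neg (μ := AddCircle.haarAddCircle)
        (fourier_add_half_inv_index hk (by norm_num : (0 : ℝ) < 1))
      exact h2
  simp_rw [h]
  split_ifs with hn
  · subst hn; simp
  · obtain ⟨i, hi⟩ := Function.ne_iff.mp hn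
    exact Finset.prod_eq_zero (Finset.mem_univ i) (by simpa using hi)

lemma norm_mFourier_apply (n : Freq) (x : Torus3) : ‖mFourier n x‖ = 1 := by
  simp only [mFourier, ContinuousMap.coe_mk, fourier_apply, norm_prod, Circle.norm_coe,
    Finset.prod_const_one]

lemma mFourier_apply_add (n : Freq) (x y : Torus3) :
    mFourier n (x + y) = mFourier n x * mFourier n y := by
  simp [mFourier, fourier_apply, smul_add, AddCircle.toCircle_add, Finset.prod_mul_distrib]

lemma mFourier_apply_neg (n : Freq) (x : Torus3) : mFourier n (-x) = mFourier (-n) x := by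
  simp [mFourier, fourier_apply]

lemma mFourier_apply_sub (n : Freq) (x y : Torus3) :
    mFourier n (x - y) = mFourier n x * mFourier (-n) y := by
  rw [sub_eq_add_neg, mFourier_apply_add, mFourier_apply_neg]

lemma mFourierCoeff_eq (f : Torus3 → ℂ) (n : Freq) :
    mFourierCoeff f n = ∫ x, mFourier (-n) x * f x ∂dx := rfl

/-- The largest absolute value of the coordinates of a frequency. -/
def height (n : Freq) : ℕ := Finset.univ.sup fun i => (n i).natAbs

lemma height_le_iff {n : Freq} {R : ℕ} : height n ≤ R ↔ ∀ i, (n i).natAbs ≤ R := by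
  simp [height]

lemma natAbs_le_height (n : Freq) (i : Fin 3) : (n i).natAbs ≤ height n :=
  height_le_iff.mp le_rfl i

lemma height_add_le (n m : Freq) : height (n + m) ≤ height n + height m :=
  height_le_iff.mpr fun i => (Int.natAbs_add_le _ _).trans
    (add_le_add (natAbs_le_height n i) (natAbs_le_height m i))

lemma height_neg (n : Freq) : height (-n) = height n := by
  simp [height]

/-- The frequencies of height at most `R`. -/
def box (R : ℕ) : Finset Freq := Fintype.piFinset fun _ => Finset.Icc (-(R : ℤ)) R

lemma mem_box {n : Freq} {R : ℕ} : n ∈ box R ↔ height n ≤ R := by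
  simp only [box, Fintype.mem_piFinset, Finset.mem_Icc, height_le_iff]
  refine forall_congr' fun i => ?_
  omega

lemma card_box (R : ℕ) : (box R).card = (2 * R + 1) ^ 3 := by
  simp only [box, Fintype.card_piFinset, Int.card_Icc, Finset.prod_const, Finset.card_univ,
    Fintype.card_fin]
  congr 1
  omega

/-- The trigonometric polynomial with frequencies in `S` and coefficients `c`. -/
def trigPoly (S : Finset Freq) (c : Freq → ℂ) (x : Torus3) : ℂ := ∑ n ∈ S, c n * mFourier n x

@[fun_prop]
lemma continuous_trigPoly (S : Finset Freq) (c : Freq → ℂ) : Continuous (trigPoly S c) := by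
  unfold trigPoly; fun_prop

lemma integrable_of_continuous {f : Torus3 → ℂ} (hf : Continuous f) : Integrable f dx :=
  hf.integrable_of_hasCompactSupport (HasCompactSupport.of_compactSpace f)

lemma integral_mFourier_mul_trigPoly (S : Finset Freq) (c : Freq → ℂ) (n : Freq) :
    ∫ x, mFourier (-n) x * trigPoly S c x ∂dx = if n ∈ S then c n else 0 := by
  simp only [trigPoly, Finset.mul_sum]
  rw [integral_finsetSum _ fun m _ => integrable_of_continuous (by fun_prop)]
  have h (m : Freq) : ∫ x, mFourier (-n) x * (c m * mFourier m x) ∂dx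
      = if n = m then c m else 0 := by
    have (x : Torus3) : mFourier (-n) x * (c m * mFourier m x) = c m * mFourier (-n + m) x := by
      rw [mFourier_add]; ring
    simp_rw [this]
    rw [integral_const_mul, integral_mFourier]
    by_cases hnm : n = m
    · simp [hnm]
    · rw [if_neg hnm, if_neg (by rwa [neg_add_eq_zero]), mul_zero]
  simp_rw [h]
  simp

lemma integral_norm_sq_trigPoly (S : Finset Freq) (c : Freq → ℂ) :
    ∫ x, ‖trigPoly S c x‖ ^ 2 ∂dx = ∑ n ∈ S, ‖c n‖ ^ 2 := by
  have h (x : Torus3) : ((‖trigPoly S c x‖ ^ 2 : ℝ) : ℂ)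
      = ∑ n ∈ S, conj (c n) * (mFourier (-n) x * trigPoly S c x) := by
    rw [← Complex.normSq_eq_norm_sq, ← Complex.mul_conj, mul_comm]
    conv_lhs => enter [1]; rw [trigPoly, map_sum]
    rw [Finset.sum_mul]
    refine Finset.sum_congr rfl fun n _ => ?_
    rw [map_mul, mFourier_neg]; ring
  have h2 : ((∫ x, ‖trigPoly S c x‖ ^ 2 ∂dx : ℝ) : ℂ) = ((∑ n ∈ S, ‖c n‖ ^ 2 : ℝ) : ℂ) := by
    rw [← integral_complex_ofReal]
    simp_rw [h]
    rw [integral_finsetSum _ fun n _ => integrable_of_continuous (by fun_prop)]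
    push_cast
    refine Finset.sum_congr rfl fun n hn => ?_
    rw [integral_const_mul, integral_mFourier_mul_trigPoly, if_pos hn, mul_comm,
      Complex.mul_conj, Complex.normSq_eq_norm_sq, Complex.ofReal_pow]
  exact_mod_cast h2

/-- Cauchy-Schwarz on the coefficients followed by Parseval. This is the `L²` case of Nikolskii's
inequality; the other even exponents follow by applying it to a power. -/
lemma norm_sq_trigPoly_le (S : Finset Freq) (c : Freq → ℂ) (x : Torus3) :
    ‖trigPoly S c x‖ ^ 2 ≤ S.card * ∫ y, ‖trigPoly S c y‖ ^ 2 ∂dx := by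
  rw [integral_norm_sq_trigPoly]
  calc ‖trigPoly S c x‖ ^ 2 ≤ (∑ n ∈ S, ‖c n‖) ^ 2 := by
        gcongr
        refine (norm_sum_le _ _).trans (Finset.sum_le_sum fun n _ => ?_)
        rw [norm_mul, norm_mFourier_apply, mul_one]
    _ ≤ _ := sq_sum_le_card_mul_sum_sq

/-- Products of trigonometric polynomials are trigonometric polynomials. -/
lemma exists_trigPoly_mul {L M : ℕ} (c d : Freq → ℂ) :
    ∃ e, ∀ x, trigPoly (box L) c x * trigPoly (box M) d x = trigPoly (box (L + M)) e x := by
  classical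
  refine ⟨fun k => ∑ n ∈ box L, ∑ m ∈ box M, if n + m = k then c n * d m else 0, fun x => ?_⟩
  rw [trigPoly, trigPoly, trigPoly, Finset.sum_mul_sum]
  simp_rw [Finset.sum_mul]
  rw [Finset.sum_comm (s := box (L + M))]
  refine Finset.sum_congr rfl fun n hn => ?_
  rw [Finset.sum_comm (s := box (L + M))]
  refine Finset.sum_congr rfl fun m hm => ?_
  have hnm : n + m ∈ box (L + M) := mem_box.mpr
    ((height_add_le n m).trans (add_le_add (mem_box.mp hn) (mem_box.mp hm)))
  simp_rw [ite_mul, zero_mul]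
  rw [Finset.sum_ite_eq, if_pos hnm, mFourier_add]
  ring

lemma exists_trigPoly_pow {L : ℕ} (c : Freq → ℂ) (m : ℕ) :
    ∃ e, ∀ x, trigPoly (box L) c x ^ m = trigPoly (box (m * L)) e x := by
  induction m with
  | zero =>
    refine ⟨fun _ => 1, fun x => ?_⟩
    have : box 0 = {0} := by
      ext n
      rw [mem_box, Finset.mem_singleton, height_le_iff]
      simp [funext_iff]
    simp [trigPoly, this, mFourier_zero]
  | succ m ih =>
    obtain ⟨e, he⟩ := ih
    obtain ⟨e', he'⟩ := exists_trigPoly_mul (L := m * L) (M := L) e c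
    refine ⟨e', fun x => ?_⟩
    rw [pow_succ, he, he', Nat.succ_mul]

/-- Nikolskii's inequality. -/
lemma enorm_trigPoly_pow_le {L : ℕ} (c : Freq → ℂ) (m : ℕ) (x : Torus3) :
    ‖trigPoly (box L) c x‖ₑ ^ (2 * m) ≤
      ((2 * (m * L) + 1) ^ 3 : ℕ) * ∫⁻ y, ‖trigPoly (box L) c y‖ₑ ^ (2 * m) ∂dx := by
  -- The `m`-th power has frequencies of height at most `m L`, so the loss is polynomial in `m` and
  -- `L`, and harmless after a `2m`-th root.
  obtain ⟨e, he⟩ := exists_trigPoly_pow (L := L) c m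
  have h := norm_sq_trigPoly_le (box (m * L)) e x
  simp_rw [← he, card_box, norm_pow, ← pow_mul, mul_comm m 2] at h
  have hint : Integrable (fun y => ‖trigPoly (box L) c y‖ ^ (2 * m)) dx :=
    (Continuous.integrable_of_hasCompactSupport (by fun_prop) (HasCompactSupport.of_compactSpace _))
  have h2 := ENNReal.ofReal_le_ofReal h
  rw [ENNReal.ofReal_mul (by positivity), ENNReal.ofReal_natCast,
    ofReal_integral_eq_lintegral_ofReal hint (ae_of_all _ fun _ => by positivity)] at h2
  simpa [ENNReal.ofReal_pow, ofReal_norm] using h2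

/-- Integration against an `L¹` function is continuous on `C(𝕋³)`, where the characters span a dense
subspace. The integrals over closed sets therefore vanish too, by approximating their indicators
with continuous functions. -/
lemma ae_eq_zero_of_mFourierCoeff_eq_zero {f : Torus3 → ℂ} (hf : Integrable f dx)
    (h : ∀ n, mFourierCoeff f n = 0) : f =ᵐ[dx] 0 := by
  have hcont (g : C(Torus3, ℂ)) : ∫ x, g x * f x ∂dx = 0 := by
    have hint (g : C(Torus3, ℂ)) : Integrable (fun x => g x * f x) dx :=
      hf.bdd_mul (c := ‖g‖) (by fun_prop) (ae_of_all _ fun x => g.norm_coe_le_norm x)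
    let Φ : C(Torus3, ℂ) →ₗ[ℂ] ℂ :=
      { toFun := fun g => ∫ x, g x * f x ∂dx
        map_add' := fun g g' => by
          simp only [ContinuousMap.add_apply, add_mul]
          exact integral_add (hint g) (hint g')
        map_smul' := fun a g => by
          simp only [ContinuousMap.smul_apply, smul_eq_mul, mul_assoc, integral_const_mul,
            RingHom.id_apply] }
    let Ψ : C(Torus3, ℂ) →L[ℂ] ℂ := Φ.mkContinuous (∫ x, ‖f x‖ ∂dx) fun g => by
      refine (norm_integral_le_integral_norm _).trans ?_
      rw [mul_comm, ← integral_const_mul]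
      refine integral_mono (hint g).norm (hf.norm.const_mul _) fun x => ?_
      dsimp only
      rw [norm_mul]
      gcongr
      exact g.norm_coe_le_norm x
    have hker : (Submodule.span ℂ (Set.range (mFourier (d := Fin 3)))).topologicalClosure
        ≤ LinearMap.ker Ψ.toLinearMap := by
      refine Submodule.topologicalClosure_minimal _ ?_ Ψ.isClosed_ker
      rw [Submodule.span_le]
      rintro _ ⟨n, rfl⟩
      have := h (-n)
      rw [mFourierCoeff_eq, neg_neg] at this
      exact this
    rw [span_mFourier_closure_eq_top] at hker
    exact hker (Submodule.mem_top (x := g))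
  refine ae_eq_zero_of_forall_setIntegral_isClosed_eq_zero hf fun s hs => ?_
  have hlim : Tendsto (fun n => ∫ x, ((hs.apprSeq n x : ℝ) : ℂ) * f x ∂dx) atTop
      (𝓝 (∫ x, s.indicator f x ∂dx)) := by
    refine tendsto_integral_of_dominated_convergence (fun x => ‖f x‖) (fun n => ?_) hf.norm
      (fun n => ae_of_all _ fun x => ?_) (ae_of_all _ fun x => ?_)
    · exact Continuous.aestronglyMeasurable (by fun_prop) |>.mul hf.aestronglyMeasurable
    · rw [norm_mul, Complex.norm_real, Real.norm_of_nonneg (by positivity)]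
      refine mul_le_of_le_one_left (norm_nonneg _) ?_
      exact_mod_cast HasOuterApproxClosed.apprSeq_apply_le_one hs n x
    · have h1 := (tendsto_pi_nhds.mp (HasOuterApproxClosed.tendsto_apprSeq hs)) x
      have h2 : Tendsto (fun n => ((hs.apprSeq n x : ℝ) : ℂ)) atTop
          (𝓝 (((s.indicator (fun _ => (1 : ℝ≥0)) x : ℝ≥0) : ℝ) : ℂ)) :=
        (Complex.continuous_ofReal.tendsto _).comp ((NNReal.continuous_coe.tendsto _).comp h1)
      have h3 := h2.mul_const (f x)
      convert! h3 using 2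
      by_cases hx : x ∈ s <;> simp [hx]
  have hzero (n : ℕ) : ∫ x, ((hs.apprSeq n x : ℝ) : ℂ) * f x ∂dx = 0 :=
    hcont ⟨fun x => ((hs.apprSeq n x : ℝ) : ℂ), by fun_prop⟩
  simp_rw [hzero] at hlim
  rw [← integral_indicator hs.measurableSet]
  exact (tendsto_nhds_unique hlim tendsto_const_nhds)

end Torus

/-! ### A positive kernel of Jackson type -/

section Jackson

open UnitAddTorus

/-- This is `|sin(πu)| ≥ 2|u|` for `|u| ≤ 1/2`. It trades a weight `‖x i‖` for multiplication by a
character minus one, a difference operator on the coefficients. -/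
lemma norm_le_norm_fourier_sub_one (t : UnitAddCircle) : 4 * ‖t‖ ≤ ‖fourier 1 t - 1‖ := by
  obtain ⟨s, rfl⟩ := QuotientAddGroup.mk_surjective t
  have hr : ((s : ℝ) : UnitAddCircle) = ((s - round s : ℝ) : UnitAddCircle) := by
    rw [AddCircle.coe_sub, eq_comm, sub_eq_self]
    have := AddCircle.coe_period (1 : ℝ)
    rw [← mul_one ((round s : ℤ) : ℝ), ← zsmul_eq_mul, AddCircle.coe_zsmul, this, smul_zero]
  change 4 * ‖((s : ℝ) : UnitAddCircle)‖ ≤ ‖fourier 1 ((s : ℝ) : UnitAddCircle) - 1‖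
  rw [UnitAddCircle.norm_eq, hr, fourier_coe_apply]
  set u := s - round s
  have hu : |u| ≤ 1 / 2 := abs_sub_round s
  have h1 : (2 * π * Complex.I * ((1 : ℤ) : ℂ) * (u : ℂ) / ((1 : ℝ) : ℂ))
      = Complex.I * ((2 * π * u : ℝ) : ℂ) := by
    push_cast; ring
  rw [h1, Complex.norm_exp_I_mul_ofReal_sub_one, Real.norm_eq_abs, abs_mul, abs_two,
    show 2 * π * u / 2 = π * u by ring]
  have h2 := Real.mul_abs_le_abs_sin (x := π * u) (by
    rw [abs_mul, abs_of_pos Real.pi_pos]; nlinarith [Real.pi_pos])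
  rw [abs_mul, abs_of_pos Real.pi_pos, ← mul_assoc, div_mul_cancel₀ _ Real.pi_pos.ne'] at h2
  linarith

/-- The tent `max (n - |j|, 0)`. -/
def tent (n : ℕ) (j : Freq) : ℝ := ((n - height j : ℕ) : ℝ)

lemma tent_neg (n : ℕ) (j : Freq) : tent n (-j) = tent n j := by rw [tent, tent, height_neg]

lemma tent_eq_zero {n : ℕ} {j : Freq} (h : j ∉ box n) : tent n j = 0 := by
  rw [mem_box, not_le] at h
  rw [tent, Nat.sub_eq_zero_of_le h.le, Nat.cast_zero]

lemma height_single (i : Fin 3) : height (Pi.single i 1) = 1 := by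
  refine le_antisymm (height_le_iff.mpr fun k => ?_) ?_
  · by_cases h : k = i
    · subst h; simp
    · simp [h]
  · simpa using natAbs_le_height (Pi.single i 1) i

lemma abs_tent_sub_le (n : ℕ) (i : Fin 3) (j : Freq) :
    |tent n (j - Pi.single i 1) - tent n j| ≤ 1 := by
  have h1 := height_add_le (j - Pi.single i 1) (Pi.single i 1)
  have h2 := height_add_le j (-Pi.single i 1)
  rw [height_neg] at h2
  rw [sub_add_cancel, height_single] at h1
  rw [height_single, ← sub_eq_add_neg] at h2
  have h3 : (n - height (j - Pi.single i 1)) ≤ (n - height j) + 1 := by omega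
  have h4 : (n - height j) ≤ (n - height (j - Pi.single i 1)) + 1 := by omega
  rw [tent, tent, abs_le]
  have h3' : ((n - height (j - Pi.single i 1) : ℕ) : ℝ) ≤ ((n - height j : ℕ) : ℝ) + 1 := by
    exact_mod_cast h3
  have h4' : ((n - height j : ℕ) : ℝ) ≤ ((n - height (j - Pi.single i 1) : ℕ) : ℝ) + 1 := by
    exact_mod_cast h4
  constructor <;> linarith

/-- The squared `L²` norm of the trigonometric polynomial with the tent coefficients. -/
def tentMass (n : ℕ) : ℝ := ∑ j ∈ box n, tent n j ^ 2

/-- The box of radius `n / 2` holds at least `n³` frequencies, and the tent is at least `n / 2` on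
each of them. -/
lemma le_tentMass {n : ℕ} : (n : ℝ) ^ 5 / 4 ≤ tentMass n := by
  have hsub : box (n / 2) ⊆ box n := fun j hj => by
    rw [mem_box] at hj ⊢; omega
  calc (n : ℝ) ^ 5 / 4 = (n : ℝ) ^ 3 * ((n : ℝ) / 2) ^ 2 := by ring
    _ ≤ ((box (n / 2)).card : ℝ) * ((n : ℝ) / 2) ^ 2 := by
        gcongr
        rw [card_box]
        have : n ≤ 2 * (n / 2) + 1 := by omega
        push_cast
        gcongr
        exact_mod_cast this
    _ ≤ ∑ j ∈ box (n / 2), tent n j ^ 2 := by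
        rw [← nsmul_eq_mul]
        refine Finset.card_nsmul_le_sum _ _ _ fun j hj => ?_
        rw [mem_box] at hj
        have : n ≤ 2 * (n - height j) := by omega
        gcongr
        rw [tent, div_le_iff₀ two_pos, mul_comm]
        exact_mod_cast this
    _ ≤ _ := Finset.sum_le_sum_of_subset_of_nonneg hsub fun _ _ _ => sq_nonneg _

lemma tentMass_pos {n : ℕ} (hn : 1 ≤ n) : 0 < tentMass n := by
  refine lt_of_lt_of_le ?_ le_tentMass
  positivity

/-- A non-negative trigonometric kernel of Jackson type. -/
def jackson (n : ℕ) (x : Torus3) : ℝ :=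
  ‖trigPoly (box n) (fun j => (tent n j : ℂ)) x‖ ^ 2 / tentMass n

@[fun_prop]
lemma continuous_jackson (n : ℕ) : Continuous (jackson n) := by unfold jackson; fun_prop

lemma jackson_nonneg {n : ℕ} (hn : 1 ≤ n) (x : Torus3) : 0 ≤ jackson n x :=
  div_nonneg (sq_nonneg _) (tentMass_pos hn).le

lemma integrable_of_continuous_real {f : Torus3 → ℝ} (hf : Continuous f) : Integrable f dx :=
  hf.integrable_of_hasCompactSupport (HasCompactSupport.of_compactSpace f)

lemma integral_jackson {n : ℕ} (hn : 1 ≤ n) : ∫ x, jackson n x ∂dx = 1 := by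
  simp only [jackson]
  rw [integral_div, integral_norm_sq_trigPoly, div_eq_one_iff_eq (tentMass_pos hn).ne']
  simp [tentMass]

lemma exists_jackson_eq_trigPoly (n : ℕ) :
    ∃ e, ∀ x, (jackson n x : ℂ) = trigPoly (box (2 * n)) e x := by
  obtain ⟨e, he⟩ := exists_trigPoly_mul (L := n) (M := n) (fun j => (tent n j : ℂ))
    (fun j => (tent n j : ℂ))
  refine ⟨fun j => e j / tentMass n, fun x => ?_⟩
  -- The tent is real and even, so its polynomial is real and the squared modulus is an honest
  -- square, of degree `2n`.
  have hconj : conj (trigPoly (box n) (fun j => (tent n j : ℂ)) x)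
      = trigPoly (box n) (fun j => (tent n j : ℂ)) x := by
    simp only [trigPoly, map_sum, map_mul, Complex.conj_ofReal, ← mFourier_neg]
    refine Finset.sum_nbij' (fun j => -j) (fun j => -j) ?_ ?_ ?_ ?_ ?_ <;>
      simp [mem_box, height_neg, tent_neg]
  rw [jackson, Complex.ofReal_div, ← Complex.normSq_eq_norm_sq, ← Complex.mul_conj, hconj, he,
    ← two_mul]
  simp only [trigPoly, Finset.sum_div]
  exact Finset.sum_congr rfl fun j _ => by ring

lemma mFourierCoeff_jackson {n : ℕ} {ξ : Freq} (h : 2 * n < height ξ) :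
    ∫ x, mFourier (-ξ) x * jackson n x ∂dx = 0 := by
  obtain ⟨e, he⟩ := exists_jackson_eq_trigPoly n
  simp_rw [he]
  rw [integral_mFourier_mul_trigPoly, if_neg]
  rw [mem_box]
  omega

/-- The weight `‖x i‖²` becomes a sum of squared differences of the tent. These are at most `1` on
at most `(5n)³` frequencies, while the normalisation is at least `n⁵/4`. The quotient is `125/(4n²)
≤ 32/n²`. -/
lemma integral_jackson_mul_norm_sq_le {n : ℕ} (hn : 1 ≤ n) (i : Fin 3) :
    ∫ x, jackson n x * ‖x i‖ ^ 2 ∂dx ≤ 32 / n ^ 2 := by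
  have hG (x : Torus3) : (mFourier (Pi.single i 1) x - 1)
      * trigPoly (box n) (fun j => (tent n j : ℂ)) x
      = trigPoly (box (n + 1)) (fun j => ((tent n (j - Pi.single i 1) - tent n j : ℝ) : ℂ)) x := by
    have h1 : trigPoly (box n) (fun j => (tent n j : ℂ)) x
        = trigPoly (box (n + 1)) (fun j => (tent n j : ℂ)) x := by
      refine Finset.sum_subset (fun j hj => ?_) fun j _ hj => ?_
      · rw [mem_box] at hj ⊢; omega
      · simp [tent_eq_zero hj]
    have h2 : mFourier (Pi.single i 1) x * trigPoly (box n) (fun j => (tent n j : ℂ)) x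
        = trigPoly (box (n + 1)) (fun j => (tent n (j - Pi.single i 1) : ℂ)) x := by
      classical
      have hinj : Function.Injective fun j : Freq => j + Pi.single i 1 := add_left_injective _
      rw [trigPoly, Finset.mul_sum, trigPoly]
      rw [← Finset.sum_subset (s₁ := (box n).image fun j => j + Pi.single i 1)
        (s₂ := box (n + 1))]
      · rw [Finset.sum_image fun a _ b _ h => hinj h]
        refine Finset.sum_congr rfl fun j _ => ?_
        rw [add_sub_cancel_right, mFourier_add]
        ring
      · intro k hk
        obtain ⟨j, hj, rfl⟩ := Finset.mem_image.mp hk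
        rw [mem_box] at hj ⊢
        refine (height_add_le _ _).trans ?_
        rw [height_single]; omega
      · intro k _ hk
        rw [tent_eq_zero, Complex.ofReal_zero, zero_mul]
        intro h
        exact hk (Finset.mem_image.mpr ⟨_, h, sub_add_cancel _ _⟩)
    rw [sub_mul, one_mul, h2, h1, trigPoly, trigPoly, trigPoly, ← Finset.sum_sub_distrib]
    refine Finset.sum_congr rfl fun j _ => ?_
    push_cast; ring
  have hpt (x : Torus3) : jackson n x * ‖x i‖ ^ 2 ≤ (16 * tentMass n)⁻¹ *
      ‖trigPoly (box (n + 1)) (fun j => ((tent n (j - Pi.single i 1) - tent n j : ℝ) : ℂ)) x‖ ^ 2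
      := by
    rw [← hG, norm_mul, mul_pow, mFourier_single, jackson]
    have h := norm_le_norm_fourier_sub_one (x i)
    have h2 : 16 * ‖x i‖ ^ 2 ≤ ‖fourier 1 (x i) - 1‖ ^ 2 := by
      nlinarith [norm_nonneg (x i)]
    have hm := tentMass_pos hn
    set g := ‖trigPoly (box n) (fun j => (tent n j : ℂ)) x‖ ^ 2
    have hg : 0 ≤ g := sq_nonneg _
    rw [mul_inv, div_mul_eq_mul_div, div_le_iff₀ hm]
    calc g * ‖x i‖ ^ 2 = 16⁻¹ * (16 * ‖x i‖ ^ 2 * g) := by ring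
      _ ≤ 16⁻¹ * (‖fourier 1 (x i) - 1‖ ^ 2 * g) := by gcongr
      _ = _ := by field_simp
  have hm := tentMass_pos hn
  calc ∫ x, jackson n x * ‖x i‖ ^ 2 ∂dx
      ≤ ∫ x, (16 * tentMass n)⁻¹ * ‖trigPoly (box (n + 1))
          (fun j => ((tent n (j - Pi.single i 1) - tent n j : ℝ) : ℂ)) x‖ ^ 2 ∂dx :=
        integral_mono (integrable_of_continuous_real (by fun_prop))
          (integrable_of_continuous_real (by fun_prop)) hpt
    _ = (16 * tentMass n)⁻¹ * ∑ j ∈ box (n + 1),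
          ‖((tent n (j - Pi.single i 1) - tent n j : ℝ) : ℂ)‖ ^ 2 := by
        rw [integral_const_mul, integral_norm_sq_trigPoly]
    _ ≤ (16 * ((n : ℝ) ^ 5 / 4))⁻¹ * ∑ j ∈ box (n + 1), 1 := by
        gcongr with j _
        · exact le_tentMass
        · rw [Complex.norm_real, Real.norm_eq_abs, sq_le_one_iff_abs_le_one, abs_abs]
          exact abs_tent_sub_le n i j
    _ ≤ (16 * ((n : ℝ) ^ 5 / 4))⁻¹ * (5 * n) ^ 3 := by
        have hn' : (1 : ℝ) ≤ n := by exact_mod_cast hn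
        rw [Finset.sum_const, nsmul_eq_mul, mul_one, card_box]
        push_cast
        gcongr
        linarith
    _ ≤ _ := by
        have hn' : (0 : ℝ) < n := by exact_mod_cast hn
        rw [inv_mul_eq_div, div_le_div_iff₀ (by positivity) (by positivity)]
        have : (0:ℝ) < (n : ℝ) ^ 5 := by positivity
        nlinarith

/-- Interpolation through `y^θ ≤ 1 + y²` at `y = n‖x‖`. The constant is `97 = 1 + 3 · 32`, from the
total mass and the three coordinates. -/
lemma integral_jackson_mul_rpow_le {n : ℕ} (hn : 1 ≤ n) {θ : ℝ} (hθ₀ : 0 ≤ θ) (hθ₂ : θ ≤ 2) :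
    ∫ x, jackson n x * ‖x‖ ^ θ ∂dx ≤ 97 * (n : ℝ) ^ (-θ) := by
  have hn' : (0 : ℝ) < n := by exact_mod_cast hn
  have hsq (x : Torus3) : ‖x‖ ^ 2 ≤ ∑ i, ‖x i‖ ^ 2 := by
    obtain ⟨i, hi⟩ : ∃ i, ‖x‖ = ‖x i‖ := by
      obtain ⟨i, -, hi⟩ := Finset.exists_mem_eq_sup Finset.univ Finset.univ_nonempty
        (fun i => ‖x i‖₊)
      exact ⟨i, by rw [Pi.norm_def, hi]; rfl⟩
    rw [hi]
    exact Finset.single_le_sum (f := fun i => ‖x i‖ ^ 2) (fun _ _ => sq_nonneg _)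
      (Finset.mem_univ i)
  have hy (y : ℝ) (hy : 0 ≤ y) : y ^ θ ≤ 1 + y ^ 2 := by
    rcases le_total y 1 with h | h
    · linarith [Real.rpow_le_one hy h hθ₀, sq_nonneg y]
    · have := Real.rpow_le_rpow_of_exponent_le h hθ₂
      rw [Real.rpow_two] at this
      linarith
  have hpt (x : Torus3) : jackson n x * ‖x‖ ^ θ ≤ (n : ℝ) ^ (-θ) *
      (jackson n x + n ^ 2 * ∑ i, jackson n x * ‖x i‖ ^ 2) := by
    have h1 : ‖x‖ ^ θ = (n : ℝ) ^ (-θ) * (n * ‖x‖) ^ θ := by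
      rw [Real.mul_rpow hn'.le (norm_nonneg _), ← mul_assoc, ← Real.rpow_add hn', neg_add_cancel,
        Real.rpow_zero, one_mul]
    have h2 := hy (n * ‖x‖) (by positivity)
    have hF := jackson_nonneg hn x
    rw [h1, ← Finset.mul_sum]
    calc jackson n x * ((n : ℝ) ^ (-θ) * (n * ‖x‖) ^ θ)
        ≤ jackson n x * ((n : ℝ) ^ (-θ) * (1 + n ^ 2 * ∑ i, ‖x i‖ ^ 2)) := by
          gcongr
          rw [mul_pow] at h2
          have := hsq x
          refine h2.trans ?_
          gcongr
      _ = _ := by ring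
  calc ∫ x, jackson n x * ‖x‖ ^ θ ∂dx
      ≤ ∫ x, (n : ℝ) ^ (-θ) * (jackson n x + n ^ 2 * ∑ i, jackson n x * ‖x i‖ ^ 2) ∂dx := by
        refine integral_mono (integrable_of_continuous_real ?_)
          (integrable_of_continuous_real (by fun_prop)) hpt
        exact (continuous_jackson n).mul (continuous_norm.rpow_const fun _ => Or.inr hθ₀)
    _ = (n : ℝ) ^ (-θ) * (1 + n ^ 2 * ∑ i, ∫ x, jackson n x * ‖x i‖ ^ 2 ∂dx) := by
        rw [integral_const_mul, integral_add (integrable_of_continuous_real (by fun_prop))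
          (integrable_of_continuous_real (by fun_prop)), integral_jackson hn, integral_const_mul,
          integral_finsetSum _ fun i _ => integrable_of_continuous_real (by fun_prop)]
    _ ≤ (n : ℝ) ^ (-θ) * (1 + n ^ 2 * ∑ _i : Fin 3, 32 / (n : ℝ) ^ 2) := by
        gcongr with i _
        exact integral_jackson_mul_norm_sq_le hn i
    _ = _ := by
        rw [Finset.sum_const, Finset.card_univ, Fintype.card_fin]
        have hn2 : (n : ℝ) ^ 2 ≠ 0 := by positivity
        rw [nsmul_eq_mul, mul_comm 97, mul_comm (n ^ 2 : ℝ), mul_assoc, div_mul_cancel₀ _ hn2]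
        norm_num

end Jackson

/-! ### Pointwise bounds and modulus of continuity of the potential -/

section Potential

lemma toTorus_add (x y : EuclideanSpace ℝ (Fin 3)) : toTorus (x + y) = toTorus x + toTorus y := by
  funext i
  simp [toTorus, add_div]

@[fun_prop]
lemma continuous_toTorus : Continuous toTorus := by
  unfold toTorus
  refine continuous_pi fun i => (AddCircle.continuous_mk' (1 : ℝ)).comp ?_
  fun_prop

lemma exists_toTorus_eq (θ : Torus3) :
    ∃ x : EuclideanSpace ℝ (Fin 3), toTorus x = θ ∧ ∀ i, |x i| = 2 * π * ‖θ i‖ := by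
  have h (i : Fin 3) : ∃ s : ℝ, ((s / (2 * π) : ℝ) : UnitAddCircle) = θ i ∧
      |s| = 2 * π * ‖θ i‖ := by
    obtain ⟨t, ht⟩ := QuotientAddGroup.mk_surjective (θ i)
    change ((t : ℝ) : UnitAddCircle) = θ i at ht
    refine ⟨2 * π * (t - round t), ?_, ?_⟩
    · rw [mul_div_cancel_left₀ _ (by positivity), AddCircle.coe_sub, ht, sub_eq_self,
        ← mul_one ((round t : ℤ) : ℝ), ← zsmul_eq_mul, AddCircle.coe_zsmul,
        AddCircle.coe_period, smul_zero]
    · rw [← ht, UnitAddCircle.norm_eq, abs_mul, abs_of_pos (by positivity)]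
  choose s hs using h
  exact ⟨WithLp.toLp 2 s, funext fun i => (hs i).1, fun i => (hs i).2⟩

lemma norm_le_half (θ : Torus3) : ‖θ‖ ≤ 1 / 2 :=
  (pi_norm_le_iff_of_nonneg (by norm_num)).mpr fun i => by
    simpa using AddCircle.norm_le_half_period (1 : ℝ) (x := θ i) one_ne_zero

lemma norm_sq_eq_sum (x : EuclideanSpace ℝ (Fin 3)) : ‖x‖ ^ 2 = ∑ i, |x i| ^ 2 := by
  simp [EuclideanSpace.norm_sq_eq]

lemma le_norm_of_abs_eq {θ : Torus3} {x : EuclideanSpace ℝ (Fin 3)}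
    (h : ∀ i, |x i| = 2 * π * ‖θ i‖) : 2 * π * ‖θ‖ ≤ ‖x‖ := by
  rw [← le_div_iff₀' (by positivity), pi_norm_le_iff_of_nonneg (by positivity)]
  intro i
  rw [le_div_iff₀' (by positivity), ← h, ← Real.norm_eq_abs]
  exact PiLp.norm_apply_le x i

lemma norm_le_of_abs_eq {θ : Torus3} {x : EuclideanSpace ℝ (Fin 3)}
    (h : ∀ i, |x i| = 2 * π * ‖θ i‖) : ‖x‖ ≤ 2 * (2 * π * ‖θ‖) := by
  refine le_of_sq_le_sq ?_ (by positivity)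
  rw [norm_sq_eq_sum]
  calc ∑ i, |x i| ^ 2 ≤ ∑ _i : Fin 3, (2 * π * ‖θ‖) ^ 2 := by
        gcongr with i _
        rw [h]
        gcongr
        exact norm_le_pi_norm θ i
    _ ≤ _ := by
        rw [Finset.sum_const, Finset.card_univ, Fintype.card_fin, nsmul_eq_mul]
        have := sq_nonneg (2 * π * ‖θ‖)
        push_cast
        nlinarith

/-- The points of `ℝ³` close to the fundamental domain. -/
def nearCell : Set (EuclideanSpace ℝ (Fin 3)) := {z | ∀ i, |z i| ≤ 5 * π / 4}

/-- The margin `5π/4` exceeds `π`, so that a point of the fundamental cell may still be moved by a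
quarter of its norm, and is below `2π`, so that the origin is the only lattice point inside. -/
lemma toTorus_ne_zero {z : EuclideanSpace ℝ (Fin 3)} (hz : z ∈ nearCell) (h0 : z ≠ 0) :
    toTorus z ≠ 0 := by
  intro h
  apply h0
  ext i
  have hi : ((z i / (2 * π) : ℝ) : UnitAddCircle) = 0 := congr_fun h i
  rw [AddCircle.coe_eq_zero_iff] at hi
  obtain ⟨n, hn⟩ := hi
  have h1 : |z i / (2 * π)| ≤ 5 / 8 := by
    rw [abs_div, abs_of_pos (by positivity : 0 < 2 * π), div_le_iff₀ (by positivity)]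
    linarith [hz i]
  rw [← hn, zsmul_eq_mul, mul_one, abs_le] at h1
  have h2 : n = 0 := by
    have h3 : (n : ℝ) < 1 := by linarith
    have h4 : (-1 : ℝ) < n := by linarith
    have h5 : n < 1 := by exact_mod_cast h3
    have h6 : -1 < n := by exact_mod_cast h4
    omega
  rw [h2, zero_smul, eq_comm, div_eq_zero_iff] at hn
  simpa [Real.pi_ne_zero] using hn

lemma norm_le_of_mem_nearCell {z : EuclideanSpace ℝ (Fin 3)} (hz : z ∈ nearCell) : ‖z‖ ≤ 8 := by
  refine le_of_sq_le_sq ?_ (by norm_num)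
  rw [norm_sq_eq_sum]
  calc ∑ i, |z i| ^ 2 ≤ ∑ _i : Fin 3, (4 : ℝ) ^ 2 := by
        gcongr with i _
        linarith [hz i, Real.pi_lt_d2]
    _ ≤ _ := by simp; norm_num

lemma isCompact_nearCell_far :
    IsCompact {z : EuclideanSpace ℝ (Fin 3) | z ∈ nearCell ∧ 1 / 10 ≤ ‖z‖} := by
  refine Metric.isCompact_of_isClosed_isBounded ?_ ?_
  · refine IsClosed.inter ?_ (isClosed_le continuous_const continuous_norm)
    simp only [nearCell, Set.ofPred_forall]
    exact isClosed_iInter fun i => isClosed_le (by fun_prop) continuous_const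
  · exact isBounded_iff_forall_norm_le.mpr ⟨8, fun z hz => norm_le_of_mem_nearCell hz.1⟩

variable {β : ℝ} {V : Torus3 → ℝ}

/-- Away from the origin compactness bounds `f`, and any constant is dominated by a multiple of the
singular weight because `‖z‖ ≤ 8` there. -/
lemma bound_of_near_of_far {E : Type*} [NormedAddCommGroup E] {f : EuclideanSpace ℝ (Fin 3) → E}
    {a c : ℝ} (ha : 0 ≤ a)
    (hf : ContinuousOn f {z : EuclideanSpace ℝ (Fin 3) | z ∈ nearCell ∧ 1 / 10 ≤ ‖z‖})
    (hnear : ∀ z, z ≠ 0 → ‖z‖ < 1 / 10 → ‖f z‖ ≤ c * ‖z‖ ^ (-a)) :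
    ∃ C, 0 ≤ C ∧ ∀ z ∈ nearCell, z ≠ 0 → ‖f z‖ ≤ C * ‖z‖ ^ (-a) := by
  obtain ⟨C₀, hC₀⟩ := isCompact_nearCell_far.exists_bound_of_continuousOn hf
  refine ⟨max |c| (|C₀| * 8 ^ a), by positivity, fun z hz h0 => ?_⟩
  have hz0 : 0 < ‖z‖ := norm_pos_iff.mpr h0
  rcases lt_or_ge ‖z‖ (1 / 10) with h | h
  · refine (hnear z h0 h).trans ?_
    gcongr
    exact (le_abs_self c).trans (le_max_left _ _)
  · calc ‖f z‖ ≤ |C₀| := (hC₀ z ⟨hz, h⟩).trans (le_abs_self _)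
      _ = |C₀| * 8 ^ a * 8 ^ (-a) := by
          rw [mul_assoc, ← Real.rpow_add (by norm_num), add_neg_cancel, Real.rpow_zero, mul_one]
      _ ≤ max |c| (|C₀| * 8 ^ a) * ‖z‖ ^ (-a) := by
          refine mul_le_mul (le_max_right _ _) ?_ (by positivity) (by positivity)
          exact Real.rpow_le_rpow_of_nonpos hz0 (norm_le_of_mem_nearCell hz) (by linarith)

lemma isOpen_toTorus_ne_zero : IsOpen {x : EuclideanSpace ℝ (Fin 3) | toTorus x ≠ 0} :=
  isOpen_ne_fun continuous_toTorus continuous_const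

/-- The power is written as `(‖y‖²)^{p/2}`, since the squared norm is smooth. -/
lemma norm_fderiv_norm_rpow_le {c p : ℝ} (hc : 0 ≤ c) {z : EuclideanSpace ℝ (Fin 3)} (hz : z ≠ 0) :
    ‖fderiv ℝ (fun y : EuclideanSpace ℝ (Fin 3) => c * ‖y‖ ^ p) z‖ ≤ c * |p| * ‖z‖ ^ (p - 1) := by
  have hz0 : 0 < ‖z‖ := norm_pos_iff.mpr hz
  have h1 := ((hasStrictFDerivAt_norm_sq z).hasFDerivAt.rpow_const (p := p / 2)
    (Or.inl (by positivity))).const_mul c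
  have h2 : (fun y : EuclideanSpace ℝ (Fin 3) => c * (‖y‖ ^ 2) ^ (p / 2))
      = fun y => c * ‖y‖ ^ p := by
    funext y
    rw [← Real.rpow_natCast, ← Real.rpow_mul (norm_nonneg _)]
    congr 2
    push_cast; ring
  rw [h2] at h1
  rw [h1.fderiv, norm_smul, norm_smul, Real.norm_of_nonneg hc, norm_mul,
    Real.norm_of_nonneg (Real.rpow_nonneg (sq_nonneg _) _), ← Nat.cast_smul_eq_nsmul ℝ, norm_smul,
    innerSL_apply_norm, Real.norm_eq_abs, ← Real.rpow_natCast, ← Real.rpow_mul (norm_nonneg _)]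
  refine le_of_eq ?_
  have h3 : ‖z‖ ^ (p - 1) = ‖z‖ ^ (((2 : ℕ) : ℝ) * (p / 2 - 1)) * ‖z‖ := by
    rw [← Real.rpow_add_one hz0.ne']
    congr 1
    push_cast; ring
  rw [h3, abs_div, abs_two]
  simp only [Nat.cast_ofNat, Real.norm_ofNat]
  ring

lemma IsInteraction.exists_lift_bound (hV : IsInteraction β V) (hβ₃ : β < 3) :
    ∃ C, 0 ≤ C ∧ (∀ z ∈ nearCell, z ≠ 0 → |V (toTorus z)| ≤ C * ‖z‖ ^ (-(3 - β))) ∧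
      ∀ z ∈ nearCell, z ≠ 0 → ‖fderiv ℝ (fun x => V (toTorus x)) z‖ ≤ C * ‖z‖ ^ (-(4 - β)) := by
  obtain ⟨c, hc, hnear⟩ := hV.near_zero
  have hsub : {z : EuclideanSpace ℝ (Fin 3) | z ∈ nearCell ∧ 1 / 10 ≤ ‖z‖}
      ⊆ {x | toTorus x ≠ 0} := fun z hz => toTorus_ne_zero hz.1 (by
        rintro rfl
        simp only [Set.mem_ofPred_eq, norm_zero] at hz
        linarith [hz.2])
  obtain ⟨C₁, hC₁, h₁⟩ := bound_of_near_of_far (f := fun x => V (toTorus x)) (a := 3 - β)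
    (by linarith) (hV.smooth.continuousOn.mono hsub) (c := c) fun z h0 hz => by
      rw [hnear z h0 hz.le, Real.norm_of_nonneg (by positivity)]
  obtain ⟨C₂, hC₂, h₂⟩ := bound_of_near_of_far (f := fderiv ℝ fun x => V (toTorus x))
    (a := 4 - β) (by linarith)
    ((hV.smooth.continuousOn_fderiv_of_isOpen isOpen_toTorus_ne_zero (by simp)).mono hsub)
    (c := c * |-(3 - β)|) fun z h0 hz => by
      have heq : (fun x => V (toTorus x)) =ᶠ[𝓝 z] fun y => c * ‖y‖ ^ (-(3 - β)) := by
        filter_upwards [isOpen_ne.mem_nhds h0,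
          (isOpen_lt continuous_norm continuous_const).mem_nhds hz]
          with y hy0 hy
        exact hnear y hy0 hy.le
      rw [heq.fderiv_eq]
      refine (norm_fderiv_norm_rpow_le hc.le h0).trans (le_of_eq ?_)
      congr 2
      ring
  refine ⟨max C₁ C₂, by positivity, fun z hz h0 => ?_, fun z hz h0 => ?_⟩
  · refine (h₁ z hz h0).trans ?_
    gcongr
    exact le_max_left _ _
  · refine (h₂ z hz h0).trans ?_
    gcongr
    exact le_max_right _ _

lemma IsInteraction.exists_abs_le (hV : IsInteraction β V) (hβ₃ : β < 3) :
    ∃ C, 0 ≤ C ∧ ∀ θ : Torus3, θ ≠ 0 → |V θ| ≤ C * ‖θ‖ ^ (-(3 - β)) := by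
  obtain ⟨C, hC, h, -⟩ := hV.exists_lift_bound hβ₃
  refine ⟨C, hC, fun θ hθ => ?_⟩
  obtain ⟨x, rfl, hx⟩ := exists_toTorus_eq θ
  have hθ0 : 0 < ‖toTorus x‖ := norm_pos_iff.mpr hθ
  have h1 := le_norm_of_abs_eq hx
  have hle : ‖toTorus x‖ ≤ ‖x‖ := by nlinarith [Real.pi_gt_three]
  refine (h x (fun i => ?_) ?_).trans ?_
  · rw [hx]
    have := (norm_le_pi_norm (toTorus x) i).trans (norm_le_half _)
    nlinarith [Real.pi_pos]
  · rintro rfl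
    simp only [norm_zero] at hle
    linarith
  · exact mul_le_mul_of_nonneg_left (Real.rpow_le_rpow_of_nonpos hθ0 hle (by linarith)) hC

/-- Mean value inequality along a segment of lifts. The lift of `θ` has norm at least `2π‖θ‖` and
that of `h` at most `4π‖h‖ ≤ π‖θ‖`, so the segment avoids the singularity and stays at distance at
least `‖θ‖` from it. -/
lemma IsInteraction.exists_abs_sub_le_of_norm_le (hV : IsInteraction β V) (hβ₃ : β < 3) :
    ∃ C, 0 ≤ C ∧ ∀ θ h : Torus3, θ ≠ 0 → ‖h‖ ≤ ‖θ‖ / 4 →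
      |V (θ + h) - V θ| ≤ C * ‖h‖ * ‖θ‖ ^ (-(4 - β)) := by
  obtain ⟨C, hC, -, hd⟩ := hV.exists_lift_bound hβ₃
  refine ⟨C * (4 * π), by positivity, fun θ h hθ hh => ?_⟩
  obtain ⟨x, rfl, hx⟩ := exists_toTorus_eq θ
  obtain ⟨y, rfl, hy⟩ := exists_toTorus_eq h
  have hθ0 : 0 < ‖toTorus x‖ := norm_pos_iff.mpr hθ
  have hx1 := le_norm_of_abs_eq hx
  have hy2 := norm_le_of_abs_eq hy
  have hseg : ∀ z ∈ segment ℝ x (x + y), z ∈ nearCell ∧ ‖toTorus x‖ ≤ ‖z‖ := by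
    intro z hz
    rw [segment_eq_image'] at hz
    obtain ⟨s, ⟨hs0, hs1⟩, rfl⟩ := hz
    simp only [add_sub_cancel_left]
    constructor
    · intro i
      have h1 : |(x + s • y) i| ≤ |x i| + |y i| := by
        simp only [PiLp.add_apply, PiLp.smul_apply, smul_eq_mul]
        refine (abs_add_le _ _).trans ?_
        rw [abs_mul, abs_of_nonneg hs0]
        nlinarith [abs_nonneg (y i)]
      rw [hx, hy] at h1
      have h2 := norm_le_pi_norm (toTorus x) i
      have h3 := norm_le_pi_norm (toTorus y) i
      have h4 := norm_le_half (toTorus x)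
      nlinarith [Real.pi_pos]
    · have h1 : ‖s • y‖ ≤ ‖y‖ := by
        rw [norm_smul, Real.norm_of_nonneg hs0]
        exact mul_le_of_le_one_left (norm_nonneg _) hs1
      have h2 := norm_sub_le (x + s • y) (s • y)
      rw [add_sub_cancel_right] at h2
      nlinarith [Real.pi_gt_three]
  have hmv := (convex_segment x (x + y)).norm_image_sub_le_of_norm_fderiv_le (𝕜 := ℝ)
    (f := fun x => V (toTorus x)) (C := C * ‖toTorus x‖ ^ (-(4 - β)))
    (fun z hz => ?_) (fun z hz => ?_) (left_mem_segment _ _ _) (right_mem_segment _ _ _)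
  · rw [Real.norm_eq_abs, toTorus_add, add_sub_cancel_left] at hmv
    refine hmv.trans ?_
    calc C * ‖toTorus x‖ ^ (-(4 - β)) * ‖y‖
        ≤ C * ‖toTorus x‖ ^ (-(4 - β)) * (2 * (2 * π * ‖toTorus y‖)) := by gcongr
      _ = _ := by ring
  · obtain ⟨hz1, hz2⟩ := hseg z hz
    have hz0 : z ≠ 0 := norm_pos_iff.mp (hθ0.trans_le hz2)
    exact (hV.smooth.differentiableOn (by simp)).differentiableAt
      (isOpen_toTorus_ne_zero.mem_nhds (toTorus_ne_zero hz1 hz0))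
  · obtain ⟨hz1, hz2⟩ := hseg z hz
    have hz0 : z ≠ 0 := norm_pos_iff.mp (hθ0.trans_le hz2)
    refine (hd z hz1 hz0).trans ?_
    exact mul_le_mul_of_nonneg_left (Real.rpow_le_rpow_of_nonpos hθ0 hz2 (by linarith)) hC

/-- The potential has a fractional modulus of continuity away from its singularity. -/
lemma IsInteraction.exists_abs_sub_le (hV : IsInteraction β V) (hβ₃ : β < 3) {ϑ : ℝ}
    (hϑ₀ : 0 ≤ ϑ) (hϑ₁ : ϑ ≤ 1) :
    ∃ C, 0 ≤ C ∧ ∀ θ h : Torus3, θ ≠ 0 → θ + h ≠ 0 → |V (θ + h) - V θ| ≤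
      C * ‖h‖ ^ ϑ * (‖θ‖ ^ (-(3 - β + ϑ)) + ‖θ + h‖ ^ (-(3 - β + ϑ))) := by
  obtain ⟨C₁, hC₁, h₁⟩ := hV.exists_abs_le hβ₃
  obtain ⟨C₂, hC₂, h₂⟩ := hV.exists_abs_sub_le_of_norm_le hβ₃
  refine ⟨5 * C₁ + C₂, by positivity, fun θ h hθ hθh => ?_⟩
  have hθ0 : 0 < ‖θ‖ := norm_pos_iff.mpr hθ
  have hθh0 : 0 < ‖θ + h‖ := norm_pos_iff.mpr hθh
  set A := ‖θ‖ ^ (-(3 - β + ϑ)) with hA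
  set B := ‖θ + h‖ ^ (-(3 - β + ϑ)) with hB
  have hA0 : 0 ≤ A := by positivity
  have hB0 : 0 ≤ B := by positivity
  -- For short increments the gradient bound is weakened with `‖h‖ ≤ ‖h‖^ϑ ‖θ‖^{1-ϑ}`. For long ones
  -- the two values are bounded separately.
  rcases le_or_gt ‖h‖ (‖θ‖ / 4) with hh | hh
  · refine (h₂ θ h hθ hh).trans ?_
    have e1 : ‖h‖ ≤ ‖h‖ ^ ϑ * ‖θ‖ ^ (1 - ϑ) := by
      rcases (norm_nonneg h).eq_or_lt with h0 | h0
      · rw [← h0]; positivity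
      · calc ‖h‖ = ‖h‖ ^ ϑ * ‖h‖ ^ (1 - ϑ) := by
              rw [← Real.rpow_add h0]; simp
          _ ≤ _ := by
              gcongr
              linarith
    have e2 : ‖θ‖ ^ (1 - ϑ) * ‖θ‖ ^ (-(4 - β)) = A := by
      rw [hA, ← Real.rpow_add hθ0]; congr 1; ring
    calc C₂ * ‖h‖ * ‖θ‖ ^ (-(4 - β))
        ≤ C₂ * (‖h‖ ^ ϑ * ‖θ‖ ^ (1 - ϑ)) * ‖θ‖ ^ (-(4 - β)) := by gcongr
      _ = C₂ * ‖h‖ ^ ϑ * A := by rw [← e2]; ring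
      _ ≤ (5 * C₁ + C₂) * ‖h‖ ^ ϑ * (A + B) := by
          gcongr
          · linarith
          · linarith
  -- Here both `θ` and `θ + h` have norm at most `5‖h‖`, so a factor `‖u‖^ϑ` can be exchanged for
  -- `‖h‖^ϑ`.
  · have key (u : Torus3) (hu : 0 < ‖u‖) (huh : ‖u‖ ≤ 5 * ‖h‖) :
        ‖u‖ ^ (-(3 - β)) ≤ 5 * ‖h‖ ^ ϑ * ‖u‖ ^ (-(3 - β + ϑ)) := by
      calc ‖u‖ ^ (-(3 - β)) = ‖u‖ ^ ϑ * ‖u‖ ^ (-(3 - β + ϑ)) := by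
            rw [← Real.rpow_add hu]; congr 1; ring
        _ ≤ (5 * ‖h‖) ^ ϑ * ‖u‖ ^ (-(3 - β + ϑ)) := by gcongr
        _ ≤ _ := by
            rw [Real.mul_rpow (by norm_num) (norm_nonneg _)]
            gcongr
            simpa using Real.rpow_le_rpow_of_exponent_le (by norm_num : (1 : ℝ) ≤ 5) hϑ₁
    have k1 := key θ hθ0 (by linarith)
    have k2 := key (θ + h) hθh0 ((norm_add_le _ _).trans (by linarith))
    calc |V (θ + h) - V θ| ≤ |V (θ + h)| + |V θ| := abs_sub _ _
      _ ≤ C₁ * ‖θ + h‖ ^ (-(3 - β)) + C₁ * ‖θ‖ ^ (-(3 - β)) := add_le_add (h₁ _ hθh) (h₁ _ hθ)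
      _ ≤ C₁ * (5 * ‖h‖ ^ ϑ * B) + C₁ * (5 * ‖h‖ ^ ϑ * A) := by gcongr
      _ = 5 * C₁ * ‖h‖ ^ ϑ * (A + B) := by ring
      _ ≤ _ := by
          gcongr
          linarith

end Potential

/-! ### Integrability of the potential and removal of low frequencies -/

section Integrability

lemma haarAddCircle_eq_volume : (AddCircle.haarAddCircle : Measure UnitAddCircle) = volume := by
  rw [AddCircle.volume_eq_smul_haarAddCircle]; simp

lemma integrable_norm_rpow_circle {b : ℝ} (hb : b < 1) :
    Integrable (fun t : UnitAddCircle => ‖t‖ ^ (-b)) AddCircle.haarAddCircle := by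
  rw [haarAddCircle_eq_volume]
  have hmeas : Measurable fun t : UnitAddCircle => ‖t‖ ^ (-b) := by fun_prop
  rw [← (AddCircle.measurePreserving_mk (1 : ℝ) 0).map_eq,
    integrable_map_measure hmeas.aestronglyMeasurable
      (by exact AddCircle.measurable_mk'.aemeasurable)]
  rw [zero_add]
  have h1 : IntegrableOn (fun x : ℝ => x ^ (-b)) (Set.Ioc 0 1) volume := by
    have := intervalIntegral.intervalIntegrable_rpow' (a := 0) (b := 1) (r := -b) (by linarith)
    rwa [intervalIntegrable_iff_integrableOn_Ioc_of_le zero_le_one] at this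
  have h2 : IntegrableOn (fun x : ℝ => (1 - x) ^ (-b)) (Set.Ioc 0 1) volume := by
    have := (intervalIntegral.intervalIntegrable_rpow' (a := 0) (b := 1) (r := -b)
      (by linarith)).comp_sub_left 1
    rw [sub_zero, sub_self] at this
    have := this.symm
    rwa [intervalIntegrable_iff_integrableOn_Ioc_of_le zero_le_one] at this
  refine (h1.add h2).mono' ?_ ?_
  · exact (hmeas.comp AddCircle.measurable_mk').aestronglyMeasurable
  · have hne : ∀ᵐ x : ℝ ∂(volume.restrict (Set.Ioc 0 1)), x ≠ 1 :=
      ae_restrict_of_ae (Measure.ae_ne volume 1)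
    filter_upwards [ae_restrict_mem measurableSet_Ioc, hne] with x hx hx1
    have hx' : x < 1 := lt_of_le_of_ne hx.2 hx1
    have hfr : Int.fract x = x := Int.fract_eq_self.mpr ⟨hx.1.le, hx'⟩
    simp only [Function.comp_apply, Pi.add_apply]
    change ‖‖((x : ℝ) : UnitAddCircle)‖ ^ (-b)‖ ≤ _
    rw [Real.norm_of_nonneg (by positivity), UnitAddCircle.norm_eq, abs_sub_round_eq_min, hfr]
    have hx2 : 0 < 1 - x := by linarith
    have p1 : 0 ≤ x ^ (-b) := Real.rpow_nonneg hx.1.le _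
    have p2 : 0 ≤ (1 - x) ^ (-b) := Real.rpow_nonneg hx2.le _
    rcases min_cases x (1 - x) with ⟨h, -⟩ | ⟨h, -⟩ <;> rw [h] <;> linarith

instance : NullSingletonClass (AddCircle.haarAddCircle : Measure UnitAddCircle) where
  measure_singleton x := by
    rw [haarAddCircle_eq_volume, ← Metric.closedBall_zero, AddCircle.volume_closedBall]
    simp

lemma ae_forall_ne_zero : ∀ᵐ θ : Torus3 ∂dx, ∀ i, θ i ≠ 0 :=
  ae_all_iff.mpr fun i =>
    Measure.ae_eval_ne (μ := fun _ : Fin 3 => (AddCircle.haarAddCircle : Measure UnitAddCircle)) i 0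

/-- The sup norm dominates every coordinate, so the singular weight is at most the product of the
weights `‖θ i‖^{-a/3}`, each integrable on the circle since `a / 3 < 1`. -/
lemma integrable_norm_rpow {a : ℝ} (ha₀ : 0 ≤ a) (ha : a < 3) :
    Integrable (fun θ : Torus3 => ‖θ‖ ^ (-a)) dx := by
  have h1 : Integrable (fun θ : Torus3 => ∏ i, ‖θ i‖ ^ (-(a / 3))) dx :=
    Integrable.fintype_prod (f := fun _ t => ‖t‖ ^ (-(a / 3)))
      fun i => integrable_norm_rpow_circle (by linarith)
  have hm : Measurable fun θ : Torus3 => ‖θ‖ ^ (-a) := by fun_prop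
  refine h1.mono' hm.aestronglyMeasurable ?_
  filter_upwards [ae_forall_ne_zero] with θ hθ
  have h0 (i) : 0 < ‖θ i‖ := norm_pos_iff.mpr (hθ i)
  rw [Real.norm_of_nonneg (by positivity)]
  calc ‖θ‖ ^ (-a) = ∏ _i : Fin 3, ‖θ‖ ^ (-(a / 3)) := by
        rw [Finset.prod_const, Finset.card_univ, Fintype.card_fin, ← Real.rpow_natCast,
          ← Real.rpow_mul (norm_nonneg _)]
        congr 1
        push_cast; ring
    _ ≤ _ := by
        refine Finset.prod_le_prod (fun i _ => by positivity) fun i _ => ?_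
        exact Real.rpow_le_rpow_of_nonpos (h0 i) (norm_le_pi_norm θ i) (by linarith)

variable {β : ℝ} {V : Torus3 → ℝ}

/-- Regularity is only known for the lift to `ℝ³` away from the lattice, so it is pulled back along
a measurable section of the quotient map. -/
lemma IsInteraction.aestronglyMeasurable (hV : IsInteraction β V) :
    AEStronglyMeasurable V dx := by
  let s : Torus3 → EuclideanSpace ℝ (Fin 3) := fun θ =>
    WithLp.toLp 2 fun i => 2 * π * ((AddCircle.equivIoc 1 0 (θ i) : Set.Ioc (0 : ℝ) (0 + 1)) : ℝ)
  have hs : Measurable s := by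
    refine (WithLp.measurable_toLp 2 _).comp (measurable_pi_lambda _ fun i => ?_)
    refine Measurable.const_mul ?_ _
    exact measurable_subtype_coe.comp
      ((AddCircle.measurableEquivIoc (1 : ℝ) 0).measurable.comp (measurable_pi_apply i))
  have hst (θ : Torus3) : toTorus (s θ) = θ := by
    funext i
    simp only [toTorus, s]
    rw [mul_div_cancel_left₀ _ (by positivity)]
    exact (AddCircle.equivIoc (1 : ℝ) 0).symm_apply_apply (θ i)
  classical
  have hF : Measurable ({x : EuclideanSpace ℝ (Fin 3) | toTorus x ≠ 0}.piecewise
      (fun x => V (toTorus x)) fun _ => 0) :=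
    ContinuousOn.measurable_piecewise hV.smooth.continuousOn continuousOn_const
      isOpen_toTorus_ne_zero.measurableSet
  refine ⟨_, (hF.comp hs).stronglyMeasurable, ?_⟩
  filter_upwards [ae_forall_ne_zero] with θ hθ
  have : s θ ∈ {x : EuclideanSpace ℝ (Fin 3) | toTorus x ≠ 0} := by
    simp only [Set.mem_ofPred_eq, hst]
    exact fun h => hθ 0 (congr_fun h 0)
  simp only [Function.comp_apply]
  rw [Set.piecewise_eq_of_mem _ _ _ this, hst]

lemma ae_ne_zero_torus : ∀ᵐ θ : Torus3 ∂dx, θ ≠ 0 := by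
  filter_upwards [ae_forall_ne_zero] with θ hθ h
  exact hθ 0 (congr_fun h 0)

lemma IsInteraction.integrable (hV : IsInteraction β V) (hβ₀ : 0 < β) (hβ₃ : β < 3) :
    Integrable V dx := by
  obtain ⟨C, hC, h⟩ := hV.exists_abs_le hβ₃
  refine ((integrable_norm_rpow (a := 3 - β) (by linarith) (by linarith)).const_mul C).mono'
    hV.aestronglyMeasurable ?_
  filter_upwards [ae_ne_zero_torus] with θ hθ
  exact h θ hθ

/-- The `L¹` modulus of continuity of the potential. -/
lemma IsInteraction.exists_integral_abs_sub_le (hV : IsInteraction β V) (hβ₃ : β < 3)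
    {ϑ : ℝ} (hϑ₀ : 0 < ϑ) (hϑ₁ : ϑ ≤ 1) (hϑβ : ϑ < β) :
    ∃ C, 0 ≤ C ∧ ∀ h : Torus3, ∫⁻ θ, ‖V θ - V (θ - h)‖ₑ ∂dx ≤ ENNReal.ofReal (C * ‖h‖ ^ ϑ) := by
  obtain ⟨C, hC, hb⟩ := hV.exists_abs_sub_le hβ₃ hϑ₀.le hϑ₁
  set S : Torus3 → ℝ := fun θ => ‖θ‖ ^ (-(3 - β + ϑ)) with hS
  -- The condition `ϑ < β` keeps the exponent `3 - β + ϑ` below the dimension.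
  have hSint : Integrable S dx := integrable_norm_rpow (by linarith) (by linarith)
  have hS0 (θ) : 0 ≤ S θ := by simp only [hS]; positivity
  refine ⟨C * (2 * ∫ θ, S θ ∂dx), mul_nonneg hC (mul_nonneg two_pos.le (integral_nonneg hS0)),
    fun h => ?_⟩
  have hae : ∀ᵐ θ ∂dx, θ - h ≠ 0 :=
    (measurePreserving_sub_right dx h).quasiMeasurePreserving.ae ae_ne_zero_torus
  have hSint' : Integrable (fun θ => S (θ - h)) dx := hSint.comp_sub_right h
  calc ∫⁻ θ, ‖V θ - V (θ - h)‖ₑ ∂dx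
      ≤ ∫⁻ θ, ENNReal.ofReal (C * ‖h‖ ^ ϑ * (S (θ - h) + S θ)) ∂dx := by
        refine lintegral_mono_ae ?_
        filter_upwards [ae_ne_zero_torus, hae] with θ h1 h2
        have := hb (θ - h) h h2 (by rwa [sub_add_cancel])
        rw [sub_add_cancel] at this
        rw [← ofReal_norm, Real.norm_eq_abs]
        exact ENNReal.ofReal_le_ofReal this
    _ = _ := by
        have hsum : Integrable (fun θ => C * ‖h‖ ^ ϑ * (S (θ - h) + S θ)) dx :=
          (hSint'.add hSint).const_mul _
        rw [← ofReal_integral_eq_lintegral_ofReal hsum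
            (ae_of_all _ fun θ => mul_nonneg (by positivity) (add_nonneg (hS0 _) (hS0 _))),
          integral_const_mul, integral_add hSint' hSint, integral_sub_right_eq_self S h]
        congr 1; ring

lemma integrable_mul_comp_sub {F : Torus3 → ℝ} (hF : Integrable F dx)
    (hV : Integrable V dx) : Integrable (fun p : Torus3 × Torus3 => F p.2 * V (p.1 - p.2))
      (dx.prod dx) :=
  hF.convolution_integrand (ContinuousLinearMap.mul ℝ ℝ) hV

/-- Truncation of an integrable function to high frequencies with a small `L¹` norm. -/
lemma exists_high_frequency_kernel (hV : Integrable V dx) {C ϑ : ℝ} (hC : 0 ≤ C)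
    (hϑ₀ : 0 < ϑ) (hϑ₁ : ϑ ≤ 1)
    (h : ∀ h : Torus3, ∫⁻ θ, ‖V θ - V (θ - h)‖ₑ ∂dx ≤ ENNReal.ofReal (C * ‖h‖ ^ ϑ))
    {n : ℕ} (hn : 1 ≤ n) :
    ∃ U : Torus3 → ℝ, Integrable U dx ∧
      ∫⁻ θ, ‖U θ‖ₑ ∂dx ≤ ENNReal.ofReal (97 * C * (n : ℝ) ^ (-ϑ)) ∧
      ∀ ξ, 2 * n < height ξ → coeff U ξ = coeff V ξ := by
  have hJ := integrable_of_continuous_real (continuous_jackson n)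
  have hprod := integrable_mul_comp_sub hJ hV
  set W : Torus3 → ℝ := fun θ => ∫ η, jackson n η * V (θ - η) ∂dx with hW
  have hWint : Integrable W dx := hprod.integral_prod_left
  have hsec : ∀ᵐ θ ∂dx, Integrable (fun η => jackson n η * V (θ - η)) dx := hprod.prod_right_ae
  -- Subtracting the Jackson mean removes nothing above height `2n`, where the kernel has no
  -- frequencies.
  refine ⟨fun θ => V θ - W θ, hV.sub hWint, ?_, fun ξ hξ => ?_⟩
  · calc ∫⁻ θ, ‖V θ - W θ‖ₑ ∂dx
        ≤ ∫⁻ θ, ∫⁻ η, ‖jackson n η‖ₑ * ‖V θ - V (θ - η)‖ₑ ∂dx ∂dx := by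
          refine lintegral_mono_ae ?_
          filter_upwards [hsec] with θ hθ
          -- As the kernel has mass one, the difference is an average of increments of `V`, and
          -- Fubini brings in the `L¹` modulus of continuity.
          have : V θ - W θ = ∫ η, jackson n η * (V θ - V (θ - η)) ∂dx := by
            simp_rw [mul_sub]
            rw [integral_sub (hJ.mul_const _) hθ, integral_mul_const, integral_jackson hn, one_mul]
          rw [this]
          refine (enorm_integral_le_lintegral_enorm _).trans (le_of_eq ?_)
          simp_rw [enorm_mul]
      _ = ∫⁻ η, ‖jackson n η‖ₑ * ∫⁻ θ, ‖V θ - V (θ - η)‖ₑ ∂dx ∂dx := by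
          have hm : AEMeasurable (fun p : Torus3 × Torus3 => V p.1 - V (p.1 - p.2)) (dx.prod dx) :=
            hV.aemeasurable.comp_fst.sub (hV.aemeasurable.comp_quasiMeasurePreserving
                (quasiMeasurePreserving_sub_of_right_invariant dx dx))
          rw [lintegral_lintegral_swap]
          · refine lintegral_congr fun η => ?_
            rw [lintegral_const_mul' _ _ (by finiteness)]
          · exact ((continuous_jackson n).measurable.comp measurable_snd).enorm.aemeasurable.mul
              hm.enorm
      _ ≤ ∫⁻ η, ENNReal.ofReal (C * (jackson n η * ‖η‖ ^ ϑ)) ∂dx := by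
          refine lintegral_mono fun η => ?_
          refine (mul_le_mul_right (h η) _).trans (le_of_eq ?_)
          rw [← ofReal_norm, Real.norm_of_nonneg (jackson_nonneg hn η),
            ← ENNReal.ofReal_mul (jackson_nonneg hn η)]
          congr 1; ring
      _ ≤ _ := by
          have hc : Continuous fun η : Torus3 => jackson n η * ‖η‖ ^ ϑ :=
            (continuous_jackson n).mul (continuous_norm.rpow_const fun _ => Or.inr hϑ₀.le)
          rw [← ofReal_integral_eq_lintegral_ofReal
            ((integrable_of_continuous_real hc).const_mul _)
            (ae_of_all _ fun η => mul_nonneg hC (mul_nonneg (jackson_nonneg hn η) (by positivity))),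
            integral_const_mul]
          refine ENNReal.ofReal_le_ofReal ?_
          have := mul_le_mul_of_nonneg_left
            (integral_jackson_mul_rpow_le hn hϑ₀.le (by linarith : ϑ ≤ 2)) hC
          linarith
  · have hVc : Integrable (fun x => UnitAddTorus.mFourier (-ξ) x * (V x : ℂ)) dx :=
      hV.ofReal.bdd_mul (c := 1) (by fun_prop) (ae_of_all _ fun x => (norm_mFourier_apply _ _).le)
    have hWc : Integrable (fun x => UnitAddTorus.mFourier (-ξ) x * (W x : ℂ)) dx :=
      hWint.ofReal.bdd_mul (c := 1) (by fun_prop)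
        (ae_of_all _ fun x => (norm_mFourier_apply _ _).le)
    have hzero : ∫ x, UnitAddTorus.mFourier (-ξ) x * (W x : ℂ) ∂dx = 0 := by
      have h1 (x : Torus3) : UnitAddTorus.mFourier (-ξ) x * (W x : ℂ)
          = ∫ η, UnitAddTorus.mFourier (-ξ) x * ((jackson n η * V (x - η) : ℝ) : ℂ) ∂dx := by
        rw [integral_const_mul, integral_complex_ofReal]
      simp_rw [h1]
      have hp : Integrable (Function.uncurry fun x η : Torus3 =>
          UnitAddTorus.mFourier (-ξ) x * ((jackson n η * V (x - η) : ℝ) : ℂ)) (dx.prod dx) :=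
        hprod.ofReal.bdd_mul (c := 1) (by fun_prop)
          (ae_of_all _ fun p => (norm_mFourier_apply _ _).le)
      rw [integral_integral_swap hp]
      have h2 (η : Torus3) : ∫ x, UnitAddTorus.mFourier (-ξ) x * ((jackson n η * V (x - η) : ℝ) : ℂ)
          ∂dx = UnitAddTorus.mFourier (-ξ) η * jackson n η *
            ∫ x, UnitAddTorus.mFourier (-ξ) x * (V x : ℂ) ∂dx := by
        rw [← integral_const_mul, ← integral_sub_right_eq_self (fun x =>
          UnitAddTorus.mFourier (-ξ) η * jackson n η *
            (UnitAddTorus.mFourier (-ξ) x * (V x : ℂ))) η]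
        refine integral_congr_ae (ae_of_all _ fun x => ?_)
        dsimp only
        have := mFourier_apply_add (-ξ) (x - η) η
        rw [sub_add_cancel] at this
        rw [this]; push_cast; ring
      simp_rw [h2]
      rw [integral_mul_const, mFourierCoeff_jackson hξ, zero_mul]
    rw [coeff, coeff, mFourierCoeff_eq, mFourierCoeff_eq]
    push_cast
    simp_rw [mul_sub]
    rw [integral_sub hVc hWc, hzero, sub_zero]

end Integrability

/-! ### The bilinear form on trigonometric polynomials -/

section Forms

open UnitAddTorus

lemma aestronglyMeasurable_comp_sub {E : Type*} [NormedAddCommGroup E] {f : Torus3 → E}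
    (hf : AEStronglyMeasurable f dx) (z : Torus3) :
    AEStronglyMeasurable (fun x => f (x - z)) dx :=
  hf.comp_measurePreserving (measurePreserving_sub_right dx z)

lemma eLpNorm_comp_sub {E : Type*} [NormedAddCommGroup E] {f : Torus3 → E}
    (hf : AEStronglyMeasurable f dx) (z : Torus3) (r : ℝ≥0∞) :
    eLpNorm (fun x => f (x - z)) r dx = eLpNorm f r dx :=
  eLpNorm_comp_measurePreserving hf (measurePreserving_sub_right dx z)

/-- Hölder's inequality, uniform in the translation `z`. The functions enter the estimate only
through this bound, so no value of `r` needs special treatment. -/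
lemma lintegral_enorm_comp_sub_mul_le {r r' : ℝ≥0∞} (hrr' : r⁻¹ + r'⁻¹ = 1) {f₁ f₂ : Torus3 → ℂ}
    (h₁ : AEStronglyMeasurable f₁ dx) (h₂ : AEStronglyMeasurable f₂ dx) (z : Torus3) :
    ∫⁻ x, ‖f₁ (x - z)‖ₑ * ‖f₂ x‖ₑ ∂dx ≤ eLpNorm f₁ r dx * eLpNorm f₂ r' dx := by
  have : ENNReal.HolderTriple r r' 1 := ⟨by rw [hrr', inv_one]⟩
  have h := eLpNorm_smul_le_mul_eLpNorm (p := r) (q := r') (r := 1) h₂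
    (aestronglyMeasurable_comp_sub h₁ z)
  rw [eLpNorm_one_eq_lintegral_enorm, eLpNorm_comp_sub h₁] at h
  simpa [enorm_mul] using h

/-- The kernel of a bilinear form in the Fourier modes. -/
def modeSum (F : Finset Freq) (g : Freq → Freq → ℂ) (z x : Torus3) : ℂ :=
  ∑ n ∈ F, ∑ m ∈ F, g n m * (mFourier n (x - z) * mFourier m x)

/-- The form `∫ (V * (e_n f₁)) e_m f₂ dx` for trigonometric polynomials `f₁`, `f₂` with
coefficients `c₁`, `c₂`, in terms of the Fourier coefficients `v` of `V`. -/
def resonant (A : Finset Freq) (v : Freq → ℂ) (c₁ c₂ : Freq → ℂ) (n m : Freq) : ℂ :=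
  ∑ a ∈ A, ∑ b ∈ A, if n + a + (m + b) = 0 then c₁ a * c₂ b * v (n + a) else 0

@[fun_prop]
lemma continuous_modeSum (F : Finset Freq) (g : Freq → Freq → ℂ) :
    Continuous fun p : Torus3 × Torus3 => modeSum F g p.1 p.2 := by
  unfold modeSum; fun_prop

lemma integral_mode_mul_trigPoly (A : Finset Freq) (c₁ c₂ : Freq → ℂ) (n m : Freq) (z : Torus3) :
    ∫ x, mFourier n (x - z) * mFourier m x * (trigPoly A c₁ (x - z) * trigPoly A c₂ x) ∂dx
      = ∑ a ∈ A, ∑ b ∈ A, if n + a + (m + b) = 0 then c₁ a * c₂ b * mFourier (-(n + a)) z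
        else 0 := by
  have h (x : Torus3) : mFourier n (x - z) * mFourier m x *
      (trigPoly A c₁ (x - z) * trigPoly A c₂ x)
      = ∑ a ∈ A, ∑ b ∈ A, c₁ a * c₂ b * mFourier (-(n + a)) z *
          mFourier (n + a + (m + b)) x := by
    rw [trigPoly, trigPoly, Finset.sum_mul_sum, Finset.mul_sum]
    refine Finset.sum_congr rfl fun a _ => ?_
    rw [Finset.mul_sum]
    refine Finset.sum_congr rfl fun b _ => ?_
    rw [mFourier_add (m := n + a), mFourier_add (m := m), mFourier_apply_sub, mFourier_apply_sub,
      neg_add, mFourier_add (m := -n), mFourier_add (m := n)]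
    ring
  simp_rw [h]
  rw [integral_finsetSum _ fun a _ => integrable_of_continuous (by fun_prop)]
  refine Finset.sum_congr rfl fun a _ => ?_
  rw [integral_finsetSum _ fun b _ => integrable_of_continuous (by fun_prop)]
  refine Finset.sum_congr rfl fun b _ => ?_
  rw [integral_const_mul, integral_mFourier]
  split_ifs <;> simp

lemma integrable_mul_mFourier {U : Torus3 → ℝ} (hU : Integrable U dx) (n : Freq) :
    Integrable (fun z => (U z : ℂ) * mFourier n z) dx :=
  hU.ofReal.mul_bdd (c := 1) (by fun_prop) (ae_of_all _ fun z => (norm_mFourier_apply _ _).le)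

lemma integral_mul_mFourier_neg (U : Torus3 → ℝ) (n : Freq) :
    ∫ z, (U z : ℂ) * mFourier (-n) z ∂dx = coeff U n := by
  rw [coeff, mFourierCoeff_eq]
  simp_rw [mul_comm]

lemma integral_modeSum_mul {U : Torus3 → ℝ} (hU : Integrable U dx) (F A : Finset Freq)
    (g : Freq → Freq → ℂ) (c₁ c₂ : Freq → ℂ) :
    ∫ z, (U z : ℂ) * ∫ x, modeSum F g z x * (trigPoly A c₁ (x - z) * trigPoly A c₂ x) ∂dx ∂dx
      = ∑ n ∈ F, ∑ m ∈ F, g n m * resonant A (coeff U) c₁ c₂ n m := by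
  have h (z : Torus3) :
      (U z : ℂ) * ∫ x, modeSum F g z x * (trigPoly A c₁ (x - z) * trigPoly A c₂ x) ∂dx
      = ∑ n ∈ F, ∑ m ∈ F, ∑ a ∈ A, ∑ b ∈ A, g n m * (if n + a + (m + b) = 0 then
          c₁ a * c₂ b * ((U z : ℂ) * mFourier (-(n + a)) z) else 0) := by
    simp only [modeSum, Finset.sum_mul]
    rw [integral_finsetSum _ fun n _ => integrable_of_continuous (by fun_prop), Finset.mul_sum]
    refine Finset.sum_congr rfl fun n _ => ?_
    rw [integral_finsetSum _ fun m _ => integrable_of_continuous (by fun_prop), Finset.mul_sum]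
    refine Finset.sum_congr rfl fun m _ => ?_
    simp_rw [mul_assoc (g n m)]
    rw [integral_const_mul, integral_mode_mul_trigPoly, Finset.mul_sum, Finset.mul_sum]
    refine Finset.sum_congr rfl fun a _ => ?_
    rw [Finset.mul_sum, Finset.mul_sum]
    refine Finset.sum_congr rfl fun b _ => ?_
    split_ifs <;> ring
  have hi (n m a b : Freq) : Integrable (fun z => g n m * (if n + a + (m + b) = 0 then
      c₁ a * c₂ b * ((U z : ℂ) * mFourier (-(n + a)) z) else 0)) dx := by
    refine Integrable.const_mul ?_ _
    split_ifs
    · exact (integrable_mul_mFourier hU _).const_mul _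
    · exact integrable_zero _ _ _
  simp_rw [h]
  rw [integral_finsetSum _ fun n _ => integrable_finsetSum _ fun m _ => integrable_finsetSum _
    fun a _ => integrable_finsetSum _ fun b _ => hi n m a b]
  refine Finset.sum_congr rfl fun n _ => ?_
  rw [integral_finsetSum _ fun m _ => integrable_finsetSum _
    fun a _ => integrable_finsetSum _ fun b _ => hi n m a b]
  refine Finset.sum_congr rfl fun m _ => ?_
  rw [integral_finsetSum _ fun a _ => integrable_finsetSum _ fun b _ => hi n m a b, resonant,
    Finset.mul_sum]
  refine Finset.sum_congr rfl fun a _ => ?_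
  rw [integral_finsetSum _ fun b _ => hi n m a b, Finset.mul_sum]
  refine Finset.sum_congr rfl fun b _ => ?_
  rw [integral_const_mul]
  split_ifs
  · rw [integral_const_mul, integral_mul_mFourier_neg]
  · simp

/-- The kernel `V` may be replaced by a kernel `U` with the same Fourier coefficients at the
frequencies that matter, and only modes with bounded total frequency contribute. -/
lemma sum_mul_resonant_congr {F A : Finset Freq} {v u : Freq → ℂ} {g : Freq → Freq → ℂ}
    {c₁ c₂ : Freq → ℂ} {R : ℕ}
    (h : ∀ n m a b, g n m ≠ 0 → c₁ a ≠ 0 → c₂ b ≠ 0 → n + a + (m + b) = 0 →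
      u (n + a) = v (n + a) ∧ height (n + m) ≤ R) :
    ∑ n ∈ F, ∑ m ∈ F, g n m * resonant A v c₁ c₂ n m
      = ∑ n ∈ F, ∑ m ∈ F, (if height (n + m) ≤ R then g n m else 0) *
        resonant A u c₁ c₂ n m := by
  refine Finset.sum_congr rfl fun n _ => Finset.sum_congr rfl fun m _ => ?_
  rw [resonant, resonant, Finset.mul_sum, Finset.mul_sum]
  refine Finset.sum_congr rfl fun a _ => ?_
  rw [Finset.mul_sum, Finset.mul_sum]
  refine Finset.sum_congr rfl fun b _ => ?_
  by_cases h0 : n + a + (m + b) = 0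
  swap
  · simp [h0]
  by_cases hg : g n m = 0
  · simp [hg]
  by_cases h1 : c₁ a = 0
  · simp [h1]
  by_cases h2 : c₂ b = 0
  · simp [h2]
  obtain ⟨e1, e2⟩ := h n m a b hg h1 h2 h0
  rw [if_pos e2, e1]

lemma memLp_trigPoly (S : Finset Freq) (c : Freq → ℂ) (r : ℝ≥0∞) :
    MemLp (trigPoly S c) r dx := by
  refine MemLp.of_bound (continuous_trigPoly S c).aestronglyMeasurable (∑ n ∈ S, ‖c n‖)
    (ae_of_all _ fun x => (norm_sum_le _ _).trans (Finset.sum_le_sum fun n _ => ?_))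
  rw [norm_mul, norm_mFourier_apply, mul_one]

/-- The sum is an integral over `z` of `U` against an `x`-integral. A bound on the kernel uniform in
`x` separates the randomness, left in `S`, from the functions. -/
lemma enorm_sum_mul_resonant_le {U : Torus3 → ℝ} (hU : Integrable U dx) (F A : Finset Freq)
    (g : Freq → Freq → ℂ) (c₁ c₂ : Freq → ℂ) {r r' : ℝ≥0∞} (hrr' : r⁻¹ + r'⁻¹ = 1)
    (S : Torus3 → ℝ≥0∞) (hS : ∀ z x, ‖modeSum F g z x‖ₑ ≤ S z) :
    ‖∑ n ∈ F, ∑ m ∈ F, g n m * resonant A (coeff U) c₁ c₂ n m‖ₑ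
      ≤ (∫⁻ z, ‖U z‖ₑ * S z ∂dx) *
        (eLpNorm (trigPoly A c₁) r dx * eLpNorm (trigPoly A c₂) r' dx) := by
  rw [← integral_modeSum_mul hU]
  refine (enorm_integral_le_lintegral_enorm _).trans ?_
  have hN : eLpNorm (trigPoly A c₁) r dx * eLpNorm (trigPoly A c₂) r' dx ≠ ∞ :=
    ENNReal.mul_ne_top (memLp_trigPoly _ _ _).2.ne (memLp_trigPoly _ _ _).2.ne
  rw [← lintegral_mul_const' _ _ hN]
  refine lintegral_mono fun z => ?_
  rw [enorm_mul, mul_assoc]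
  gcongr
  · simp [← ofReal_norm]
  · refine (enorm_integral_le_lintegral_enorm _).trans ?_
    calc ∫⁻ x, ‖modeSum F g z x * (trigPoly A c₁ (x - z) * trigPoly A c₂ x)‖ₑ ∂dx
        ≤ ∫⁻ x, S z * (‖trigPoly A c₁ (x - z)‖ₑ * ‖trigPoly A c₂ x‖ₑ) ∂dx := by
          refine lintegral_mono fun x => ?_
          rw [enorm_mul, enorm_mul]
          gcongr
          exact hS z x
      _ ≤ S z * (eLpNorm (trigPoly A c₁) r dx * eLpNorm (trigPoly A c₂) r' dx) := by
          rw [lintegral_const_mul _ (by fun_prop)]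
          gcongr
          exact lintegral_enorm_comp_sub_mul_le hrr'
            (continuous_trigPoly _ _).aestronglyMeasurable
            (continuous_trigPoly _ _).aestronglyMeasurable z

end Forms

/-! ### Moments of the supremum of the random kernel -/

section RandomModes

open UnitAddTorus

/-- A bound for the supremum norm of `modeSum F g z` through its `L^{2m}` norm. -/
def supBound (F : Finset Freq) (g : Freq → Freq → ℂ) (L m : ℕ) (z : Torus3) : ℝ≥0∞ :=
  (((2 * (m * L) + 1) ^ 3 : ℕ) * ∫⁻ x, ‖modeSum F g z x‖ₑ ^ (2 * m) ∂dx) ^ (1 / (2 * m : ℝ))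

lemma supBound_pow (F : Finset Freq) (g : Freq → Freq → ℂ) (L : ℕ) {m : ℕ} (hm : 1 ≤ m)
    (z : Torus3) : supBound F g L m z ^ (2 * m) =
      ((2 * (m * L) + 1) ^ 3 : ℕ) * ∫⁻ x, ‖modeSum F g z x‖ₑ ^ (2 * m) ∂dx := by
  rw [supBound, ← ENNReal.rpow_natCast, ← ENNReal.rpow_mul]
  have : (1 / (2 * m : ℝ)) * ((2 * m : ℕ) : ℝ) = 1 := by
    push_cast
    rw [one_div_mul_cancel]
    positivity
  rw [this, ENNReal.rpow_one]

/-- For fixed `z` the frequencies in `x` are the sums `n + k`, which makes Nikolskii's inequality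
available in `x` alone. -/
lemma exists_modeSum_eq_trigPoly {F : Finset Freq} {g : Freq → Freq → ℂ} {L : ℕ}
    (hL : ∀ n ∈ F, ∀ k ∈ F, g n k ≠ 0 → height (n + k) ≤ L) (z : Torus3) :
    ∃ c, ∀ x, modeSum F g z x = trigPoly (box L) c x := by
  classical
  refine ⟨fun l => ∑ n ∈ F, ∑ k ∈ F, if n + k = l then g n k * mFourier (-n) z else 0,
    fun x => ?_⟩
  rw [modeSum, trigPoly]
  simp_rw [Finset.sum_mul]
  rw [Finset.sum_comm (s := box L)]
  refine Finset.sum_congr rfl fun n hn => ?_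
  rw [Finset.sum_comm (s := box L)]
  refine Finset.sum_congr rfl fun k hk => ?_
  by_cases hg : g n k = 0
  · simp [hg]
  simp_rw [ite_mul, zero_mul]
  rw [Finset.sum_ite_eq, if_pos (mem_box.mpr (hL n hn k hk hg)), mFourier_add,
    mFourier_apply_sub]
  ring

lemma enorm_modeSum_le_supBound {F : Finset Freq} {g : Freq → Freq → ℂ} {L m : ℕ} (hm : 1 ≤ m)
    (hL : ∀ n ∈ F, ∀ k ∈ F, g n k ≠ 0 → height (n + k) ≤ L) (z x : Torus3) :
    ‖modeSum F g z x‖ₑ ≤ supBound F g L m z := by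
  rw [← ENNReal.pow_le_pow_left_iff (n := 2 * m) (by omega), supBound_pow F g L hm]
  obtain ⟨c, hc⟩ := exists_modeSum_eq_trigPoly hL z
  simp_rw [hc]
  exact enorm_trigPoly_pow_le c m x

variable {Ω : Type*} [MeasurableSpace Ω] {P : Measure Ω} {a : Freq → Ω → ℂ} {F : Finset Freq}
  {s : Freq → ℝ}

/-- The renormalised products of the modes `a n`, restricted to the pairs in `D`. -/
def wickProd (P : Measure Ω) (a : Freq → Ω → ℂ) (D : Freq → Freq → Prop)
    [∀ n k, Decidable (D n k)] (ω : Ω) (n k : Freq) : ℂ :=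
  if D n k then a n ω * a k ω - ∫ ω', a n ω' * a k ω' ∂P else 0

/-- The products of characters are unimodular, so the chaos bound is the same at every point `(z,
x)`. It is applied to the law of the finitely many modes in `F`. -/
lemma lintegral_enorm_modeSum_pow_le
    (hlaw : HasGaussianLaw (fun ω => fun n : F => a n ω) P)
    (h0 : ∀ n ∈ F, ∫ ω, a n ω ∂P = 0) (hs : ∀ n, 0 ≤ s n)
    (hcov : ∀ n ∈ F, ∀ k ∈ F, ∫ ω, a n ω * conj (a k ω) ∂P = if n = k then (s n : ℂ) else 0)
    (D : Freq → Freq → Prop) [∀ n k, Decidable (D n k)] {m : ℕ} (hm : 1 ≤ m) (z x : Torus3) :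
    ∫⁻ ω, ‖modeSum F (wickProd P a D ω) z x‖ₑ ^ (2 * m) ∂P ≤
      ENNReal.ofReal ((192 * m) ^ 2 * ∑ n ∈ F, ∑ k ∈ F, if D n k then s n * s k else 0) ^ m := by
  set X : Ω → F → ℂ := fun ω n => a n ω with hX
  set μ := P.map X with hμ
  have hXm : AEMeasurable X P := hlaw.aemeasurable
  have : IsGaussian μ := hlaw.isGaussian_map
  have hmul (i j : F) : ∫ w, w i * w j ∂μ = ∫ ω, a i ω * a j ω ∂P := by
    rw [hμ, integral_map hXm (by fun_prop)]
  have hmean : ∫ w, w ∂μ = 0 := by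
    funext i
    have h := (ContinuousLinearMap.proj (R := ℝ) (φ := fun _ : F => ℂ) i).integral_comp_comm
      (IsGaussian.integrable_id (μ := μ))
    have h2 : ∫ w : F → ℂ, w i ∂μ = 0 := by
      rw [hμ, integral_map hXm (measurable_pi_apply i).aestronglyMeasurable]
      exact h0 i i.2
    exact h.symm.trans h2
  have hc (i j : F) : ∫ w, w i * conj (w j) ∂μ = if i = j then ((s i : ℝ) : ℂ) else 0 := by
    rw [hμ, integral_map hXm (by fun_prop)]
    simp only [hX]
    rw [hcov i i.2 j j.2]
    by_cases h : i = j
    · rw [if_pos h, if_pos (congrArg _ h)]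
    · rw [if_neg h, if_neg fun h' => h (Subtype.ext h')]
  set b : F → F → ℂ := fun i j =>
    if D i j then mFourier (i : Freq) (x - z) * mFourier (j : Freq) x else 0 with hb
  have h := lintegral_enorm_chaos_pow_le (μ := μ) (s := fun i : F => s i) hmean (fun i => hs i)
    hc b hm
  rw [hμ, lintegral_map' (by fun_prop) hXm, ← hμ] at h
  refine (le_of_eq ?_).trans (h.trans (le_of_eq ?_))
  · refine lintegral_congr fun ω => ?_
    congr 2
    rw [modeSum, ← Finset.sum_coe_sort F]
    refine Finset.sum_congr rfl fun i _ => ?_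
    rw [← Finset.sum_coe_sort F]
    refine Finset.sum_congr rfl fun j _ => ?_
    rw [hmul, wickProd]
    simp only [hb, hX]
    split_ifs <;> ring
  · congr 3
    rw [← Finset.sum_coe_sort F]
    refine Finset.sum_congr rfl fun i _ => ?_
    rw [← Finset.sum_coe_sort F]
    refine Finset.sum_congr rfl fun j _ => ?_
    simp only [hb]
    split_ifs
    · simp [norm_mFourier_apply]
    · simp

lemma aemeasurable_enorm_modeSum_pow {Y : Type*} [MeasurableSpace Y] {ν : Measure Y} [SFinite ν]
    [SFinite P] (ha : ∀ n ∈ F, AEMeasurable (a n) P)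
    (D : Freq → Freq → Prop) [∀ n k, Decidable (D n k)] {f g : Y → Torus3} (hf : Measurable f)
    (hg : Measurable g) (m : ℕ) :
    AEMeasurable (fun p : Ω × Y => ‖modeSum F (wickProd P a D p.1) (f p.2) (g p.2)‖ₑ ^ m)
      (P.prod ν) := by
  refine AEMeasurable.pow_const (AEMeasurable.enorm ?_) _
  unfold modeSum
  refine Finset.aemeasurable_fun_sum _ fun n hn => Finset.aemeasurable_fun_sum _ fun k hk => ?_
  refine AEMeasurable.mul ?_ ?_
  · unfold wickProd
    split_ifs
    · exact ((ha n hn).comp_fst.mul (ha k hk).comp_fst).sub aemeasurable_const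
    · exact aemeasurable_const
  · have : Measurable fun y => mFourier n (g y - f y) * mFourier k (g y) := by fun_prop
    exact (this.comp measurable_snd).aemeasurable

lemma measurable_supBound (g : Freq → Freq → ℂ) (L m : ℕ) : Measurable (supBound F g L m) := by
  have hc : Continuous fun p : Torus3 × Torus3 => ‖modeSum F g p.1 p.2‖ₑ ^ (2 * m) := by fun_prop
  exact (hc.measurable.lintegral_prod_right'.const_mul _).pow_const _

/-- Moments of an average of the suprema of a renormalised product. -/
lemma lintegral_lintegral_supBound_pow_le [IsProbabilityMeasure P]
    (hlaw : HasGaussianLaw (fun ω => fun n : F => a n ω) P)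
    (h0 : ∀ n ∈ F, ∫ ω, a n ω ∂P = 0) (hs : ∀ n, 0 ≤ s n)
    (hcov : ∀ n ∈ F, ∀ k ∈ F, ∫ ω, a n ω * conj (a k ω) ∂P = if n = k then (s n : ℂ) else 0)
    (D : Freq → Freq → Prop) [∀ n k, Decidable (D n k)] {L m : ℕ} (hm : 1 ≤ m)
    {U : Torus3 → ℝ} (hU : Integrable U dx) :
    ∫⁻ ω, (∫⁻ z, ‖U z‖ₑ * supBound F (wickProd P a D ω) L m z ∂dx) ^ (2 * m) ∂P ≤
      (∫⁻ z, ‖U z‖ₑ ∂dx) ^ (2 * m) * (((2 * (m * L) + 1) ^ 3 : ℕ) * ENNReal.ofReal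
        ((192 * m) ^ 2 * ∑ n ∈ F, ∑ k ∈ F, if D n k then s n * s k else 0) ^ m) := by
  have ha (n : Freq) (hn : n ∈ F) : AEMeasurable (a n) P :=
    (measurable_pi_apply (⟨n, hn⟩ : F)).comp_aemeasurable hlaw.aemeasurable
  have hUm : AEMeasurable (fun z => ‖U z‖ₑ) dx := hU.aestronglyMeasurable.enorm
  set K := ∫⁻ z, ‖U z‖ₑ ∂dx with hK
  set N : ℝ≥0∞ := (((2 * (m * L) + 1) ^ 3 : ℕ) : ℝ≥0∞) with hN
  set B := ENNReal.ofReal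
    ((192 * m) ^ 2 * ∑ n ∈ F, ∑ k ∈ F, if D n k then s n * s k else 0) ^ m with hB
  have hjensen (ω : Ω) : (∫⁻ z, ‖U z‖ₑ * supBound F (wickProd P a D ω) L m z ∂dx) ^ (2 * m) ≤
      K ^ (2 * m - 1) * ∫⁻ p : Torus3 × Torus3,
        ‖U p.1‖ₑ * (N * ‖modeSum F (wickProd P a D ω) p.1 p.2‖ₑ ^ (2 * m)) ∂(dx.prod dx) := by
    -- Jensen's inequality for `|U(z)| dz`, so that only the `L¹` norm of `U` enters.
    have h := lintegral_pow_le_of_measure (μ := dx.withDensity fun z => ‖U z‖ₑ)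
      (measurable_supBound (F := F) (wickProd P a D ω) L m).aemeasurable (m := 2 * m) (by omega)
    rw [lintegral_withDensity_eq_lintegral_mul₀ hUm (measurable_supBound _ L m).aemeasurable,
      lintegral_withDensity_eq_lintegral_mul₀ hUm
        ((measurable_supBound _ L m).pow_const _).aemeasurable,
      withDensity_apply _ MeasurableSet.univ, Measure.restrict_univ] at h
    simp only [Pi.mul_apply] at h
    refine h.trans (le_of_eq ?_)
    congr 1
    have hc : Measurable fun p : Torus3 × Torus3 =>
        ‖modeSum F (wickProd P a D ω) p.1 p.2‖ₑ ^ (2 * m) := by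
      have : Continuous fun p : Torus3 × Torus3 =>
        ‖modeSum F (wickProd P a D ω) p.1 p.2‖ₑ ^ (2 * m) := by fun_prop
      exact this.measurable
    have hint : AEMeasurable (fun p : Torus3 × Torus3 =>
        ‖U p.1‖ₑ * (N * ‖modeSum F (wickProd P a D ω) p.1 p.2‖ₑ ^ (2 * m))) (dx.prod dx) :=
      hUm.comp_fst.mul (hc.const_mul _).aemeasurable
    rw [lintegral_prod _ hint]
    refine lintegral_congr fun z => ?_
    dsimp only
    rw [supBound_pow _ _ _ hm, lintegral_const_mul' _ _ (by finiteness),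
      lintegral_const_mul' _ _ (by finiteness)]
  have hm' : AEMeasurable (fun q : Ω × (Torus3 × Torus3) =>
      ‖U q.2.1‖ₑ * (N * ‖modeSum F (wickProd P a D q.1) q.2.1 q.2.2‖ₑ ^ (2 * m)))
      (P.prod (dx.prod dx)) :=
    (hUm.comp_fst.comp_snd).mul
      ((aemeasurable_enorm_modeSum_pow ha D measurable_fst measurable_snd _).const_mul _)
  calc ∫⁻ ω, (∫⁻ z, ‖U z‖ₑ * supBound F (wickProd P a D ω) L m z ∂dx) ^ (2 * m) ∂P
      ≤ ∫⁻ ω, K ^ (2 * m - 1) * ∫⁻ p : Torus3 × Torus3,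
        ‖U p.1‖ₑ * (N * ‖modeSum F (wickProd P a D ω) p.1 p.2‖ₑ ^ (2 * m)) ∂(dx.prod dx) ∂P :=
        lintegral_mono hjensen
    _ = K ^ (2 * m - 1) * ∫⁻ p : Torus3 × Torus3, ‖U p.1‖ₑ * (N *
          ∫⁻ ω, ‖modeSum F (wickProd P a D ω) p.1 p.2‖ₑ ^ (2 * m) ∂P) ∂(dx.prod dx) := by
        rw [lintegral_const_mul' _ _ (ENNReal.pow_ne_top hU.2.ne), lintegral_lintegral_swap hm']
        congr 1
        refine lintegral_congr fun p => ?_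
        rw [lintegral_const_mul' _ _ (by finiteness), lintegral_const_mul' _ _ (by finiteness)]
    _ ≤ K ^ (2 * m - 1) * ∫⁻ p : Torus3 × Torus3, ‖U p.1‖ₑ * (N * B) ∂(dx.prod dx) := by
        gcongr with p
        exact lintegral_enorm_modeSum_pow_le hlaw h0 hs hcov D hm p.1 p.2
    _ = K ^ (2 * m - 1) * (K * (N * B)) := by
        have hint : AEMeasurable (fun p : Torus3 × Torus3 => ‖U p.1‖ₑ * (N * B)) (dx.prod dx) :=
          hUm.comp_fst.mul_const _
        rw [lintegral_prod _ hint]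
        simp only [lintegral_const, measure_univ, mul_one]
        rw [lintegral_mul_const'' _ hUm]
    _ = _ := by
        rw [← mul_assoc, ← pow_succ, Nat.sub_add_cancel (by omega)]

end RandomModes

/-! ### Dyadic shells, variance count and choice of the localised kernel -/

section Localization

/-- The index of the dyadic shell of a frequency. -/
def shell (n : Freq) : ℕ := Nat.size (height n)

lemma height_lt_of_shell_eq {n : Freq} {k : ℕ} (h : shell n = k) : height n < 2 ^ k :=
  h ▸ Nat.lt_size_self _

lemma two_pow_le_height {n : Freq} {k : ℕ} (h : shell n = k) (hk : 1 ≤ k) :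
    2 ^ k ≤ 2 * height n := by
  obtain ⟨l, rfl⟩ : ∃ l, k = l + 1 := ⟨k - 1, by omega⟩
  have : 2 ^ l ≤ height n := Nat.lt_size.1 (by rw [← shell, h]; omega)
  rw [pow_succ]; omega

lemma inv_one_add_height_sq_le {n : Freq} {k : ℕ} (h : shell n = k) :
    1 / (1 + (height n : ℝ) ^ 2) ≤ 4 / 4 ^ k := by
  rw [div_le_div_iff₀ (by positivity) (by positivity), one_mul]
  rcases Nat.eq_zero_or_pos k with rfl | hk
  · have : (0 : ℝ) ≤ (height n : ℝ) ^ 2 := by positivity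
    simp only [pow_zero]; linarith
  · have h2 : ((2 ^ k : ℕ) : ℝ) ≤ ((2 * height n : ℕ) : ℝ) :=
      Nat.cast_le.2 (two_pow_le_height h hk)
    push_cast at h2
    have : (4 : ℝ) ^ k = (2 ^ k) ^ 2 := by rw [← pow_mul, mul_comm, pow_mul]; norm_num
    have h0 : (0 : ℝ) ≤ 2 ^ k := by positivity
    nlinarith

lemma card_filter_shell_le (F : Finset Freq) (k : ℕ) :
    ((F.filter fun n => shell n = k).card : ℝ) ≤ 8 * 8 ^ k := by
  have h1 : (F.filter fun n => shell n = k) ⊆ box (2 ^ k - 1) := fun n hn => by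
    rw [mem_box]
    have := height_lt_of_shell_eq (Finset.mem_filter.1 hn).2
    omega
  have h2 := Finset.card_le_card h1
  rw [card_box] at h2
  have h3 : 2 * (2 ^ k - 1) + 1 ≤ 2 * 2 ^ k := by have := Nat.one_le_two_pow (n := k); omega
  have h4 : (F.filter fun n => shell n = k).card ≤ (2 * 2 ^ k) ^ 3 :=
    h2.trans (Nat.pow_le_pow_left h3 3)
  have h5 : ((F.filter fun n => shell n = k).card : ℝ) ≤ ((2 * 2 ^ k) ^ 3 : ℕ) := by
    exact_mod_cast h4
  refine h5.trans (le_of_eq ?_)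
  push_cast
  rw [mul_pow, ← pow_mul, mul_comm k, pow_mul]; norm_num

lemma card_filter_height_add_le (F : Finset Freq) (n : Freq) (R : ℕ) :
    ((F.filter fun m => height (n + m) ≤ R).card : ℝ) ≤ (2 * (R : ℝ) + 1) ^ 3 := by
  have h : (F.filter fun m => height (n + m) ≤ R).card ≤ (box R).card :=
    Finset.card_le_card_of_injOn (fun m => n + m)
      (fun m hm => mem_box.2 (Finset.mem_filter.1 hm).2) (fun a _ b _ hab => add_left_cancel hab)
  rw [card_box] at h
  exact_mod_cast h

/-- The size, up to a constant, of the variance of a frequency localised renormalised product. -/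
def varianceBound (k₁ k₂ R : ℕ) : ℝ := 2 ^ k₁ / 4 ^ k₂ * min (8 ^ k₂) ((2 * (R : ℝ) + 1) ^ 3)

lemma varianceBound_nonneg (k₁ k₂ R : ℕ) : 0 ≤ varianceBound k₁ k₂ R := by
  unfold varianceBound; positivity

/-- The pairs of frequencies in given shells with a small sum. -/
def shellPair (k₁ k₂ R : ℕ) (n m : Freq) : Prop :=
  shell n = k₁ ∧ shell m = k₂ ∧ height (n + m) ≤ R

instance (k₁ k₂ R : ℕ) (n m : Freq) : Decidable (shellPair k₁ k₂ R n m) := by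
  unfold shellPair; infer_instance

/-- Each term is at most `16 / 4^{k₁+k₂}`. There are at most `8 · 8^{k₁}` choices of `n`, and for
each of them `m` ranges over its shell and also over a translate of a box of radius `R`. The
constant is `16 · 8 · 8`. -/
lemma sum_shellPair_le {s : Freq → ℝ} (hs₀ : ∀ n, 0 ≤ s n)
    (hs : ∀ n, s n ≤ 1 / (1 + (height n : ℝ) ^ 2)) (F : Finset Freq) (k₁ k₂ R : ℕ) :
    ∑ n ∈ F, ∑ m ∈ F, (if shellPair k₁ k₂ R n m then s n * s m else 0)
      ≤ 1024 * varianceBound k₁ k₂ R := by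
  have hin (n : Freq) (hn : shell n = k₁) :
      ∑ m ∈ F, (if shellPair k₁ k₂ R n m then s n * s m else 0)
        ≤ 16 / (4 ^ k₁ * 4 ^ k₂) * (8 * min (8 ^ k₂) ((2 * (R : ℝ) + 1) ^ 3)) := by
    have hcard : ((F.filter fun m => shellPair k₁ k₂ R n m).card : ℝ)
        ≤ 8 * min (8 ^ k₂) ((2 * (R : ℝ) + 1) ^ 3) := by
      rw [mul_min_of_nonneg _ _ (by norm_num)]
      refine le_min ?_ ?_
      · refine le_trans ?_ (card_filter_shell_le F k₂)
        exact_mod_cast Finset.card_le_card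
          (Finset.monotone_filter_right F fun m _ (hm : shellPair k₁ k₂ R n m) => hm.2.1)
      · have : ((F.filter fun m => shellPair k₁ k₂ R n m).card : ℝ) ≤ (2 * (R : ℝ) + 1) ^ 3 := by
          refine le_trans ?_ (card_filter_height_add_le F n R)
          exact_mod_cast Finset.card_le_card
            (Finset.monotone_filter_right F fun m _ (hm : shellPair k₁ k₂ R n m) => hm.2.2)
        have h0 : (0 : ℝ) ≤ (2 * (R : ℝ) + 1) ^ 3 := by positivity
        linarith
    rw [← Finset.sum_filter]
    have hterm : ∀ m ∈ F.filter (fun m => shellPair k₁ k₂ R n m),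
        s n * s m ≤ 16 / (4 ^ k₁ * 4 ^ k₂) := fun m hm => by
      have hm2 := (Finset.mem_filter.1 hm).2.2.1
      calc s n * s m ≤ 4 / 4 ^ k₁ * (4 / 4 ^ k₂) :=
            mul_le_mul ((hs n).trans (inv_one_add_height_sq_le hn))
              ((hs m).trans (inv_one_add_height_sq_le hm2)) (hs₀ m) (by positivity)
        _ = 16 / (4 ^ k₁ * 4 ^ k₂) := by rw [div_mul_div_comm]; norm_num
    refine (Finset.sum_le_card_nsmul _ _ _ hterm).trans ?_
    rw [nsmul_eq_mul, mul_comm]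
    exact mul_le_mul_of_nonneg_left hcard (by positivity)
  have hout : ∑ n ∈ F, ∑ m ∈ F, (if shellPair k₁ k₂ R n m then s n * s m else 0)
      = ∑ n ∈ F.filter (fun n => shell n = k₁),
        ∑ m ∈ F, (if shellPair k₁ k₂ R n m then s n * s m else 0) := by
    rw [Finset.sum_filter]
    refine Finset.sum_congr rfl fun n _ => ?_
    split_ifs with h
    · rfl
    · exact Finset.sum_eq_zero fun m _ => if_neg fun hp => h hp.1
  rw [hout]
  refine (Finset.sum_le_card_nsmul _ _ _ fun n hn => hin n (Finset.mem_filter.1 hn).2).trans ?_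
  rw [nsmul_eq_mul]
  refine (mul_le_mul_of_nonneg_right (card_filter_shell_le F k₁) (by positivity)).trans
    (le_of_eq ?_)
  have h8 : (8 : ℝ) ^ k₁ = 2 ^ k₁ * 4 ^ k₁ := by rw [← mul_pow]; norm_num
  rw [varianceBound, h8]
  field_simp
  norm_num

lemma two_rpow_natCast (k : ℕ) : (2 : ℝ) ^ (k : ℝ) = 2 ^ k := Real.rpow_natCast 2 k

lemma sqrt_varianceBound_le (k₁ k₂ R : ℕ) :
    √(varianceBound k₁ k₂ R) ≤ 2 ^ (((k₁ : ℝ) + k₂) / 2) := by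
  refine Real.sqrt_le_iff.2 ⟨by positivity, ?_⟩
  rw [← Real.rpow_mul_natCast (by norm_num)]
  have h8 : (8 : ℝ) ^ k₂ = 2 ^ k₂ * 4 ^ k₂ := by rw [← mul_pow]; norm_num
  calc varianceBound k₁ k₂ R ≤ 2 ^ k₁ / 4 ^ k₂ * 8 ^ k₂ :=
        mul_le_mul_of_nonneg_left (min_le_left _ _) (by positivity)
    _ = 2 ^ k₁ * 2 ^ k₂ := by rw [h8]; field_simp
    _ = _ := by
        rw [← pow_add, ← two_rpow_natCast]; congr 1; push_cast; ring

/-- Here the restriction on `n + m` is the one that counts. The factor `2^9` is the root of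
`(2^6)^3`, from `2 · 2^{J+4} + 1 ≤ 2^{J+6}`. -/
lemma sqrt_varianceBound_two_pow_le (k₁ k₂ J : ℕ) :
    √(varianceBound k₁ k₂ (2 ^ (J + 4))) ≤ 2 ^ 9 * 2 ^ ((k₁ : ℝ) / 2 - k₂ + 3 / 2 * J) := by
  refine Real.sqrt_le_iff.2 ⟨by positivity, ?_⟩
  rw [mul_pow, ← Real.rpow_mul_natCast (by norm_num)]
  have h3 : ((2 * (2 ^ (J + 4) : ℕ) + 1 : ℝ)) ≤ 2 ^ (J + 6) := by
    push_cast
    have : (1 : ℝ) ≤ 2 ^ J := one_le_pow₀ (by norm_num)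
    rw [pow_add, pow_add]; linarith
  calc varianceBound k₁ k₂ (2 ^ (J + 4)) ≤ 2 ^ k₁ / 4 ^ k₂ * (2 ^ (J + 6)) ^ 3 :=
        mul_le_mul_of_nonneg_left ((min_le_right _ _).trans
          (pow_le_pow_left₀ (by positivity) h3 3)) (by positivity)
    _ = (2 ^ 9) ^ 2 * (2 ^ k₁ / (2 ^ k₂) ^ 2 * (2 ^ J) ^ 3) := by
        rw [pow_add, mul_pow, ← pow_mul 2 k₂, mul_comm k₂, pow_mul 2 2]; norm_num; ring
    _ = _ := by
        congr 1
        rw [← two_rpow_natCast, ← two_rpow_natCast, ← two_rpow_natCast, ← Real.rpow_mul_natCast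
          (by norm_num), ← Real.rpow_mul_natCast (by norm_num), ← Real.rpow_sub (by norm_num),
          ← Real.rpow_add (by norm_num)]
        congr 1; push_cast; ring

/-- The Jackson kernel is taken at `n = 2^{k-4}`, so coefficients above height `2^{k-3}` are kept.
The threshold `3/8 · 2^k` is what remains of a height at least `2^{k-1}` after a perturbation below
`2^{k-3}`. -/
lemma exists_shell_kernel {V : Torus3 → ℝ} {β ϑ : ℝ} (hβ₀ : 0 < β) (hβ₃ : β < 3)
    (hV : IsInteraction β V) (hϑ₀ : 0 < ϑ) (hϑ₁ : ϑ ≤ 1) (hϑβ : ϑ < β) :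
    ∃ C : ℝ, 0 ≤ C ∧ ∀ k : ℕ, 6 ≤ k → ∃ U : Torus3 → ℝ, Integrable U dx ∧
      ∫⁻ z, ‖U z‖ₑ ∂dx ≤ ENNReal.ofReal (C * 2 ^ (-ϑ * k)) ∧
      ∀ ξ, 3 * 2 ^ k ≤ 8 * height ξ → coeff U ξ = coeff V ξ := by
  obtain ⟨C, hC, h⟩ := hV.exists_integral_abs_sub_le hβ₃ hϑ₀ hϑ₁ hϑβ
  refine ⟨97 * C * 2 ^ (4 * ϑ), by positivity, fun k hk => ?_⟩
  obtain ⟨l, rfl⟩ : ∃ l, k = l + 4 := ⟨k - 4, by omega⟩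
  obtain ⟨U, hU, hU1, hU2⟩ := exists_high_frequency_kernel (hV.integrable hβ₀ hβ₃) hC hϑ₀ hϑ₁ h
    (n := 2 ^ l) Nat.one_le_two_pow
  refine ⟨U, hU, hU1.trans (ENNReal.ofReal_le_ofReal (le_of_eq ?_)), fun ξ hξ => hU2 ξ ?_⟩
  · push_cast
    rw [mul_assoc, ← two_rpow_natCast, ← Real.rpow_mul (by norm_num),
      mul_assoc (97 * C), ← Real.rpow_add (by norm_num), mul_assoc]
    congr 3; ring
  · rw [pow_add] at hξ
    have := Nat.one_le_two_pow (n := l)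
    omega

lemma lintegral_mul_localization_le {K : ℝ≥0∞} {C₁ C₂ x y u E v c : ℝ} (hC₁ : 0 ≤ C₁)
    (hK : K ≤ ENNReal.ofReal (C₁ * 2 ^ x)) (hv : v ≤ C₂ * 2 ^ y) (h : x + u + y ≤ c + E) :
    K * ENNReal.ofReal (2 ^ u * v) ≤ ENNReal.ofReal (C₁ * |C₂| * 2 ^ c * 2 ^ E) := by
  calc K * ENNReal.ofReal (2 ^ u * v)
      ≤ ENNReal.ofReal (C₁ * 2 ^ x) * ENNReal.ofReal (2 ^ u * (|C₂| * 2 ^ y)) := by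
        gcongr
        exact hv.trans (by gcongr; exact le_abs_self _)
    _ = ENNReal.ofReal (C₁ * |C₂| * 2 ^ (x + u + y)) := by
        rw [← ENNReal.ofReal_mul (by positivity), Real.rpow_add (by norm_num),
          Real.rpow_add (by norm_num)]
        congr 1; ring
    _ ≤ _ := by
        refine ENNReal.ofReal_le_ofReal ?_
        rw [mul_assoc _ ((2 : ℝ) ^ c), ← Real.rpow_add (by norm_num)]
        gcongr
        norm_num

/-- For each choice of dyadic shells the potential may be replaced by a function which has the same
Fourier coefficients at all the frequencies that occur, and whose norm outweighs the variance. -/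
theorem exists_localized_kernel {V : Torus3 → ℝ} {β γ : ℝ} (hβ₀ : 0 < β) (hβ₃ : β < 3)
    (hV : IsInteraction β V) (hγ : max (1 - β) (1 / 2) < γ) :
    ∃ ε δ C : ℝ, 0 < ε ∧ 0 < δ ∧ 0 ≤ C ∧ ∀ k₁ k₂ j₁ j₂ : ℕ, ∃ (U : Torus3 → ℝ) (R : ℕ),
      Integrable U dx ∧
      (∀ n m a b : Freq, shell n = k₁ → shell m = k₂ → height a < 2 ^ (j₁ + 3) →
        height b < 2 ^ (j₂ + 3) → n + a + (m + b) = 0 →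
        coeff U (n + a) = coeff V (n + a) ∧ height (n + m) ≤ R) ∧
      (∫⁻ z, ‖U z‖ₑ ∂dx) *
          ENNReal.ofReal (2 ^ (ε * (k₁ + k₂)) * √(varianceBound k₁ k₂ R)) ≤
        ENNReal.ofReal (C * 2 ^ (γ * (j₁ + j₂) - δ * (k₁ + k₂ + (j₁ + j₂)))) := by
  obtain ⟨hγβ, hγ₂⟩ := max_lt_iff.1 hγ
  -- Both lower bounds on `γ` enter here: they make the interval for `ϑ` nonempty.
  obtain ⟨ϑ, hϑl, hϑu⟩ : ∃ ϑ, max 0 (1 - γ) < ϑ ∧ ϑ < min β (1 / 2) :=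
    exists_between (max_lt (lt_min hβ₀ (by norm_num)) (lt_min (by linarith) (by linarith)))
  obtain ⟨hϑ₀, hϑγ⟩ := max_lt_iff.1 hϑl
  obtain ⟨hϑβ, hϑ₂⟩ := lt_min_iff.1 hϑu
  -- The exponent `γ` is lowered to some `g ≤ 1`, so that the spare power satisfies `8δ ≤ ϑ` and all
  -- coefficients below stay nonnegative.
  obtain ⟨g, hg, hgγ, hg1⟩ : ∃ g, 1 - ϑ < g ∧ g ≤ γ ∧ g ≤ 1 :=
    ⟨min γ 1, lt_min (by linarith) (by linarith), min_le_left _ _, min_le_right _ _⟩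
  obtain ⟨δ, hδ, hδg⟩ : ∃ δ, 0 < δ ∧ 8 * δ = g - (1 - ϑ) :=
    ⟨(g - (1 - ϑ)) / 8, by linarith, by ring⟩
  obtain ⟨C₁, hC₁, hker⟩ := exists_shell_kernel hβ₀ hβ₃ hV hϑ₀ (by linarith) hϑβ
  have hVi := hV.integrable hβ₀ hβ₃
  set K := (∫⁻ z, ‖V z‖ₑ ∂dx).toReal with hKdef
  have hK : ∫⁻ z, ‖V z‖ₑ ∂dx = ENNReal.ofReal K := (ENNReal.ofReal_toReal hVi.2.ne).symm
  have hK0 : 0 ≤ K := ENNReal.toReal_nonneg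
  have hzero (E v : ℝ) : (∫⁻ z, ‖(0 : Torus3 → ℝ) z‖ₑ ∂dx) * ENNReal.ofReal v ≤
      ENNReal.ofReal E := by simp
  refine ⟨δ, δ, (C₁ + K) * 2 ^ 9 * 2 ^ (20 : ℝ), hδ, hδ, by positivity,
    fun k₁ k₂ j₁ j₂ => ?_⟩
  have hgj₁ : g * j₁ ≤ γ * j₁ := mul_le_mul_of_nonneg_right hgγ (Nat.cast_nonneg _)
  have hgj₂ : g * j₂ ≤ γ * j₂ := mul_le_mul_of_nonneg_right hgγ (Nat.cast_nonneg _)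
  have hsqrt (R : ℕ) : √(varianceBound k₁ k₂ R) ≤ 2 ^ 9 * 2 ^ (((k₁ : ℝ) + k₂) / 2) :=
    (sqrt_varianceBound_le k₁ k₂ R).trans (le_mul_of_one_le_left (by positivity) (by norm_num))
  have hfin {U : Torus3 → ℝ} {v x y : ℝ}
      (h1 : ∫⁻ z, ‖U z‖ₑ ∂dx ≤ ENNReal.ofReal ((C₁ + K) * 2 ^ x))
      (h2 : v ≤ 2 ^ 9 * 2 ^ y)
      (h3 : x + δ * (k₁ + k₂) + y ≤ 20 + (g * (j₁ + j₂) - δ * (k₁ + k₂ + (j₁ + j₂)))) :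
      (∫⁻ z, ‖U z‖ₑ ∂dx) * ENNReal.ofReal (2 ^ (δ * ((k₁ : ℝ) + k₂)) * v) ≤
        ENNReal.ofReal ((C₁ + K) * 2 ^ 9 * 2 ^ (20 : ℝ) *
          2 ^ (γ * (j₁ + j₂) - δ * (k₁ + k₂ + (j₁ + j₂)))) := by
    have := lintegral_mul_localization_le (E := γ * (j₁ + j₂) - δ * (k₁ + k₂ + (j₁ + j₂)))
      (c := 20) (u := δ * ((k₁ : ℝ) + k₂)) (by positivity) h1 h2 (by linarith)
    rwa [abs_of_nonneg (by positivity)] at this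
  have hkerK {U : Torus3 → ℝ} {x : ℝ} (h : ∫⁻ z, ‖U z‖ₑ ∂dx ≤ ENNReal.ofReal (C₁ * 2 ^ x)) :
      ∫⁻ z, ‖U z‖ₑ ∂dx ≤ ENNReal.ofReal ((C₁ + K) * 2 ^ x) :=
    h.trans (ENNReal.ofReal_le_ofReal (by gcongr; linarith))
  -- A field frequency at least six shells above its partner determines the size of the sum.
  have hbox {n a : Freq} {k j : ℕ} (hn : shell n = k) (ha : height a < 2 ^ (j + 3)) :
      (j + 6 ≤ k → 3 * 2 ^ k ≤ 8 * height (n + a)) ∧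
        height (n + a) < 2 ^ k + 2 ^ (j + 3) := by
    have h1 := height_add_le n a
    have h2 := height_lt_of_shell_eq hn
    refine ⟨fun hk => ?_, by omega⟩
    have h3 := two_pow_le_height hn (by omega)
    have h4 := height_add_le (n + a) (-a)
    rw [height_neg, add_neg_cancel_right] at h4
    have h5 : 2 ^ (j + 3) * 8 ≤ 2 ^ k := by
      rw [show (8 : ℕ) = 2 ^ 3 by norm_num, ← pow_add]
      exact Nat.pow_le_pow_right (by norm_num) (by omega)
    omega
  have hsum {n m a b : Freq} (h : n + a + (m + b) = 0) :
      height (n + a) = height (m + b) ∧ height (n + m) = height (a + b) := by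
    constructor
    · rw [eq_neg_of_add_eq_zero_left h, height_neg]
    · rw [show n + m = -(a + b) from eq_neg_of_add_eq_zero_left (by rw [← h]; abel), height_neg]
  have hR {n m : Freq} (hn : shell n = k₁) (hm : shell m = k₂) :
      height (n + m) ≤ 2 ^ k₁ + 2 ^ k₂ := by
    have h1 := height_add_le n m
    have h2 := height_lt_of_shell_eq hn
    have h3 := height_lt_of_shell_eq hm
    omega
  have hlow {k j l : ℕ} (hk : k < j + 6) (hl : 3 * 2 ^ l < 8 * (2 ^ k + 2 ^ (j + 3))) :
      l < j + 9 := by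
    by_contra! hc
    have h1 : 2 ^ k ≤ 2 ^ (j + 5) := Nat.pow_le_pow_right (by norm_num) (by omega)
    have h2 : 2 ^ (j + 9) ≤ 2 ^ l := Nat.pow_le_pow_right (by norm_num) hc
    rw [pow_add] at h1 h2 hl
    omega
  by_cases h₁ : k₁ < j₁ + 6 <;> by_cases h₂ : k₂ < j₂ + 6
  -- No field frequency dominates: `V` is kept, and the loss `2^{(k₁+k₂)/2}` is absorbed by `g >
  -- 1/2`.
  · refine ⟨V, 2 ^ k₁ + 2 ^ k₂, hVi, fun n m a b hn hm _ _ _ => ⟨rfl, hR hn hm⟩,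
      hfin (x := 0) ?_ (hsqrt _) ?_⟩
    · rw [hK, Real.rpow_zero]
      exact ENNReal.ofReal_le_ofReal (by linarith)
    · have h₁' : (k₁ : ℝ) ≤ j₁ + 5 := by exact_mod_cast Nat.lt_succ_iff.1 h₁
      have h₂' : (k₂ : ℝ) ≤ j₂ + 5 := by exact_mod_cast Nat.lt_succ_iff.1 h₂
      have e1 := mul_le_mul_of_nonneg_left h₁' (show 0 ≤ 1 / 2 + 2 * δ by positivity)
      have e2 := mul_le_mul_of_nonneg_left h₂' (show 0 ≤ 1 / 2 + 2 * δ by positivity)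
      have e3 : (1 / 2 + 3 * δ) * (j₁ : ℝ) ≤ g * j₁ :=
        mul_le_mul_of_nonneg_right (by linarith) (Nat.cast_nonneg _)
      have e4 : (1 / 2 + 3 * δ) * (j₂ : ℝ) ≤ g * j₂ :=
        mul_le_mul_of_nonneg_right (by linarith) (Nat.cast_nonneg _)
      linarith
  · push Not at h₂
    -- Only the second field frequency dominates. Since `n + a = -(m + b)` has size `2^{k₂}`, the
    -- first function frequency must be at least comparable. The gain `2^{-ϑk₂}` leaves the loss
    -- `2^{(1-ϑ)j₁}`.
    by_cases h₃ : k₂ < j₁ + 9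
    · obtain ⟨U, hU, hU1, hU2⟩ := hker k₂ (by omega)
      refine ⟨U, 2 ^ k₁ + 2 ^ k₂, hU, fun n m a b hn hm ha hb h => ⟨hU2 _ ?_, hR hn hm⟩,
        hfin (hkerK hU1) (hsqrt _) ?_⟩
      · rw [(hsum h).1]
        exact (hbox hm hb).1 h₂
      · have h₁' : (k₁ : ℝ) ≤ j₁ + 5 := by exact_mod_cast Nat.lt_succ_iff.1 h₁
        have h₃' : (k₂ : ℝ) ≤ j₁ + 8 := by exact_mod_cast Nat.lt_succ_iff.1 h₃
        have e1 := mul_le_mul_of_nonneg_left h₁' (show 0 ≤ 1 / 2 + 2 * δ by positivity)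
        have e2 := mul_le_mul_of_nonneg_left h₃' (show 0 ≤ 1 / 2 - ϑ + 2 * δ by linarith)
        have e3 : (1 - ϑ + 5 * δ) * (j₁ : ℝ) ≤ g * j₁ :=
          mul_le_mul_of_nonneg_right (by linarith) (Nat.cast_nonneg _)
        have e4 : δ * (j₂ : ℝ) ≤ g * j₂ :=
          mul_le_mul_of_nonneg_right (by linarith) (Nat.cast_nonneg _)
        linarith
    -- No resonant quadruple exists, so the zero kernel will do.
    · refine ⟨0, 0, integrable_zero _ _ _, fun n m a b hn hm ha hb h => ?_, hzero _ _⟩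
      refine absurd (hlow h₁ ?_) h₃
      refine ((hbox hm hb).1 h₂).trans_lt ?_
      rw [← (hsum h).1]
      have := (hbox hn ha).2
      omega
  · push Not at h₁
    -- The mirror case, with the roles of the two pairs exchanged.
    by_cases h₃ : k₁ < j₂ + 9
    · obtain ⟨U, hU, hU1, hU2⟩ := hker k₁ (by omega)
      refine ⟨U, 2 ^ k₁ + 2 ^ k₂, hU, fun n m a b hn hm ha hb h => ⟨hU2 _ ?_, hR hn hm⟩,
        hfin (hkerK hU1) (hsqrt _) ?_⟩
      · exact (hbox hn ha).1 h₁
      · have h₂' : (k₂ : ℝ) ≤ j₂ + 5 := by exact_mod_cast Nat.lt_succ_iff.1 h₂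
        have h₃' : (k₁ : ℝ) ≤ j₂ + 8 := by exact_mod_cast Nat.lt_succ_iff.1 h₃
        have e1 := mul_le_mul_of_nonneg_left h₂' (show 0 ≤ 1 / 2 + 2 * δ by positivity)
        have e2 := mul_le_mul_of_nonneg_left h₃' (show 0 ≤ 1 / 2 - ϑ + 2 * δ by linarith)
        have e3 : (1 - ϑ + 5 * δ) * (j₂ : ℝ) ≤ g * j₂ :=
          mul_le_mul_of_nonneg_right (by linarith) (Nat.cast_nonneg _)
        have e4 : δ * (j₁ : ℝ) ≤ g * j₁ :=
          mul_le_mul_of_nonneg_right (by linarith) (Nat.cast_nonneg _)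
        linarith
    · refine ⟨0, 0, integrable_zero _ _ _, fun n m a b hn hm ha hb h => ?_, hzero _ _⟩
      refine absurd (hlow h₂ ?_) h₃
      refine ((hbox hn ha).1 h₁).trans_lt ?_
      rw [(hsum h).1]
      have := (hbox hm hb).2
      omega
  · push Not at h₁ h₂
    -- Both field frequencies dominate, so their shells are adjacent and `n + m = -(a + b)` has
    -- height below `2^{J+4}`, `J = max j₁ j₂`. Up to constants the exponent is `3J/2 - k₁/2 - ϑk₁`,
    -- at most `(1 - ϑ)J` since `J ≤ k₁`.
    by_cases h₃ : k₁ ≤ k₂ + 1 ∧ k₂ ≤ k₁ + 1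
    · obtain ⟨U, hU, hU1, hU2⟩ := hker k₁ (by omega)
      refine ⟨U, 2 ^ (max j₁ j₂ + 4), hU, fun n m a b hn hm ha hb h => ⟨hU2 _ ?_, ?_⟩,
        hfin (hkerK hU1) (sqrt_varianceBound_two_pow_le _ _ _) ?_⟩
      · exact (hbox hn ha).1 h₁
      · rw [(hsum h).2]
        have h4 := height_add_le a b
        have h5 : 2 ^ (j₁ + 3) ≤ 2 ^ (max j₁ j₂ + 3) :=
          Nat.pow_le_pow_right (by norm_num) (by omega)
        have h6 : 2 ^ (j₂ + 3) ≤ 2 ^ (max j₁ j₂ + 3) :=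
          Nat.pow_le_pow_right (by norm_num) (by omega)
        rw [pow_succ _ (_ + 3)]
        omega
      · have e0 : (k₁ : ℝ) ≤ k₂ + 1 := by exact_mod_cast h₃.1
        have e0' : (k₂ : ℝ) ≤ k₁ + 1 := by exact_mod_cast h₃.2
        have hJ : ((max j₁ j₂ : ℕ) : ℝ) ≤ k₁ := by
          exact_mod_cast (show max j₁ j₂ ≤ k₁ by omega)
        have hJj : ((max j₁ j₂ : ℕ) : ℝ) ≤ j₁ + j₂ := by
          exact_mod_cast (show max j₁ j₂ ≤ j₁ + j₂ by omega)
        have e1 := mul_le_mul_of_nonneg_left hJ (show 0 ≤ ϑ + 1 / 2 - 4 * δ by linarith)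
        have e2 := mul_le_mul_of_nonneg_left e0' (show 0 ≤ 2 * δ by positivity)
        have e3 := mul_le_mul_of_nonneg_left hJj (show 0 ≤ 1 - ϑ + 4 * δ by linarith)
        have e4 : (1 - ϑ + 5 * δ) * ((j₁ : ℝ) + j₂) ≤ g * (j₁ + j₂) :=
          mul_le_mul_of_nonneg_right (by linarith) (by positivity)
        linarith
    · refine ⟨0, 0, integrable_zero _ _ _, fun n m a b hn hm ha hb h => ?_, hzero _ _⟩
      exfalso
      apply h₃
      have h4 := hbox hn ha
      have h5 := hbox hm hb
      have h6 := (hsum h).1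
      have h7 : 2 ^ (j₁ + 3) * 8 ≤ 2 ^ k₁ := by
        rw [show (8 : ℕ) = 2 ^ 3 by norm_num, ← pow_add]
        exact Nat.pow_le_pow_right (by norm_num) (by omega)
      have h8 : 2 ^ (j₂ + 3) * 8 ≤ 2 ^ k₂ := by
        rw [show (8 : ℕ) = 2 ^ 3 by norm_num, ← pow_add]
        exact Nat.pow_le_pow_right (by norm_num) (by omega)
      have h9 := h4.1 h₁
      have h10 := h5.1 h₂
      constructor
      · by_contra! hc
        have : 2 ^ (k₂ + 2) ≤ 2 ^ k₁ := Nat.pow_le_pow_right (by norm_num) (by omega)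
        rw [pow_add] at this
        omega
      · by_contra! hc
        have : 2 ^ (k₁ + 2) ≤ 2 ^ k₂ := Nat.pow_le_pow_right (by norm_num) (by omega)
        rw [pow_add] at this
        omega

end Localization

/-! ### Summation of the localised moment bounds -/

section Summation

lemma tsum_geometric_four_ne_top {x : ℝ≥0∞} (hx : x < 1) :
    ∑' q : ℕ × ℕ × ℕ × ℕ, x ^ q.1 * (x ^ q.2.1 * (x ^ q.2.2.1 * x ^ q.2.2.2)) ≠ ∞ := by
  have h : ∑' k : ℕ, x ^ k ≠ ∞ := by
    rw [ENNReal.tsum_geometric]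
    exact ENNReal.inv_ne_top.2 (tsub_pos_of_lt hx).ne'
  simp_rw [ENNReal.tsum_prod', ENNReal.tsum_mul_left, ENNReal.tsum_mul_right]
  exact ENNReal.mul_ne_top h (ENNReal.mul_ne_top h (ENNReal.mul_ne_top h h))

variable {Ω : Type*} [MeasurableSpace Ω] {P : Measure Ω} {a : Freq → Ω → ℂ} {F : Finset Freq}
  {s : Freq → ℝ}

lemma aemeasurable_lintegral_supBound [IsProbabilityMeasure P]
    (ha : ∀ n ∈ F, AEMeasurable (a n) P) (D : Freq → Freq → Prop) [∀ n k, Decidable (D n k)]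
    (L m : ℕ) {U : Torus3 → ℝ} (hU : Integrable U dx) :
    AEMeasurable (fun ω => ∫⁻ z, ‖U z‖ₑ * supBound F (wickProd P a D ω) L m z ∂dx) P := by
  have h1 := AEMeasurable.comp_quasiMeasurePreserving
    (aemeasurable_enorm_modeSum_pow (ν := dx.prod dx) ha D
      (f := Prod.fst) (g := Prod.snd) measurable_fst measurable_snd (2 * m))
    (measurePreserving_prodAssoc P dx dx).quasiMeasurePreserving
  have h2 := h1.lintegral_prod_right'
  have h3 : AEMeasurable (fun p : Ω × Torus3 =>
      ‖U p.2‖ₑ * supBound F (wickProd P a D p.1) L m p.2) (P.prod dx) := by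
    refine AEMeasurable.mul hU.aestronglyMeasurable.enorm.comp_snd ?_
    exact (h2.const_mul _).pow_const _
  exact h3.lintegral_prod_right'

/-- The Nikolskii factor as a `2m`-th power. Powers of the shell sizes are absorbed by
`2^{ε(k₁+k₂)}` once `2mε ≥ 3`. The dependence on `m` is harmless: `125 m³ ≤ 125 · 8^m ≤ 1000^m ≤
32^{2m}`. -/
lemma boxCount_le {ε : ℝ} {m : ℕ} (hm : 1 ≤ m) (hmε : 3 ≤ 2 * m * ε) (k₁ k₂ : ℕ) :
    (((2 * (m * (2 ^ k₁ + 2 ^ k₂)) + 1) ^ 3 : ℕ) : ℝ≥0∞)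
      ≤ ENNReal.ofReal (32 * 2 ^ (ε * (k₁ + k₂))) ^ (2 * m) := by
  rw [← ENNReal.ofReal_pow (by positivity), ← ENNReal.ofReal_natCast]
  refine ENNReal.ofReal_le_ofReal ?_
  have h1 : (1 : ℝ) ≤ 2 ^ k₁ := one_le_pow₀ (by norm_num)
  have h2 : (1 : ℝ) ≤ 2 ^ k₂ := one_le_pow₀ (by norm_num)
  have hm' : (1 : ℝ) ≤ m := by exact_mod_cast hm
  have h3 : (2 : ℝ) ^ k₁ + 2 ^ k₂ ≤ 2 * 2 ^ (k₁ + k₂) := by rw [pow_add]; nlinarith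
  have h4 : (1 : ℝ) ≤ 2 ^ (k₁ + k₂) := one_le_pow₀ (by norm_num)
  have h5 : ((2 * (m * (2 ^ k₁ + 2 ^ k₂)) + 1 : ℝ)) ≤ 5 * m * 2 ^ (k₁ + k₂) := by nlinarith
  have h6 : (m : ℝ) ≤ 2 ^ m := by exact_mod_cast Nat.lt_two_pow_self.le
  have h7 : (2 : ℝ) ^ (3 * ((k₁ : ℝ) + k₂)) ≤ (2 ^ (ε * (k₁ + k₂))) ^ (2 * m) := by
    rw [← Real.rpow_mul_natCast (by norm_num)]
    refine Real.rpow_le_rpow_of_exponent_le (by norm_num) ?_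
    push_cast
    have : 0 ≤ (k₁ : ℝ) + k₂ := by positivity
    nlinarith [mul_le_mul_of_nonneg_right hmε this]
  have h8 : (125 : ℝ) * 8 ^ m ≤ 32 ^ (2 * m) := by
    rw [pow_mul]
    have h9 : (125 : ℝ) ≤ 125 ^ m := by
      calc (125 : ℝ) = 125 ^ 1 := by norm_num
        _ ≤ 125 ^ m := pow_le_pow_right₀ (by norm_num) hm
    calc (125 : ℝ) * 8 ^ m ≤ 125 ^ m * 8 ^ m := by gcongr
      _ = 1000 ^ m := by rw [← mul_pow]; norm_num
      _ ≤ _ := by gcongr; norm_num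
  calc (((2 * (m * (2 ^ k₁ + 2 ^ k₂)) + 1) ^ 3 : ℕ) : ℝ)
      = (2 * (m * (2 ^ k₁ + 2 ^ k₂)) + 1 : ℝ) ^ 3 := by push_cast; ring
    _ ≤ (5 * m * 2 ^ (k₁ + k₂)) ^ 3 := by gcongr
    _ = 125 * (m : ℝ) ^ 3 * (2 ^ (k₁ + k₂)) ^ 3 := by ring
    _ ≤ 125 * (2 ^ m) ^ 3 * (2 ^ (k₁ + k₂)) ^ 3 := by gcongr
    _ = 125 * 8 ^ m * 2 ^ (3 * ((k₁ : ℝ) + k₂)) := by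
        have e1 : ((2 : ℝ) ^ m) ^ 3 = 8 ^ m := by rw [← pow_mul, mul_comm m, pow_mul]; norm_num
        have e2 : ((2 : ℝ) ^ (k₁ + k₂)) ^ 3 = 2 ^ (3 * ((k₁ : ℝ) + k₂)) := by
          rw [← pow_mul, ← Real.rpow_natCast]
          congr 1; push_cast; ring
        rw [e1, e2]
    _ ≤ 32 ^ (2 * m) * (2 ^ (ε * (k₁ + k₂))) ^ (2 * m) := by gcongr
    _ = _ := by rw [mul_pow]

/-- The random bound for the part of the bilinear form that is localised to the shells `k₁`, `k₂`
of the two fields and `j₁`, `j₂` of the two functions, `q = (k₁, k₂, j₁, j₂)`. -/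
def localizedBound (P : Measure Ω) (a : Freq → Ω → ℂ) (F : Finset Freq) (γ : ℝ)
    (U : ℕ × ℕ × ℕ × ℕ → Torus3 → ℝ) (R : ℕ × ℕ × ℕ × ℕ → ℕ) (m : ℕ) (ω : Ω)
    (q : ℕ × ℕ × ℕ × ℕ) : ℝ≥0∞ :=
  ENNReal.ofReal (2 ^ (-γ * (q.2.2.1 + q.2.2.2))) * ∫⁻ z, ‖U q z‖ₑ *
    supBound F (wickProd P a (shellPair q.1 q.2.1 (R q)) ω) (2 ^ q.1 + 2 ^ q.2.1) m z ∂dx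

lemma lintegral_localizedBound_pow_le [IsProbabilityMeasure P] {γ ε C E : ℝ}
    {U : ℕ × ℕ × ℕ × ℕ → Torus3 → ℝ} {R : ℕ × ℕ × ℕ × ℕ → ℕ} {q : ℕ × ℕ × ℕ × ℕ}
    (hlaw : HasGaussianLaw (fun ω => fun n : F => a n ω) P)
    (h0 : ∀ n ∈ F, ∫ ω, a n ω ∂P = 0) (hs : ∀ n, 0 ≤ s n)
    (hs' : ∀ n, s n ≤ 1 / (1 + (height n : ℝ) ^ 2))
    (hcov : ∀ n ∈ F, ∀ k ∈ F, ∫ ω, a n ω * conj (a k ω) ∂P = if n = k then (s n : ℂ) else 0)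
    {m : ℕ} (hm : 1 ≤ m) (hmε : 3 ≤ 2 * m * ε) (hU : Integrable (U q) dx)
    (hq : (∫⁻ z, ‖U q z‖ₑ ∂dx) *
        ENNReal.ofReal (2 ^ (ε * (q.1 + q.2.1)) * √(varianceBound q.1 q.2.1 (R q))) ≤
      ENNReal.ofReal (C * 2 ^ (γ * (q.2.2.1 + q.2.2.2) - E))) :
    ∫⁻ ω, localizedBound P a F γ U R m ω q ^ (2 * m) ∂P ≤
      ENNReal.ofReal (196608 * C * m * 2 ^ (-E)) ^ (2 * m) := by
  obtain ⟨k₁, k₂, j₁, j₂⟩ := q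
  simp only [localizedBound, mul_pow] at hq ⊢
  set K := ∫⁻ z, ‖U (k₁, k₂, j₁, j₂) z‖ₑ ∂dx with hK
  set v := varianceBound k₁ k₂ (R (k₁, k₂, j₁, j₂)) with hv
  have hv0 : 0 ≤ v := varianceBound_nonneg _ _ _
  have hvar : ENNReal.ofReal ((192 * m) ^ 2 * ∑ n ∈ F, ∑ k ∈ F,
      if shellPair k₁ k₂ (R (k₁, k₂, j₁, j₂)) n k then s n * s k else 0) ^ m ≤
      ENNReal.ofReal (192 * m * (32 * √v)) ^ (2 * m) := by
    rw [pow_mul]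
    gcongr
    rw [← ENNReal.ofReal_pow (by positivity), mul_pow (192 * (m : ℝ)), mul_pow 32,
      Real.sq_sqrt hv0]
    refine ENNReal.ofReal_le_ofReal ?_
    gcongr
    refine (sum_shellPair_le hs hs' F _ _ _).trans (le_of_eq ?_)
    rw [hv]; norm_num
  rw [lintegral_const_mul' _ _ (by finiteness)]
  calc _ ≤ ENNReal.ofReal (2 ^ (-γ * (j₁ + j₂))) ^ (2 * m) * (K ^ (2 * m) *
        (ENNReal.ofReal (32 * 2 ^ (ε * (k₁ + k₂))) ^ (2 * m) *
          ENNReal.ofReal (192 * m * (32 * √v)) ^ (2 * m))) := by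
        gcongr
        refine (lintegral_lintegral_supBound_pow_le hlaw h0 hs hcov _ hm hU).trans ?_
        gcongr
        exact boxCount_le hm hmε k₁ k₂
    -- The constant is `32 · 192 · 32`: Nikolskii, the chaos constant, and the root of `1024` from
    -- the variance count.
    _ = (ENNReal.ofReal (196608 * m * 2 ^ (-γ * (j₁ + j₂))) *
          (K * ENNReal.ofReal (2 ^ (ε * (k₁ + k₂)) * √v))) ^ (2 * m) := by
        simp_rw [← mul_pow]
        congr 1
        rw [← ENNReal.ofReal_mul (by positivity), mul_left_comm,
          ← ENNReal.ofReal_mul (by positivity),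
          mul_left_comm (ENNReal.ofReal _) K, ← ENNReal.ofReal_mul (by positivity)]
        congr 2
        ring
    _ ≤ (ENNReal.ofReal (196608 * m * 2 ^ (-γ * (j₁ + j₂))) *
          ENNReal.ofReal (C * 2 ^ (γ * (j₁ + j₂) - E))) ^ (2 * m) := by
        gcongr
    _ = _ := by
        rw [← ENNReal.ofReal_mul (by positivity)]
        congr 2
        have : (2 : ℝ) ^ (-E) = 2 ^ (-γ * ((j₁ : ℝ) + j₂)) * 2 ^ (γ * ((j₁ : ℝ) + j₂) - E) := by
          rw [← Real.rpow_add (by norm_num)]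
          congr 1; ring
        rw [this]; ring

/-- The localised bounds are summable, with moments of linear growth. -/
theorem exists_lintegral_tsum_localizedBound_le {V : Torus3 → ℝ} {β γ : ℝ} (hβ₀ : 0 < β)
    (hβ₃ : β < 3) (hV : IsInteraction β V) (hγ : max (1 - β) (1 / 2) < γ) :
    ∃ (U : ℕ × ℕ × ℕ × ℕ → Torus3 → ℝ) (R : ℕ × ℕ × ℕ × ℕ → ℕ) (C : ℝ) (m₀ : ℕ), 0 ≤ C ∧ 1 ≤ m₀ ∧
      (∀ q, Integrable (U q) dx) ∧
      (∀ k₁ k₂ j₁ j₂, ∀ n m a b : Freq, shell n = k₁ → shell m = k₂ →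
        height a < 2 ^ (j₁ + 3) → height b < 2 ^ (j₂ + 3) → n + a + (m + b) = 0 →
        coeff (U (k₁, k₂, j₁, j₂)) (n + a) = coeff V (n + a) ∧
          height (n + m) ≤ R (k₁, k₂, j₁, j₂)) ∧
      ∀ (Ω : Type*) [MeasurableSpace Ω] (P : Measure Ω) [IsProbabilityMeasure P]
        (a : Freq → Ω → ℂ) (F : Finset Freq) (s : Freq → ℝ),
        HasGaussianLaw (fun ω => fun n : F => a n ω) P →
        (∀ n ∈ F, ∫ ω, a n ω ∂P = 0) → (∀ n, 0 ≤ s n) →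
        (∀ n, s n ≤ 1 / (1 + (height n : ℝ) ^ 2)) →
        (∀ n ∈ F, ∀ k ∈ F, ∫ ω, a n ω * conj (a k ω) ∂P = if n = k then (s n : ℂ) else 0) →
        ∀ m, m₀ ≤ m → ∫⁻ ω, (∑' q, localizedBound P a F γ U R m ω q) ^ (2 * m) ∂P ≤
          ENNReal.ofReal (C * m) ^ (2 * m) := by
  obtain ⟨ε, δ, C, hε, hδ, hC, h⟩ := exists_localized_kernel hβ₀ hβ₃ hV hγ
  -- The kernels and radii are fixed before the probability space, so all constants are independent
  -- of it.
  choose U R hU hUR hq using fun q : ℕ × ℕ × ℕ × ℕ => h q.1 q.2.1 q.2.2.1 q.2.2.2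
  set x : ℝ≥0∞ := ENNReal.ofReal (2 ^ (-δ)) with hx
  have hx1 : x < 1 := by
    rw [hx, ENNReal.ofReal_lt_one]
    exact Real.rpow_lt_one_of_one_lt_of_neg (by norm_num) (by linarith)
  set S : ℝ := (∑' q : ℕ × ℕ × ℕ × ℕ, x ^ q.1 * (x ^ q.2.1 * (x ^ q.2.2.1 * x ^ q.2.2.2))).toReal
    with hS
  have hS0 : 0 ≤ S := ENNReal.toReal_nonneg
  -- The threshold for `m` is the one that makes `2mε ≥ 3`; `S` is the sum of the geometric series
  -- in the four indices.
  refine ⟨U, R, 196608 * C * S, ⌈3 / (2 * ε)⌉₊ + 1, by positivity, by omega, hU,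
    fun k₁ k₂ j₁ j₂ => hUR (k₁, k₂, j₁, j₂), fun Ω _ P _ a F s hlaw h0 hs hs' hcov m hm => ?_⟩
  have hmε : 3 ≤ 2 * m * ε := by
    have h1 : 3 / (2 * ε) ≤ m := (Nat.le_ceil _).trans (by exact_mod_cast (by omega))
    rw [div_le_iff₀ (by positivity)] at h1
    linarith
  have ha (n : Freq) (hn : n ∈ F) : AEMeasurable (a n) P :=
    (measurable_pi_apply (⟨n, hn⟩ : F)).comp_aemeasurable hlaw.aemeasurable
  refine (lintegral_tsum_pow_le (fun q => ?_) (m := 2 * m) (by omega)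
    (fun q => lintegral_localizedBound_pow_le hlaw h0 hs hs' hcov (by omega) hmε (hU q)
      (hq q))).trans (le_of_eq ?_)
  · exact (aemeasurable_lintegral_supBound ha _ _ _ (hU q)).const_mul _
  · congr 1
    have hterm (q : ℕ × ℕ × ℕ × ℕ) : ENNReal.ofReal (196608 * C * m *
        2 ^ (-(δ * (q.1 + q.2.1 + (q.2.2.1 + q.2.2.2) : ℝ)))) =
        ENNReal.ofReal (196608 * C * m) *
          (x ^ q.1 * (x ^ q.2.1 * (x ^ q.2.2.1 * x ^ q.2.2.2))) := by
      rw [ENNReal.ofReal_mul (by positivity), ← pow_add, ← pow_add, ← pow_add, hx,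
        ← ENNReal.ofReal_pow (by positivity), ← Real.rpow_mul_natCast (by norm_num)]
      congr 3
      push_cast; ring
    simp_rw [hterm]
    rw [ENNReal.tsum_mul_left, ← ENNReal.ofReal_toReal (tsum_geometric_four_ne_top hx1), ← hS,
      ← ENNReal.ofReal_mul (by positivity)]
    congr 1; ring

end Summation

/-! ### Dyadic decomposition of the form -/

section Decomposition

lemma resonant_sum_sum (A : Finset Freq) (v : Freq → ℂ) (c₁ c₂ : ℕ → Freq → ℂ) (s t : Finset ℕ)
    (n m : Freq) :
    resonant A v (fun b => ∑ i ∈ s, c₁ i b) (fun b => ∑ j ∈ t, c₂ j b) n m =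
      ∑ i ∈ s, ∑ j ∈ t, resonant A v (c₁ i) (c₂ j) n m := by
  simp only [resonant]
  have h (a b : Freq) : (if n + a + (m + b) = 0 then
      (∑ i ∈ s, c₁ i a) * (∑ j ∈ t, c₂ j b) * v (n + a) else 0) =
      ∑ i ∈ s, ∑ j ∈ t, if n + a + (m + b) = 0 then c₁ i a * c₂ j b * v (n + a) else 0 := by
    split_ifs
    · rw [Finset.sum_mul_sum, Finset.sum_mul]
      simp_rw [Finset.sum_mul]
    · simp
  simp_rw [h]
  simp_rw [Finset.sum_comm (s := A) (t := s), Finset.sum_comm (s := A) (t := t)]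

variable {Ω : Type*} [MeasurableSpace Ω] {P : Measure Ω} {a : Freq → Ω → ℂ} {F : Finset Freq}

/-- On the resonant set the coefficients of `V` agree with those of `U`, and the restriction on `n +
k` holds automatically. It can thus be inserted into the random kernel before taking the supremum,
and it is this smaller kernel whose variance is counted. -/
lemma enorm_localized_le {V : Torus3 → ℝ} {γ : ℝ} {U : ℕ × ℕ × ℕ × ℕ → Torus3 → ℝ}
    {R : ℕ × ℕ × ℕ × ℕ → ℕ} {k₁ k₂ j₁ j₂ : ℕ} (hU : Integrable (U (k₁, k₂, j₁, j₂)) dx)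
    (hUR : ∀ n m a b : Freq, shell n = k₁ → shell m = k₂ →
        height a < 2 ^ (j₁ + 3) → height b < 2 ^ (j₂ + 3) → n + a + (m + b) = 0 →
        coeff (U (k₁, k₂, j₁, j₂)) (n + a) = coeff V (n + a) ∧
          height (n + m) ≤ R (k₁, k₂, j₁, j₂))
    {r r' : ℝ≥0∞} (hrr' : r⁻¹ + r'⁻¹ = 1) {A : Finset Freq} {c₁ c₂ : Freq → ℂ}
    (h₁ : ∀ n, c₁ n ≠ 0 → height n < 2 ^ (j₁ + 3)) (h₂ : ∀ n, c₂ n ≠ 0 → height n < 2 ^ (j₂ + 3))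
    (hn₁ : eLpNorm (trigPoly A c₁) r dx ≤ ENNReal.ofReal (2 ^ (-γ * j₁)))
    (hn₂ : eLpNorm (trigPoly A c₂) r' dx ≤ ENNReal.ofReal (2 ^ (-γ * j₂)))
    {m : ℕ} (hm : 1 ≤ m) (ω : Ω) :
    ‖∑ n ∈ F, ∑ k ∈ F, (if shell n = k₁ ∧ shell k = k₂ then
      a n ω * a k ω - ∫ ω', a n ω' * a k ω' ∂P else 0) * resonant A (coeff V) c₁ c₂ n k‖ₑ ≤
      localizedBound P a F γ U R m ω (k₁, k₂, j₁, j₂) := by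
  rw [sum_mul_resonant_congr (R := R (k₁, k₂, j₁, j₂)) (u := coeff (U (k₁, k₂, j₁, j₂)))]
  · have hg (n k : Freq) : (if height (n + k) ≤ R (k₁, k₂, j₁, j₂) then
        if shell n = k₁ ∧ shell k = k₂ then a n ω * a k ω - ∫ ω', a n ω' * a k ω' ∂P else 0
        else 0) = wickProd P a (shellPair k₁ k₂ (R (k₁, k₂, j₁, j₂))) ω n k := by
      rw [wickProd, ← ite_and]
      congr 1
      rw [shellPair, eq_iff_iff]
      tauto
    simp_rw [hg]
    refine (enorm_sum_mul_resonant_le hU F A _ c₁ c₂ hrr' (supBound F (wickProd P a (shellPair k₁ k₂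
      (R (k₁, k₂, j₁, j₂))) ω) (2 ^ k₁ + 2 ^ k₂) m) fun z x =>
        enorm_modeSum_le_supBound hm (fun n _ k _ hnk => ?_) z x).trans ?_
    · have hp : shellPair k₁ k₂ (R (k₁, k₂, j₁, j₂)) n k := by
        by_contra hp
        exact hnk (if_neg hp)
      have h1 := height_lt_of_shell_eq hp.1
      have h2 := height_lt_of_shell_eq hp.2.1
      have h3 := height_add_le n k
      omega
    · rw [localizedBound, mul_comm]
      dsimp only
      gcongr
      refine (mul_le_mul' hn₁ hn₂).trans (le_of_eq ?_)
      rw [← ENNReal.ofReal_mul (by positivity), ← Real.rpow_add (by norm_num), mul_add]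
  · intro n k b d hg hb hd h0
    have hs : shell n = k₁ ∧ shell k = k₂ := by
      by_contra hs
      exact hg (if_neg hs)
    exact hUR n k b d hs.1 hs.2 (h₁ b hb) (h₂ d hd) h0

/-- The renormalised form on sums of frequency localised trigonometric polynomials is bounded by
the sum of the localised bounds. -/
theorem enorm_sum_mul_resonant_le_tsum {V : Torus3 → ℝ} {γ : ℝ} {U : ℕ × ℕ × ℕ × ℕ → Torus3 → ℝ}
    {R : ℕ × ℕ × ℕ × ℕ → ℕ} (hU : ∀ q, Integrable (U q) dx)
    (hUR : ∀ k₁ k₂ j₁ j₂, ∀ n m a b : Freq, shell n = k₁ → shell m = k₂ →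
        height a < 2 ^ (j₁ + 3) → height b < 2 ^ (j₂ + 3) → n + a + (m + b) = 0 →
        coeff (U (k₁, k₂, j₁, j₂)) (n + a) = coeff V (n + a) ∧
          height (n + m) ≤ R (k₁, k₂, j₁, j₂))
    {r r' : ℝ≥0∞} (hrr' : r⁻¹ + r'⁻¹ = 1) {A : Finset Freq} {c₁ c₂ : ℕ → Freq → ℂ}
    (h₁ : ∀ j n, c₁ j n ≠ 0 → height n < 2 ^ (j + 3))
    (h₂ : ∀ j n, c₂ j n ≠ 0 → height n < 2 ^ (j + 3)) {J : ℕ}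
    (hn₁ : ∀ j < J, eLpNorm (trigPoly A (c₁ j)) r dx ≤ ENNReal.ofReal (2 ^ (-γ * j)))
    (hn₂ : ∀ j < J, eLpNorm (trigPoly A (c₂ j)) r' dx ≤ ENNReal.ofReal (2 ^ (-γ * j)))
    {m : ℕ} (hm : 1 ≤ m) (ω : Ω) :
    ‖∑ n ∈ F, ∑ k ∈ F, (a n ω * a k ω - ∫ ω', a n ω' * a k ω' ∂P) * resonant A (coeff V)
      (fun b => ∑ j ∈ Finset.range J, c₁ j b) (fun b => ∑ j ∈ Finset.range J, c₂ j b) n k‖ₑ ≤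
      ∑' q, localizedBound P a F γ U R m ω q := by
  -- Only finitely many shells meet `F`, so the decomposition is a finite sum.
  set K := F.sup shell + 1 with hK
  set Q := Finset.range K ×ˢ Finset.range K ×ˢ Finset.range J ×ˢ Finset.range J with hQ
  have hshell {n : Freq} (hn : n ∈ F) : shell n ∈ Finset.range K :=
    Finset.mem_range.2 (Nat.lt_succ_of_le (Finset.le_sup hn))
  have hdec : ∑ n ∈ F, ∑ k ∈ F, (a n ω * a k ω - ∫ ω', a n ω' * a k ω' ∂P) *
      resonant A (coeff V) (fun b => ∑ j ∈ Finset.range J, c₁ j b)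
        (fun b => ∑ j ∈ Finset.range J, c₂ j b) n k =
      ∑ q ∈ Q, ∑ n ∈ F, ∑ k ∈ F, (if shell n = q.1 ∧ shell k = q.2.1 then
        a n ω * a k ω - ∫ ω', a n ω' * a k ω' ∂P else 0) *
          resonant A (coeff V) (c₁ q.2.2.1) (c₂ q.2.2.2) n k := by
    rw [Finset.sum_comm (s := Q)]
    refine Finset.sum_congr rfl fun n hn => ?_
    rw [Finset.sum_comm (s := Q)]
    refine Finset.sum_congr rfl fun k hk => ?_
    rw [resonant_sum_sum, hQ, Finset.sum_product, Finset.sum_eq_single_of_mem _ (hshell hn),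
      Finset.sum_product, Finset.sum_eq_single_of_mem _ (hshell hk), Finset.sum_product,
      Finset.mul_sum]
    · simp [Finset.mul_sum]
    · intro l _ hl
      simp [hl.symm]
    · intro l _ hl
      refine Finset.sum_eq_zero fun q _ => ?_
      simp [hl.symm]
  rw [hdec]
  refine (enorm_sum_le _ _).trans (le_trans (Finset.sum_le_sum fun q hq => ?_)
    (ENNReal.sum_le_tsum Q))
  obtain ⟨k₁, k₂, j₁, j₂⟩ := q
  simp only [hQ, Finset.mem_product, Finset.mem_range] at hq
  exact enorm_localized_le (hU _) (hUR k₁ k₂ j₁ j₂) hrr' (h₁ j₁) (h₂ j₂) (hn₁ j₁ hq.2.2.1)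
    (hn₂ j₂ hq.2.2.2) hm ω

end Decomposition

/-! ### Littlewood-Paley decomposition of the test functions -/

section LittlewoodPaley

open UnitAddTorus

variable {ρ : ℝ → ℝ}

lemma bracket_pos (y : ℝ) : 0 < bracket y := Real.sqrt_pos.2 (by positivity)

lemma height_le_freqNorm (n : Freq) : (height n : ℝ) ≤ freqNorm n := by
  obtain ⟨i, hi⟩ : ∃ i, height n = (n i).natAbs := by
    by_contra! h
    have : height n ≤ height n - 1 := height_le_iff.2 fun i => by
      have := natAbs_le_height n i
      have := h i
      omega
    have h0 : height n = 0 := by omega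
    exact h 0 (by have := natAbs_le_height n 0; omega)
  rw [hi, freqNorm]
  refine Real.le_sqrt_of_sq_le ?_
  rw [Nat.cast_natAbs, Int.cast_abs, sq_abs]
  exact Finset.single_le_sum (f := fun i => (n i : ℝ) ^ 2) (fun i _ => sq_nonneg _)
    (Finset.mem_univ i)

lemma freqNorm_neg (n : Freq) : freqNorm (-n) = freqNorm n := by simp [freqNorm]

lemma trunc_neg (t : ℝ) (n : Freq) : trunc ρ t (-n) = trunc ρ t n := by
  rw [trunc, freqNorm_neg, trunc]

lemma freqNorm_nonneg (n : Freq) : 0 ≤ freqNorm n := Real.sqrt_nonneg _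

lemma IsCutoff.trunc_mem (hρ : IsCutoff ρ) (t : ℝ) (n : Freq) :
    trunc ρ t n ∈ Set.Icc (0 : ℝ) 1 :=
  hρ.range _ (div_nonneg (freqNorm_nonneg n) (bracket_pos t).le)

lemma IsCutoff.trunc_eq_zero (hρ : IsCutoff ρ) {t : ℝ} {n : Freq}
    (h : 4 * bracket t ≤ height n) : trunc ρ t n = 0 :=
  hρ.eq_zero _ ((le_div_iff₀ (bracket_pos t)).2 (h.trans (height_le_freqNorm n)))

lemma bracket_two_pow_le (k : ℕ) : bracket (2 ^ k) ≤ 2 * 2 ^ k := by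
  rw [bracket, Real.sqrt_le_iff]
  have : (1 : ℝ) ≤ 2 ^ k := one_le_pow₀ (by norm_num)
  exact ⟨by positivity, by nlinarith⟩

lemma le_bracket (y : ℝ) : y ≤ bracket y :=
  Real.le_sqrt_of_sq_le (by linarith)

/-- The cutoff vanishes beyond `4⟨2^k⟩ ≤ 2^{k+3}`, which is the origin of the shift by three in all
frequency supports. -/
lemma IsCutoff.trunc_two_pow_eq_zero (hρ : IsCutoff ρ) {k : ℕ} {n : Freq}
    (h : 2 ^ (k + 3) ≤ height n) : trunc ρ (2 ^ k) n = 0 := by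
  refine hρ.trunc_eq_zero ?_
  have h1 : ((2 ^ (k + 3) : ℕ) : ℝ) ≤ height n := by exact_mod_cast h
  have h2 := bracket_two_pow_le k
  push_cast at h1
  rw [pow_add] at h1
  linarith

lemma IsCutoff.eventually_trunc_eq_one (hρ : IsCutoff ρ) (n : Freq) :
    ∀ᶠ k : ℕ in atTop, trunc ρ (2 ^ k) n = 1 := by
  have h := (tendsto_pow_atTop_atTop_of_one_lt (one_lt_two (α := ℝ))).eventually_ge_atTop
    (4 * freqNorm n)
  filter_upwards [h] with k hk
  refine hρ.eq_one _ (div_nonneg (freqNorm_nonneg n) (bracket_pos _).le) ?_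
  rw [div_le_iff₀ (bracket_pos _)]
  have := le_bracket (2 ^ k)
  linarith

lemma sum_chi (n : Freq) (J : ℕ) : ∑ j ∈ Finset.range (J + 1), chi ρ j n = trunc ρ (2 ^ J) n := by
  induction J with
  | zero => simp [chi]
  | succ J ih => rw [Finset.sum_range_succ, ih, chi]; ring

lemma IsCutoff.height_lt_of_chi_ne_zero (hρ : IsCutoff ρ) {j : ℕ} {n : Freq}
    (h : chi ρ j n ≠ 0) : height n < 2 ^ (j + 3) := by
  contrapose! h
  cases j with
  | zero => simpa [chi] using hρ.trunc_two_pow_eq_zero h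
  | succ j =>
    rw [chi, hρ.trunc_two_pow_eq_zero h, hρ.trunc_two_pow_eq_zero (le_trans
      (Nat.pow_le_pow_right (by norm_num) (by omega)) h), sub_zero]

lemma IsCutoff.lpProj_eq_trigPoly (hρ : IsCutoff ρ) {A : Finset Freq} {j : ℕ}
    (hA : box (2 ^ (j + 3)) ⊆ A) (f : Torus3 → ℝ) :
    lpProj ρ j f = trigPoly A fun n => chi ρ j n * coeff f n := by
  funext x
  refine tsum_eq_sum fun n hn => ?_
  have : chi ρ j n = 0 := by
    by_contra h
    exact hn (hA (mem_box.2 (hρ.height_lt_of_chi_ne_zero h).le))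
  simp [this]

/-- Any single entry is bounded by the `ℓ^r` norm, for every `r` including `∞`. -/
lemma eLpNorm_lpProj_le {s : ℝ} {r : ℝ≥0∞} (hr : 1 ≤ r) {f : Torus3 → ℝ}
    (hf : sobolevNorm ρ s r f ≤ 1) (j : ℕ) :
    eLpNorm (lpProj ρ j f) r dx ≤ ENNReal.ofReal (2 ^ (-s * j)) := by
  have h := (enorm_le_eLpNorm_count (p := r) (fun k : ℕ => ENNReal.ofReal (((2 : ℝ) ^ k) ^ s) *
    eLpNorm (lpProj ρ k f) r dx) j (zero_lt_one.trans_le hr).ne').trans hf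
  rw [enorm_eq_self, ← two_rpow_natCast, ← Real.rpow_mul (by norm_num)] at h
  have h1 : ENNReal.ofReal (2 ^ (-s * (j : ℝ))) * ENNReal.ofReal (2 ^ ((j : ℝ) * s)) = 1 := by
    rw [← ENNReal.ofReal_mul (by positivity), ← Real.rpow_add (by norm_num),
      show -s * (j : ℝ) + j * s = 0 by ring, Real.rpow_zero, ENNReal.ofReal_one]
  calc eLpNorm (lpProj ρ j f) r dx
      = ENNReal.ofReal (2 ^ (-s * (j : ℝ))) *
        (ENNReal.ofReal (2 ^ ((j : ℝ) * s)) * eLpNorm (lpProj ρ j f) r dx) := by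
        rw [← mul_assoc, h1, one_mul]
    _ ≤ ENNReal.ofReal (2 ^ (-s * (j : ℝ))) * 1 := by gcongr
    _ = _ := mul_one _

lemma enorm_mFourierCoeff_le {f : Torus3 → ℂ} {r : ℝ≥0∞} (hr : 1 ≤ r)
    (hf : AEStronglyMeasurable f dx) (n : Freq) : ‖mFourierCoeff f n‖ₑ ≤ eLpNorm f r dx := by
  rw [mFourierCoeff_eq]
  refine (enorm_integral_le_lintegral_enorm _).trans ?_
  refine le_trans (le_of_eq ?_) (eLpNorm_le_eLpNorm_of_exponent_le hr hf)
  rw [eLpNorm_one_eq_lintegral_enorm]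
  refine lintegral_congr fun x => ?_
  rw [enorm_mul, ← ofReal_norm (mFourier (-n) x), norm_mFourier_apply, ENNReal.ofReal_one, one_mul]

lemma mFourierCoeff_sub {f g : Torus3 → ℂ} (hf : Integrable f dx) (hg : Integrable g dx)
    (n : Freq) : mFourierCoeff (f - g) n = mFourierCoeff f n - mFourierCoeff g n := by
  simp only [mFourierCoeff_eq, Pi.sub_apply, mul_sub]
  refine integral_sub ?_ ?_
  · exact hf.bdd_mul (c := 1) (by fun_prop) (ae_of_all _ fun z => (norm_mFourier_apply _ _).le)
  · exact hg.bdd_mul (c := 1) (by fun_prop) (ae_of_all _ fun z => (norm_mFourier_apply _ _).le)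

/-- The partial sums of the Littlewood-Paley decomposition are trigonometric polynomials. -/
lemma IsCutoff.sum_lpProj (hρ : IsCutoff ρ) {J : ℕ} {A : Finset Freq}
    (hA : box (2 ^ (J + 3)) ⊆ A) (f : Torus3 → ℝ) (x : Torus3) :
    ∑ j ∈ Finset.range (J + 1), lpProj ρ j f x =
      trigPoly A (fun n => ∑ j ∈ Finset.range (J + 1), chi ρ j n * coeff f n) x := by
  have h (j : ℕ) (hj : j ∈ Finset.range (J + 1)) :
      lpProj ρ j f x = trigPoly A (fun n => chi ρ j n * coeff f n) x := by
    rw [hρ.lpProj_eq_trigPoly fun n hn => hA ?_]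
    rw [mem_box] at hn ⊢
    exact hn.trans (Nat.pow_le_pow_right (by norm_num) (by
      have := Finset.mem_range.1 hj; omega))
  rw [Finset.sum_congr rfl h]
  simp only [trigPoly, Finset.sum_mul]
  exact Finset.sum_comm

/-- For `s > 0` the series converges absolutely in `L^r`, even for `r = ∞`, because its terms decay
geometrically. The limit is `f` by uniqueness of Fourier coefficients, since the telescoped symbol
is eventually `1` at each frequency. -/
theorem IsCutoff.tendsto_sum_lpProj (hρ : IsCutoff ρ) {s : ℝ} (hs : 0 < s) {r : ℝ≥0∞} (hr : 1 ≤ r)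
    {f : Torus3 → ℝ} (hf : MemLp f r dx) (h1 : sobolevNorm ρ s r f ≤ 1) :
    Tendsto (fun J : ℕ => eLpNorm (fun x => ∑ j ∈ Finset.range (J + 1), lpProj ρ j f x - f x) r dx)
      atTop (𝓝 0) := by
  have : Fact (1 ≤ r) := ⟨hr⟩
  have hmem (j : ℕ) : MemLp (lpProj ρ j f) r dx := by
    rw [hρ.lpProj_eq_trigPoly subset_rfl]
    exact memLp_trigPoly _ _ _
  have hsum : Summable fun j => (hmem j).toLp (lpProj ρ j f) := by
    refine Summable.of_norm_bounded (g := fun j : ℕ => ((2 : ℝ) ^ (-s)) ^ j)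
      (summable_geometric_of_lt_one (by positivity)
        (Real.rpow_lt_one_of_one_lt_of_neg (by norm_num) (by linarith))) fun j => ?_
    rw [Lp.norm_toLp, ← Real.rpow_mul_natCast (by norm_num)]
    exact ENNReal.toReal_le_of_le_ofReal (by positivity) (eLpNorm_lpProj_le hr h1 j)
  set g := ∑' j, (hmem j).toLp (lpProj ρ j f) with hg
  have hlim := (hsum.hasSum.tendsto_sum_nat).comp (tendsto_add_atTop_nat 1)
  rw [Lp.tendsto_Lp_iff_tendsto_eLpNorm'] at hlim
  have hcoe (J : ℕ) : ⇑(∑ j ∈ Finset.range (J + 1), (hmem j).toLp (lpProj ρ j f)) =ᵐ[dx]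
      fun x => ∑ j ∈ Finset.range (J + 1), lpProj ρ j f x := by
    have h2 : ∀ᵐ x ∂dx, ∀ j, (hmem j).toLp (lpProj ρ j f) x = lpProj ρ j f x :=
      ae_all_iff.2 fun j => (hmem j).coeFn_toLp
    filter_upwards [Lp.coeFn_finsetSum (Finset.range (J + 1)) fun j =>
      (hmem j).toLp (lpProj ρ j f), h2] with x hx hx2
    rw [hx, Finset.sum_apply]
    exact Finset.sum_congr rfl fun j _ => hx2 j
  have hS (J : ℕ) : (fun x => ∑ j ∈ Finset.range (J + 1), lpProj ρ j f x) =
      trigPoly (box (2 ^ (J + 3))) fun n => ∑ j ∈ Finset.range (J + 1), chi ρ j n * coeff f n :=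
    funext fun x => hρ.sum_lpProj subset_rfl f x
  have hlim' : Tendsto (fun J : ℕ => eLpNorm ((fun x => ∑ j ∈ Finset.range (J + 1), lpProj ρ j f x)
      - ⇑g) r dx) atTop (𝓝 0) :=
    hlim.congr fun J => eLpNorm_congr_ae ((hcoe J).sub EventuallyEq.rfl)
  have hgi : Integrable g dx := (Lp.memLp g).integrable hr
  have hfi : Integrable (fun x => (f x : ℂ)) dx := (hf.integrable hr).ofReal
  have hcoeff (n : Freq) : mFourierCoeff g n = coeff f n := by
    have h3 : Tendsto (fun J : ℕ => mFourierCoeff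
        (fun x => ∑ j ∈ Finset.range (J + 1), lpProj ρ j f x) n) atTop (𝓝 (mFourierCoeff g n)) := by
      rw [tendsto_iff_edist_tendsto_0]
      refine tendsto_of_tendsto_of_tendsto_of_le_of_le tendsto_const_nhds hlim'
        (fun _ => zero_le) fun J => ?_
      dsimp only
      rw [hS, edist_eq_enorm_sub, ← mFourierCoeff_sub
        ((memLp_trigPoly _ _ r).integrable hr) hgi]
      exact enorm_mFourierCoeff_le hr
        ((memLp_trigPoly _ _ r).1.sub (Lp.memLp g).1) n
    refine tendsto_nhds_unique h3 (tendsto_const_nhds.congr' ?_)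
    have h4 : ∀ᶠ J : ℕ in atTop, height n ≤ 2 ^ (J + 3) :=
      (eventually_ge_atTop (height n)).mono fun J hJ => hJ.trans
        (Nat.lt_two_pow_self.le.trans (Nat.pow_le_pow_right (by norm_num) (by omega)))
    filter_upwards [hρ.eventually_trunc_eq_one n, h4] with J hJ hJ'
    rw [hS, mFourierCoeff_eq, integral_mFourier_mul_trigPoly, if_pos (mem_box.2 hJ'),
      ← Finset.sum_mul]
    have h5 := sum_chi (ρ := ρ) n J
    rw [hJ] at h5
    rw [← Complex.ofReal_sum, h5, Complex.ofReal_one, one_mul]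
  have hae : (⇑g - fun x => (f x : ℂ)) =ᵐ[dx] 0 := by
    refine ae_eq_zero_of_mFourierCoeff_eq_zero (hgi.sub hfi) fun n => ?_
    rw [mFourierCoeff_sub hgi hfi, hcoeff, coeff, sub_self]
  refine hlim'.congr fun J => eLpNorm_congr_ae ?_
  filter_upwards [hae] with x hx
  simp only [Pi.sub_apply, Pi.zero_apply, sub_eq_zero] at hx ⊢
  rw [hx]

end LittlewoodPaley

/-! ### Continuity of the bilinear form on Lebesgue spaces -/

section Pairing

open UnitAddTorus

/-- The bilinear form `∫ V(z) K(z, x) f₁(x - z) f₂(x) dx dz`. -/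
def pairing (V : Torus3 → ℝ) (K : Torus3 → Torus3 → ℂ) (f₁ f₂ : Torus3 → ℂ) : ℂ :=
  ∫ z, (V z : ℂ) * ∫ x, K z x * (f₁ (x - z) * f₂ x) ∂dx ∂dx

variable {V : Torus3 → ℝ} {K : Torus3 → Torus3 → ℂ} {f₁ f₂ h₁ h₂ : Torus3 → ℂ} {r r' : ℝ≥0∞}

lemma exists_norm_le_of_continuous (hK : Continuous fun p : Torus3 × Torus3 => K p.1 p.2) :
    ∃ B : ℝ, 0 ≤ B ∧ ∀ z x, ‖K z x‖ ≤ B := by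
  obtain ⟨B, hB⟩ := isCompact_univ.exists_bound_of_continuousOn hK.continuousOn
  exact ⟨B, (norm_nonneg _).trans (hB (0, 0) trivial), fun z x => hB (z, x) trivial⟩

lemma integrable_comp_sub_mul (hrr' : r⁻¹ + r'⁻¹ = 1) (hf₁ : MemLp f₁ r dx) (hf₂ : MemLp f₂ r' dx)
    (z : Torus3) : Integrable (fun x => f₁ (x - z) * f₂ x) dx := by
  refine ⟨(aestronglyMeasurable_comp_sub hf₁.1 z).mul hf₂.1, ?_⟩
  rw [hasFiniteIntegral_iff_enorm]
  simp_rw [enorm_mul]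
  exact (lintegral_enorm_comp_sub_mul_le hrr' hf₁.1 hf₂.1 z).trans_lt
    (ENNReal.mul_lt_top hf₁.2 hf₂.2)

lemma integrable_kernel_mul (hK : Continuous fun p : Torus3 × Torus3 => K p.1 p.2)
    (hrr' : r⁻¹ + r'⁻¹ = 1) (hf₁ : MemLp f₁ r dx) (hf₂ : MemLp f₂ r' dx)
    (z : Torus3) : Integrable (fun x => K z x * (f₁ (x - z) * f₂ x)) dx := by
  obtain ⟨B, -, hB⟩ := exists_norm_le_of_continuous hK
  have hc : Continuous (K z) := hK.comp (Continuous.prodMk_right z)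
  exact (integrable_comp_sub_mul hrr' hf₁ hf₂ z).bdd_mul (c := B) hc.aestronglyMeasurable
    (ae_of_all _ fun x => hB z x)

/-- The absolute integrability behind every exchange of the `x` and `z` integrals: the kernel is
bounded, and Hölder's inequality is uniform in `z`. -/
lemma integrable_pairing (hV : Integrable V dx)
    (hK : Continuous fun p : Torus3 × Torus3 => K p.1 p.2) (hrr' : r⁻¹ + r'⁻¹ = 1)
    (hf₁ : MemLp f₁ r dx) (hf₂ : MemLp f₂ r' dx) :
    Integrable (fun p : Torus3 × Torus3 => (V p.1 : ℂ) * (K p.1 p.2 * (f₁ (p.2 - p.1) * f₂ p.2)))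
      (dx.prod dx) := by
  obtain ⟨B, -, hB⟩ := exists_norm_le_of_continuous hK
  have hsub : Measure.QuasiMeasurePreserving (fun p : Torus3 × Torus3 => p.2 - p.1)
      (dx.prod dx) dx :=
    (quasiMeasurePreserving_sub_of_right_invariant dx dx).comp
      Measure.measurePreserving_swap.quasiMeasurePreserving
  have hm : AEStronglyMeasurable (fun p : Torus3 × Torus3 =>
      (V p.1 : ℂ) * (f₁ (p.2 - p.1) * f₂ p.2)) (dx.prod dx) :=
    hV.ofReal.1.comp_fst.mul ((hf₁.1.comp_quasiMeasurePreserving hsub).mul hf₂.1.comp_snd)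
  have hint : Integrable (fun p : Torus3 × Torus3 =>
      (V p.1 : ℂ) * (f₁ (p.2 - p.1) * f₂ p.2)) (dx.prod dx) := by
    refine ⟨hm, ?_⟩
    rw [hasFiniteIntegral_iff_enorm, lintegral_prod _ hm.enorm]
    calc ∫⁻ z, ∫⁻ x, ‖(V z : ℂ) * (f₁ (x - z) * f₂ x)‖ₑ ∂dx ∂dx
        ≤ ∫⁻ z, ‖V z‖ₑ * (eLpNorm f₁ r dx * eLpNorm f₂ r' dx) ∂dx := by
          refine lintegral_mono fun z => ?_
          simp_rw [enorm_mul]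
          rw [lintegral_const_mul' _ _ (by finiteness)]
          gcongr
          · simp [← ofReal_norm]
          · exact lintegral_enorm_comp_sub_mul_le hrr' hf₁.1 hf₂.1 z
      _ < ∞ := by
          have hN := ENNReal.mul_lt_top hf₁.2 hf₂.2
          rw [lintegral_mul_const' _ _ hN.ne]
          exact ENNReal.mul_lt_top hV.2 hN
  refine (hint.bdd_mul (c := B) hK.aestronglyMeasurable (ae_of_all _ fun p => hB p.1 p.2)).congr
    (ae_of_all _ fun p => ?_)
  dsimp only
  ring

lemma pairing_eq_integral_integral (hV : Integrable V dx)
    (hK : Continuous fun p : Torus3 × Torus3 => K p.1 p.2) (hrr' : r⁻¹ + r'⁻¹ = 1)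
    (hf₁ : MemLp f₁ r dx) (hf₂ : MemLp f₂ r' dx) :
    pairing V K f₁ f₂ = ∫ x, ∫ z, (V z : ℂ) * (K z x * (f₁ (x - z) * f₂ x)) ∂dx ∂dx := by
  rw [← integral_integral_swap (integrable_pairing hV hK hrr' hf₁ hf₂), pairing]
  simp_rw [integral_const_mul]

lemma integrable_pairing_outer (hV : Integrable V dx)
    (hK : Continuous fun p : Torus3 × Torus3 => K p.1 p.2) (hrr' : r⁻¹ + r'⁻¹ = 1)
    (hf₁ : MemLp f₁ r dx) (hf₂ : MemLp f₂ r' dx) :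
    Integrable (fun z => (V z : ℂ) * ∫ x, K z x * (f₁ (x - z) * f₂ x) ∂dx) dx := by
  have h := (integrable_pairing hV hK hrr' hf₁ hf₂).integral_prod_left
  simpa only [integral_const_mul] using h

lemma enorm_pairing_le {B : ℝ≥0∞} (hB : ∀ z x, ‖K z x‖ₑ ≤ B) (hB' : B ≠ ∞)
    (hrr' : r⁻¹ + r'⁻¹ = 1)
    (hf₁ : MemLp f₁ r dx) (hf₂ : MemLp f₂ r' dx) :
    ‖pairing V K f₁ f₂‖ₑ ≤
      (∫⁻ z, ‖V z‖ₑ ∂dx) * B * (eLpNorm f₁ r dx * eLpNorm f₂ r' dx) := by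
  have hN : eLpNorm f₁ r dx * eLpNorm f₂ r' dx ≠ ∞ := ENNReal.mul_ne_top hf₁.2.ne hf₂.2.ne
  refine (enorm_integral_le_lintegral_enorm _).trans ?_
  rw [mul_assoc, ← lintegral_mul_const' _ _ (ENNReal.mul_ne_top hB' hN)]
  refine lintegral_mono fun z => ?_
  rw [enorm_mul]
  gcongr
  · simp [← ofReal_norm]
  · refine (enorm_integral_le_lintegral_enorm _).trans ?_
    simp_rw [enorm_mul]
    calc ∫⁻ x, ‖K z x‖ₑ * (‖f₁ (x - z)‖ₑ * ‖f₂ x‖ₑ) ∂dx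
        ≤ ∫⁻ x, B * (‖f₁ (x - z)‖ₑ * ‖f₂ x‖ₑ) ∂dx :=
          lintegral_mono fun x => mul_le_mul' (hB z x) le_rfl
      _ = B * ∫⁻ x, ‖f₁ (x - z)‖ₑ * ‖f₂ x‖ₑ ∂dx := lintegral_const_mul' _ _ hB'
      _ ≤ _ := by
        gcongr
        exact lintegral_enorm_comp_sub_mul_le hrr' hf₁.1 hf₂.1 z

lemma pairing_sub_left (hV : Integrable V dx)
    (hK : Continuous fun p : Torus3 × Torus3 => K p.1 p.2) (hrr' : r⁻¹ + r'⁻¹ = 1)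
    (hf₁ : MemLp f₁ r dx) (hh₁ : MemLp h₁ r dx) (hf₂ : MemLp f₂ r' dx) :
    pairing V K (f₁ - h₁) f₂ = pairing V K f₁ f₂ - pairing V K h₁ f₂ := by
  simp only [pairing]
  rw [← integral_sub (integrable_pairing_outer hV hK hrr' hf₁ hf₂)
    (integrable_pairing_outer hV hK hrr' hh₁ hf₂)]
  congr 1; funext z
  rw [← mul_sub, ← integral_sub (integrable_kernel_mul hK hrr' hf₁ hf₂ z)
    (integrable_kernel_mul hK hrr' hh₁ hf₂ z)]
  congr 2; funext x
  simp only [Pi.sub_apply]; ring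

lemma pairing_sub_right (hV : Integrable V dx)
    (hK : Continuous fun p : Torus3 × Torus3 => K p.1 p.2) (hrr' : r⁻¹ + r'⁻¹ = 1)
    (hf₁ : MemLp f₁ r dx) (hf₂ : MemLp f₂ r' dx) (hh₂ : MemLp h₂ r' dx) :
    pairing V K f₁ (f₂ - h₂) = pairing V K f₁ f₂ - pairing V K f₁ h₂ := by
  simp only [pairing]
  rw [← integral_sub (integrable_pairing_outer hV hK hrr' hf₁ hf₂)
    (integrable_pairing_outer hV hK hrr' hf₁ hh₂)]
  congr 1; funext z
  rw [← mul_sub, ← integral_sub (integrable_kernel_mul hK hrr' hf₁ hf₂ z)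
    (integrable_kernel_mul hK hrr' hf₁ hh₂ z)]
  congr 2; funext x
  simp only [Pi.sub_apply]; ring

/-- The bilinear form is continuous on `L^r × L^{r'}`. -/
lemma tendsto_pairing (hV : Integrable V dx)
    (hK : Continuous fun p : Torus3 × Torus3 => K p.1 p.2) (hrr' : r⁻¹ + r'⁻¹ = 1)
    (hr' : 1 ≤ r')
    (hf₁ : MemLp f₁ r dx) (hf₂ : MemLp f₂ r' dx) {g₁ g₂ : ℕ → Torus3 → ℂ}
    (hg₁ : ∀ J, MemLp (g₁ J) r dx) (hg₂ : ∀ J, MemLp (g₂ J) r' dx)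
    (h₁ : Tendsto (fun J => eLpNorm (g₁ J - f₁) r dx) atTop (𝓝 0))
    (h₂ : Tendsto (fun J => eLpNorm (g₂ J - f₂) r' dx) atTop (𝓝 0)) :
    Tendsto (fun J => pairing V K (g₁ J) (g₂ J)) atTop (𝓝 (pairing V K f₁ f₂)) := by
  obtain ⟨B, hB0, hB⟩ := exists_norm_le_of_continuous hK
  have hB' (z x : Torus3) : ‖K z x‖ₑ ≤ ENNReal.ofReal B := by
    rw [← ofReal_norm]; exact ENNReal.ofReal_le_ofReal (hB z x)
  set M := (∫⁻ z, ‖V z‖ₑ ∂dx) * ENNReal.ofReal B with hM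
  have hMt : M ≠ ∞ := ENNReal.mul_ne_top hV.2.ne ENNReal.ofReal_ne_top
  rw [tendsto_iff_edist_tendsto_0]
  have hle (J : ℕ) : edist (pairing V K (g₁ J) (g₂ J)) (pairing V K f₁ f₂) ≤
      M * (eLpNorm (g₁ J - f₁) r dx * (eLpNorm (g₂ J - f₂) r' dx + eLpNorm f₂ r' dx)) +
        M * (eLpNorm f₁ r dx * eLpNorm (g₂ J - f₂) r' dx) := by
    -- One argument is changed at a time, and the norms of `g₂ J` stay controlled because they
    -- converge.
    have hsplit : pairing V K (g₁ J) (g₂ J) - pairing V K f₁ f₂ =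
        pairing V K (g₁ J - f₁) (g₂ J) + pairing V K f₁ (g₂ J - f₂) := by
      rw [pairing_sub_left hV hK hrr' (hg₁ J) hf₁ (hg₂ J),
        pairing_sub_right hV hK hrr' hf₁ (hg₂ J) hf₂]
      ring
    rw [edist_eq_enorm_sub, hsplit]
    refine (enorm_add_le _ _).trans (add_le_add ?_ ?_)
    · refine (enorm_pairing_le hB' ENNReal.ofReal_ne_top hrr' ((hg₁ J).sub hf₁) (hg₂ J)).trans ?_
      gcongr
      calc eLpNorm (g₂ J) r' dx = eLpNorm ((g₂ J - f₂) + f₂) r' dx := by rw [sub_add_cancel]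
        _ ≤ _ := eLpNorm_add_le ((hg₂ J).1.sub hf₂.1) hf₂.1 hr'
    · exact enorm_pairing_le hB' ENNReal.ofReal_ne_top hrr' hf₁ ((hg₂ J).sub hf₂)
  have hlim : Tendsto (fun J => M * (eLpNorm (g₁ J - f₁) r dx *
      (eLpNorm (g₂ J - f₂) r' dx + eLpNorm f₂ r' dx)) +
        M * (eLpNorm f₁ r dx * eLpNorm (g₂ J - f₂) r' dx)) atTop (𝓝 0) := by
    have e1 := ENNReal.Tendsto.const_mul (a := M) (ENNReal.Tendsto.mul h₁
      (Or.inr (by simpa using hf₂.2.ne)) (h₂.add_const (eLpNorm f₂ r' dx))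
      (Or.inr ENNReal.zero_ne_top)) (Or.inr hMt)
    have e2 := ENNReal.Tendsto.const_mul (a := M)
      (ENNReal.Tendsto.const_mul (a := eLpNorm f₁ r dx) h₂ (Or.inr hf₁.2.ne)) (Or.inr hMt)
    simpa using e1.add e2
  exact tendsto_of_tendsto_of_tendsto_of_le_of_le tendsto_const_nhds hlim (fun _ => zero_le) hle

/-- Exhibits the form as a polynomial in the modes with coefficients depending only on the
functions; the measurability of the supremum rests on this. -/
lemma pairing_modeSum (hV : Integrable V dx) (F : Finset Freq) (g : Freq → Freq → ℂ)
    (hrr' : r⁻¹ + r'⁻¹ = 1) (hf₁ : MemLp f₁ r dx) (hf₂ : MemLp f₂ r' dx) :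
    pairing V (modeSum F g) f₁ f₂ = ∑ n ∈ F, ∑ m ∈ F, g n m *
      pairing V (fun z x => mFourier n (x - z) * mFourier m x) f₁ f₂ := by
  have hc (n m : Freq) : Continuous fun p : Torus3 × Torus3 =>
      mFourier n (p.2 - p.1) * mFourier m p.2 := by fun_prop
  have h (z : Torus3) : (V z : ℂ) * ∫ x, modeSum F g z x * (f₁ (x - z) * f₂ x) ∂dx =
      ∑ n ∈ F, ∑ m ∈ F, g n m * ((V z : ℂ) *
        ∫ x, mFourier n (x - z) * mFourier m x * (f₁ (x - z) * f₂ x) ∂dx) := by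
    have hi (n m : Freq) := (integrable_kernel_mul (K := fun z x => mFourier n (x - z) *
      mFourier m x) (hc n m) hrr' hf₁ hf₂ z).const_mul (g n m)
    simp only [modeSum, Finset.sum_mul, mul_assoc (g _ _)]
    rw [integral_finsetSum _ fun n _ => integrable_finsetSum _ fun m _ => hi n m, Finset.mul_sum]
    refine Finset.sum_congr rfl fun n _ => ?_
    rw [integral_finsetSum _ fun m _ => hi n m, Finset.mul_sum]
    refine Finset.sum_congr rfl fun m _ => ?_
    rw [integral_const_mul]; ring
  have ho (n m : Freq) := (integrable_pairing_outer (K := fun z x => mFourier n (x - z) *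
      mFourier m x) hV (hc n m) hrr' hf₁ hf₂).const_mul (g n m)
  rw [pairing]
  simp_rw [h]
  rw [integral_finsetSum _ fun n _ => integrable_finsetSum _ fun m _ => ho n m]
  refine Finset.sum_congr rfl fun n _ => ?_
  rw [integral_finsetSum _ fun m _ => ho n m]
  refine Finset.sum_congr rfl fun m _ => ?_
  rw [integral_const_mul, pairing]

end Pairing

/-! ### The renormalised form as a pairing with a centred kernel -/

section Renormalization

open UnitAddTorus

variable {V : Torus3 → ℝ} {r r' : ℝ≥0∞}

lemma pairing_kernel_sub (hV : Integrable V dx) {K L : Torus3 → Torus3 → ℂ} {f₁ f₂ : Torus3 → ℂ}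
    (hK : Continuous fun p : Torus3 × Torus3 => K p.1 p.2)
    (hL : Continuous fun p : Torus3 × Torus3 => L p.1 p.2) (hrr' : r⁻¹ + r'⁻¹ = 1)
    (hf₁ : MemLp f₁ r dx) (hf₂ : MemLp f₂ r' dx) :
    pairing V (fun z x => K z x - L z x) f₁ f₂ = pairing V K f₁ f₂ - pairing V L f₁ f₂ := by
  simp only [pairing]
  rw [← integral_sub (integrable_pairing_outer hV hK hrr' hf₁ hf₂)
    (integrable_pairing_outer hV hL hrr' hf₁ hf₂)]
  congr 1; funext z
  rw [← mul_sub, ← integral_sub (integrable_kernel_mul hK hrr' hf₁ hf₂ z)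
    (integrable_kernel_mul hL hrr' hf₁ hf₂ z)]
  congr 2; funext x
  ring

lemma ofReal_convolution (U f : Torus3 → ℝ) (x : Torus3) :
    ((convolution U f (ContinuousLinearMap.mul ℝ ℝ) dx x : ℝ) : ℂ) =
      ∫ z, (U z : ℂ) * (f (x - z) : ℂ) ∂dx := by
  rw [convolution, ← integral_complex_ofReal]
  simp

lemma coeff_convolution {U f : Torus3 → ℝ} (hU : Integrable U dx) (hf : Integrable f dx)
    (n : Freq) : coeff (convolution U f (ContinuousLinearMap.mul ℝ ℝ) dx) n =
      coeff U n * coeff f n := by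
  have hf' : MemLp (fun x => (f x : ℂ)) 1 dx := memLp_one_iff_integrable.2 hf.ofReal
  have he : MemLp (fun x => mFourier (-n) x) ∞ dx := memLp_top_of_bound (by fun_prop) 1
    (ae_of_all _ fun x => (norm_mFourier_apply _ _).le)
  -- The convolution theorem is the pairing with constant kernel, where a character serves as the
  -- `L^∞` partner of `f`.
  have h := pairing_eq_integral_integral (K := fun _ _ => 1) hU continuous_const (by simp) hf' he
  have h1 : ∫ x, ∫ z, (U z : ℂ) * (1 * ((f (x - z) : ℂ) * mFourier (-n) x)) ∂dx ∂dx =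
      coeff (convolution U f (ContinuousLinearMap.mul ℝ ℝ) dx) n := by
    rw [coeff, mFourierCoeff_eq]
    congr 1; funext x
    rw [ofReal_convolution, ← integral_const_mul]
    congr 1; funext z
    ring
  have h2 (z : Torus3) : ∫ x, 1 * ((f (x - z) : ℂ) * mFourier (-n) x) ∂dx =
      mFourier (-n) z * coeff f n := by
    rw [coeff, mFourierCoeff_eq, ← integral_const_mul, ← integral_sub_right_eq_self (μ := dx)
      (fun x => mFourier (-n) z * (mFourier (-n) x * (f x : ℂ))) z]
    congr 1; funext x
    have hx : mFourier (-n) x = mFourier (-n) (x - z) * mFourier (-n) z := by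
      rw [← mFourier_apply_add, sub_add_cancel]
    rw [hx]; ring
  rw [← h1, ← h, pairing]
  simp_rw [h2, ← mul_assoc]
  rw [integral_mul_const, integral_mul_mFourier_neg]

/-- The multiplier is defined by a choice, so uniqueness of Fourier coefficients is needed to
identify it with a concrete function. -/
lemma multiplier_ae_eq {m : Freq → ℂ} {f g : Torus3 → ℝ} (hg : Integrable g dx)
    (h : ∀ n, coeff g n = m n * coeff f n) : multiplier m f =ᵐ[dx] g := by
  have hex : ∃ g : Torus3 → ℝ, Integrable g dx ∧ ∀ n, coeff g n = m n * coeff f n := ⟨g, hg, h⟩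
  rw [multiplier, dif_pos hex]
  obtain ⟨h1, h2⟩ := hex.choose_spec
  set k := hex.choose
  have hk : Integrable (fun x => (k x : ℂ)) dx := h1.ofReal
  have hg' : Integrable (fun x => (g x : ℂ)) dx := hg.ofReal
  have hae := ae_eq_zero_of_mFourierCoeff_eq_zero (hk.sub hg') fun n => by
    rw [mFourierCoeff_sub hk hg', ← coeff, ← coeff, h2 n, h n, sub_self]
  filter_upwards [hae] with x hx
  simp only [Pi.sub_apply, Pi.zero_apply, sub_eq_zero] at hx
  exact_mod_cast hx

/-- A trigonometric polynomial with conjugate symmetric coefficients is real. -/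
lemma ofReal_re_trigPoly_box {R : ℕ} {a : Freq → ℂ} (ha : ∀ n, a (-n) = conj (a n))
    (x : Torus3) : (((trigPoly (box R) a x).re : ℝ) : ℂ) = trigPoly (box R) a x := by
  rw [← Complex.conj_eq_iff_re, trigPoly, map_sum]
  refine Finset.sum_equiv (Equiv.neg Freq) (fun n => ?_) fun n _ => ?_
  · simp [mem_box, height_neg]
  · simp [ha, mFourier_neg]

lemma trigPoly_box_neg {R : ℕ} {a : Freq → ℂ} (ha : ∀ n, a (-n) = a n) (z : Torus3) :
    trigPoly (box R) a z = ∑ n ∈ box R, a n * mFourier (-n) z := by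
  refine Finset.sum_equiv (Equiv.neg Freq) (fun n => ?_) fun n _ => ?_
  · simp [mem_box, height_neg]
  · simp [ha]

lemma coeff_mul_trigPoly {R : ℕ} {s : Freq → ℝ} (hs : ∀ n, s (-n) = s n) (hV : Integrable V dx)
    (n : Freq) : coeff (fun z => V z * (trigPoly (box R) (fun m => s m) z).re) n =
      ∑ m ∈ box R, coeff V (n + m) * s m := by
  rw [coeff, mFourierCoeff_eq]
  have h (z : Torus3) : mFourier (-n) z *
      ((V z * (trigPoly (box R) (fun m => (s m : ℂ)) z).re : ℝ) : ℂ) =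
      ∑ m ∈ box R, s m * ((V z : ℂ) * mFourier (-(n + m)) z) := by
    rw [Complex.ofReal_mul, ofReal_re_trigPoly_box (fun m => by simp [hs]),
      trigPoly_box_neg (fun m => by simp [hs]), Finset.mul_sum, Finset.mul_sum]
    refine Finset.sum_congr rfl fun m _ => ?_
    rw [neg_add, mFourier_add]; ring
  simp_rw [h]
  rw [integral_finsetSum _ fun m _ => (integrable_mul_mFourier hV _).const_mul _]
  refine Finset.sum_congr rfl fun m _ => ?_
  rw [integral_const_mul, integral_mul_mFourier_neg, mul_comm]

/-- The bilinear form of a real field with Fourier modes `a`, renormalised by the correlations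
`s`, as the pairing with a kernel. -/
theorem ofReal_renorm_eq_pairing {R : ℕ} {a : Freq → ℂ} {s : Freq → ℝ}
    (ha : ∀ n, a (-n) = conj (a n)) (hs : ∀ n, s (-n) = s n) (hV : Integrable V dx)
    (hr : 1 ≤ r) (hrr' : r⁻¹ + r'⁻¹ = 1) {σ : Freq → ℂ}
    (hσ : ∀ n, σ n = ∑ m ∈ box R, coeff V (n + m) * s m) {w f₁ f₂ : Torus3 → ℝ}
    (hw : ∀ x, w x = (trigPoly (box R) a x).re)
    (hf₁ : MemLp f₁ r dx) (hf₂ : MemLp f₂ r' dx) :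
    (((∫ x, convolution V (w * f₁) (ContinuousLinearMap.mul ℝ ℝ) dx x * (w x * f₂ x) ∂dx)
      - ∫ x, multiplier σ f₁ x * f₂ x ∂dx : ℝ) : ℂ) =
      pairing V (modeSum (box R) fun n m => a n * a m - if n + m = 0 then (s n : ℂ) else 0)
        (fun x => f₁ x) (fun x => f₂ x) := by
  -- The covariance function of the field with variances `s`. The symbol `σ` consists of the Fourier
  -- coefficients of `V c`, so the multiplier is convolution with `V c`.
  set c : Torus3 → ℝ := fun z => (trigPoly (box R) (fun m => (s m : ℂ)) z).re with hc
  have hw' (x : Torus3) : (w x : ℂ) = trigPoly (box R) a x := by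
    rw [hw, ofReal_re_trigPoly_box ha]
  have hc' (x : Torus3) : (c x : ℂ) = trigPoly (box R) (fun m => (s m : ℂ)) x :=
    ofReal_re_trigPoly_box (fun m => by simp [hs]) x
  have hwc : Continuous fun x => (w x : ℂ) := by
    simp_rw [hw']; exact continuous_trigPoly _ _
  have hcc : Continuous fun x => (c x : ℂ) := by
    simp_rw [hc']; exact continuous_trigPoly _ _
  have hcont : Continuous c := Complex.continuous_re.comp (continuous_trigPoly _ _)
  have hF₁ : MemLp (fun x => (f₁ x : ℂ)) r dx := hf₁.ofReal
  have hF₂ : MemLp (fun x => (f₂ x : ℂ)) r' dx := hf₂.ofReal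
  have hVc : Integrable (fun z => V z * c z) dx := by
    obtain ⟨B, hB⟩ := isCompact_univ.exists_bound_of_continuousOn hcont.continuousOn
    exact hV.mul_bdd (c := B) hcont.aestronglyMeasurable (ae_of_all _ fun x => hB x trivial)
  have hf₁i := hf₁.integrable hr
  have hmult : multiplier σ f₁ =ᵐ[dx]
      convolution (fun z => V z * c z) f₁ (ContinuousLinearMap.mul ℝ ℝ) dx :=
    multiplier_ae_eq (hVc.integrable_convolution _ hf₁i) fun n => by
      rw [coeff_convolution hVc hf₁i, hσ, coeff_mul_trigPoly hs hV]
  have hmult' : ∫ x, multiplier σ f₁ x * f₂ x ∂dx = ∫ x, convolution (fun z => V z * c z) f₁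
      (ContinuousLinearMap.mul ℝ ℝ) dx x * f₂ x ∂dx :=
    integral_congr_ae (hmult.mul (ae_eq_refl f₂))
  have hkw : Continuous fun p : Torus3 × Torus3 => (w (p.2 - p.1) : ℂ) * (w p.2 : ℂ) :=
    (hwc.comp (continuous_snd.sub continuous_fst)).mul (hwc.comp continuous_snd)
  have hkc : Continuous fun p : Torus3 × Torus3 => (c p.1 : ℂ) := hcc.comp continuous_fst
  -- The subtracted terms `n + m = 0` resum to `c(z)`, the `x` dependence cancelling between the two
  -- characters.
  have hkernel : (modeSum (box R) fun n m => a n * a m - if n + m = 0 then (s n : ℂ) else 0) =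
      fun z x => (w (x - z) : ℂ) * (w x : ℂ) - (c z : ℂ) := by
    funext z x
    simp only [modeSum, sub_mul, Finset.sum_sub_distrib]
    congr 1
    · rw [hw', hw', trigPoly, trigPoly, Finset.sum_mul_sum]
      refine Finset.sum_congr rfl fun n _ => Finset.sum_congr rfl fun m _ => ?_
      ring
    · rw [hc', trigPoly_box_neg (fun m => by simp [hs])]
      refine Finset.sum_congr rfl fun n hn => ?_
      rw [Finset.sum_eq_single_of_mem (-n) (by simpa [mem_box, height_neg] using hn)]
      · rw [if_pos (add_neg_cancel n), mFourier_apply_sub, mFourier_neg (n := n) (x := x)]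
        have h1 : mFourier n x * conj (mFourier n x) = 1 := by
          rw [Complex.mul_conj, Complex.normSq_eq_norm_sq, norm_mFourier_apply]; simp
        linear_combination (s n : ℂ) * mFourier (-n) z * h1
      · intro m _ hm
        rw [if_neg fun h => hm (eq_neg_of_add_eq_zero_right h), zero_mul]
  rw [hkernel, pairing_kernel_sub hV hkw hkc hrr' hF₁ hF₂,
    pairing_eq_integral_integral hV hkw hrr' hF₁ hF₂,
    pairing_eq_integral_integral hV hkc hrr' hF₁ hF₂, Complex.ofReal_sub,
    hmult', ← integral_complex_ofReal, ← integral_complex_ofReal]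
  congr 1
  · congr 1; funext x
    push_cast
    rw [ofReal_convolution, ← integral_mul_const]
    congr 1; funext z
    simp only [Pi.mul_apply]
    push_cast; ring
  · congr 1; funext x
    push_cast
    rw [ofReal_convolution, ← integral_mul_const]
    congr 1; funext z
    push_cast; ring

end Renormalization

/-! ### The operator norm -/

section OperatorNorm

open UnitAddTorus

/-- The bound for trigonometric polynomials does not depend on the number of dyadic pieces, so it
survives the limit of the Littlewood-Paley sums. -/
lemma enorm_pairing_le_tsum {Ω : Type*} [MeasurableSpace Ω] {P : Measure Ω} {a : Freq → Ω → ℂ}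
    {F : Finset Freq} {ρ : ℝ → ℝ} (hρ : IsCutoff ρ) {V : Torus3 → ℝ} (hV : Integrable V dx)
    {γ : ℝ} (hγ : 0 < γ) {U : ℕ × ℕ × ℕ × ℕ → Torus3 → ℝ}
    {R : ℕ × ℕ × ℕ × ℕ → ℕ} (hU : ∀ q, Integrable (U q) dx)
    (hUR : ∀ k₁ k₂ j₁ j₂, ∀ n m a b : Freq, shell n = k₁ → shell m = k₂ →
        height a < 2 ^ (j₁ + 3) → height b < 2 ^ (j₂ + 3) → n + a + (m + b) = 0 →
        coeff (U (k₁, k₂, j₁, j₂)) (n + a) = coeff V (n + a) ∧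
          height (n + m) ≤ R (k₁, k₂, j₁, j₂))
    {r r' : ℝ≥0∞} (hr : 1 ≤ r) (hr' : 1 ≤ r') (hrr' : r⁻¹ + r'⁻¹ = 1) {f₁ f₂ : Torus3 → ℝ}
    (hf₁ : MemLp f₁ r dx) (hf₂ : MemLp f₂ r' dx) (h₁ : sobolevNorm ρ γ r f₁ ≤ 1)
    (h₂ : sobolevNorm ρ γ r' f₂ ≤ 1) {m : ℕ} (hm : 1 ≤ m) (ω : Ω) :
    ‖pairing V (modeSum F fun n k => a n ω * a k ω - ∫ ω', a n ω' * a k ω' ∂P)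
      (fun x => f₁ x) (fun x => f₂ x)‖ₑ ≤ ∑' q, localizedBound P a F γ U R m ω q := by
  have hS (f : Torus3 → ℝ) (J : ℕ) : (fun x => ∑ j ∈ Finset.range (J + 1), lpProj ρ j f x) =
      trigPoly (box (2 ^ (J + 3))) fun n => ∑ j ∈ Finset.range (J + 1), chi ρ j n * coeff f n :=
    funext fun x => hρ.sum_lpProj subset_rfl f x
  have hmem (f : Torus3 → ℝ) (r : ℝ≥0∞) (J : ℕ) :
      MemLp (fun x => ∑ j ∈ Finset.range (J + 1), lpProj ρ j f x) r dx := by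
    rw [hS]; exact memLp_trigPoly _ _ _
  have hsupp (f : Torus3 → ℝ) (j : ℕ) (n : Freq) (h : (chi ρ j n : ℂ) * coeff f n ≠ 0) :
      height n < 2 ^ (j + 3) :=
    hρ.height_lt_of_chi_ne_zero fun h0 => h (by simp [h0])
  have hnorm {f : Torus3 → ℝ} {r : ℝ≥0∞} (hr : 1 ≤ r) (hf : sobolevNorm ρ γ r f ≤ 1) (J j : ℕ)
      (hj : j < J + 1) : eLpNorm (trigPoly (box (2 ^ (J + 3))) fun n => chi ρ j n * coeff f n) r dx
        ≤ ENNReal.ofReal (2 ^ (-γ * j)) := by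
    rw [← hρ.lpProj_eq_trigPoly fun n hn => ?_]
    · exact eLpNorm_lpProj_le hr hf j
    · rw [mem_box] at hn ⊢
      exact hn.trans (Nat.pow_le_pow_right (by norm_num) (by omega))
  have hlim := tendsto_pairing hV (continuous_modeSum F
    fun n k => a n ω * a k ω - ∫ ω', a n ω' * a k ω' ∂P) hrr' hr' hf₁.ofReal hf₂.ofReal
    (hmem f₁ r) (hmem f₂ r') (hρ.tendsto_sum_lpProj hγ hr hf₁ h₁)
    (hρ.tendsto_sum_lpProj hγ hr' hf₂ h₂)
  refine le_of_tendsto hlim.enorm (Eventually.of_forall fun J => ?_)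
  rw [hS, hS, pairing, integral_modeSum_mul hV]
  exact enorm_sum_mul_resonant_le_tsum hU hUR hrr' (hsupp f₁) (hsupp f₂) (hnorm hr h₁ J)
    (hnorm hr' h₂ J) hm ω

/-! ### Law of the modes and measurability of the supremum -/

section Modes

variable {ρ : ℝ → ℝ} {Ω : Type*} [MeasurableSpace Ω] {P : Measure Ω}
  {W : ℝ≥0 → Freq → Ω → ℂ}

/-- The Fourier modes of the truncated field. -/
def truncMode (ρ : ℝ → ℝ) (W : ℝ≥0 → Freq → Ω → ℂ) (T t : ℝ≥0) (n : Freq) (ω : Ω) : ℂ :=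
  trunc ρ T n * W t n ω

/-- The variances of the Fourier modes of the truncated field. -/
def modeVariance (ρ : ℝ → ℝ) (T t : ℝ≥0) (n : Freq) : ℝ :=
  (trunc ρ T n * trunc ρ t n) ^ 2 / bracket (freqNorm n) ^ 2

lemma modeVariance_nonneg (T t : ℝ≥0) (n : Freq) : 0 ≤ modeVariance ρ T t n := by
  unfold modeVariance; positivity

lemma modeVariance_neg (T t : ℝ≥0) (n : Freq) :
    modeVariance ρ T t (-n) = modeVariance ρ T t n := by
  simp only [modeVariance, trunc_neg, freqNorm_neg]

lemma IsCutoff.modeVariance_le (hρ : IsCutoff ρ) (T t : ℝ≥0) (n : Freq) :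
    modeVariance ρ T t n ≤ 1 / (1 + (height n : ℝ) ^ 2) := by
  have h1 := hρ.trunc_mem T n
  have h2 := hρ.trunc_mem t n
  have h3 : bracket (freqNorm n) ^ 2 = 1 + freqNorm n ^ 2 := Real.sq_sqrt (by positivity)
  have h4 := height_le_freqNorm n
  rw [modeVariance, h3]
  gcongr
  exact pow_le_one₀ (mul_nonneg h1.1 h2.1) (mul_le_one₀ h1.2 h2.1 h2.2)

lemma IsFieldProcess.hasGaussianLaw_truncMode (hW : IsFieldProcess ρ P W) (T t : ℝ≥0)
    (F : Finset Freq) : HasGaussianLaw (fun ω => fun n : F => truncMode ρ W T t n ω) P := by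
  have h := ((hW.gaussian.comp_right fun n : Freq => (t, n)).smul
    fun n => trunc ρ T n).hasGaussianLaw F
  refine h.congr (ae_of_all _ fun ω => ?_)
  funext n
  simp [truncMode]

lemma IsFieldProcess.integral_truncMode (hW : IsFieldProcess ρ P W) (T t : ℝ≥0) (n : Freq) :
    ∫ ω, truncMode ρ W T t n ω ∂P = 0 := by
  simp only [truncMode]
  rw [integral_const_mul, hW.centred, mul_zero]

lemma IsFieldProcess.integral_truncMode_mul_conj (hW : IsFieldProcess ρ P W) (T t : ℝ≥0)
    (n k : Freq) : ∫ ω, truncMode ρ W T t n ω * conj (truncMode ρ W T t k ω) ∂P =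
      if n = k then (modeVariance ρ T t n : ℂ) else 0 := by
  have h (ω : Ω) : truncMode ρ W T t n ω * conj (truncMode ρ W T t k ω) =
      (trunc ρ T n * trunc ρ T k : ℂ) * (W t n ω * conj (W t k ω)) := by
    simp only [truncMode, map_mul, Complex.conj_ofReal]; ring
  simp_rw [h]
  rw [integral_const_mul, hW.covariance, min_self]
  split_ifs with hnk
  · subst hnk
    rw [modeVariance]
    push_cast; ring
  · simp

lemma IsFieldProcess.ae_truncMode_neg (hW : IsFieldProcess ρ P W) (T t : ℝ≥0) :
    ∀ᵐ ω ∂P, ∀ n, truncMode ρ W T t (-n) ω = conj (truncMode ρ W T t n ω) := by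
  filter_upwards [ae_all_iff.2 fun n => hW.conj_symm t n] with ω h n
  simp only [truncMode, trunc_neg, h n, map_mul, Complex.conj_ofReal]

/-- Reality of the field turns the covariance into the correlation without conjugate, supported on
`k = -n`. This is the mean that the multiplier subtracts. -/
lemma IsFieldProcess.integral_truncMode_mul (hW : IsFieldProcess ρ P W) (T t : ℝ≥0)
    (n k : Freq) : ∫ ω, truncMode ρ W T t n ω * truncMode ρ W T t k ω ∂P =
      if n + k = 0 then (modeVariance ρ T t n : ℂ) else 0 := by
  have h : ∫ ω, truncMode ρ W T t n ω * truncMode ρ W T t k ω ∂P =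
      ∫ ω, truncMode ρ W T t n ω * conj (truncMode ρ W T t (-k) ω) ∂P := by
    refine integral_congr_ae ?_
    filter_upwards [hW.ae_truncMode_neg T t] with ω hω
    rw [hω k, Complex.conj_conj]
  rw [h, hW.integral_truncMode_mul_conj]
  simp only [eq_neg_iff_add_eq_zero]

lemma IsCutoff.exists_trunc_eq_zero (hρ : IsCutoff ρ) (T : ℝ) :
    ∃ R : ℕ, ∀ n, n ∉ box R → trunc ρ T n = 0 := by
  refine ⟨⌈4 * bracket T⌉₊, fun n hn => hρ.trunc_eq_zero ?_⟩
  rw [mem_box, not_le] at hn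
  exact (Nat.le_ceil _).trans (by exact_mod_cast hn.le)

/-- The renormalised form of the truncated field is almost surely a pairing with the renormalised
products of the modes. -/
lemma IsFieldProcess.ae_renormForm_eq (hW : IsFieldProcess ρ P W)
    {V : Torus3 → ℝ} (hV : Integrable V dx) {r r' : ℝ≥0∞} (hr : 1 ≤ r) (hrr' : r⁻¹ + r'⁻¹ = 1)
    (T t : ℝ≥0) {R : ℕ} (hR : ∀ n, n ∉ box R → trunc ρ T n = 0) :
    ∀ᵐ ω ∂P, ∀ f₁ f₂ : Torus3 → ℝ, MemLp f₁ r dx → MemLp f₂ r' dx →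
      renormForm ρ V T t (truncField ρ W T t ω) f₁ f₂ =
      (pairing V (modeSum (box R) fun n k => truncMode ρ W T t n ω * truncMode ρ W T t k ω -
        ∫ ω', truncMode ρ W T t n ω' * truncMode ρ W T t k ω' ∂P)
        (fun x => f₁ x) (fun x => f₂ x)).re := by
  -- The exceptional null set comes from the reality of the field alone and serves all functions at
  -- once, as needed for the uncountable supremum.
  filter_upwards [hW.ae_truncMode_neg T t] with ω hω f₁ f₂ hf₁ hf₂
  simp_rw [hW.integral_truncMode_mul]
  have hσ (n : Freq) : renormSymbol ρ V T t n =
      ∑ m ∈ box R, coeff V (n + m) * (modeVariance ρ T t m : ℂ) :=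
    tsum_eq_sum fun m hm => by simp [hR m hm]
  have hw (x : Torus3) : truncField ρ W T t ω x =
      (trigPoly (box R) (fun n => truncMode ρ W T t n ω) x).re := by
    rw [truncField, tsum_eq_sum (s := box R) fun m hm => by simp [hR m hm]]
    rfl
  rw [← ofReal_renorm_eq_pairing hω (modeVariance_neg T t) hV hr hrr' hσ hw hf₁ hf₂,
    Complex.ofReal_re, renormForm]

/-- A supremum of continuous functions of the modes is lower semicontinuous, hence measurable,
although the index set is uncountable. -/
lemma IsFieldProcess.aemeasurable_opNorm (hρ : IsCutoff ρ) (hW : IsFieldProcess ρ P W)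
    {V : Torus3 → ℝ} (hV : Integrable V dx) {r r' : ℝ≥0∞} (hr : 1 ≤ r) (hrr' : r⁻¹ + r'⁻¹ = 1)
    (γ : ℝ) (T t : ℝ≥0) : AEMeasurable (opNorm ρ V γ r r' W T t) P := by
  obtain ⟨R, hR⟩ := hρ.exists_trunc_eq_zero T
  set G : (Freq → ℂ) → ℝ≥0∞ := fun y => ⨆ (f₁ : Torus3 → ℝ) (f₂ : Torus3 → ℝ)
    (_ : MemSobolev ρ γ r f₁ ∧ sobolevNorm ρ γ r f₁ ≤ 1)
    (_ : MemSobolev ρ γ r' f₂ ∧ sobolevNorm ρ γ r' f₂ ≤ 1),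
    ENNReal.ofReal (∑ n ∈ box R, ∑ m ∈ box R, (y n * y m -
      ∫ ω', truncMode ρ W T t n ω' * truncMode ρ W T t m ω' ∂P) *
        pairing V (fun z x => mFourier n (x - z) * mFourier m x)
          (fun x => f₁ x) (fun x => f₂ x)).re with hG
  have hGm : Measurable G := by
    refine LowerSemicontinuous.measurable ?_
    refine lowerSemicontinuous_iSup fun f₁ => lowerSemicontinuous_iSup fun f₂ =>
      lowerSemicontinuous_iSup fun _ => lowerSemicontinuous_iSup fun _ =>
        Continuous.lowerSemicontinuous (ENNReal.continuous_ofReal.comp ?_)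
    fun_prop
  have ha : AEMeasurable (fun ω => fun n => truncMode ρ W T t n ω) P :=
    aemeasurable_pi_iff.2 fun n => (hW.gaussian.aemeasurable (t, n)).const_mul _
  refine (hGm.comp_aemeasurable ha).congr ?_
  filter_upwards [hW.ae_renormForm_eq hV hr hrr' T t hR] with ω hω
  simp only [Function.comp_apply, hG, opNorm]
  refine iSup_congr fun f₁ => iSup_congr fun f₂ => iSup_congr fun h₁ => iSup_congr fun h₂ => ?_
  have hf₁ : MemLp (fun x => (f₁ x : ℂ)) r dx := h₁.1.1.ofReal
  have hf₂ : MemLp (fun x => (f₂ x : ℂ)) r' dx := h₂.1.1.ofReal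
  rw [hω f₁ f₂ h₁.1.1 h₂.1.1, pairing_modeSum hV _ _ hrr' hf₁ hf₂]

end Modes

lemma eLpNorm_le_of_lintegral_pow_le {Ω : Type*} [MeasurableSpace Ω] {P : Measure Ω}
    {f : Ω → ℝ≥0∞} {n : ℕ} (hn : n ≠ 0) {A : ℝ≥0∞} (h : ∫⁻ ω, f ω ^ n ∂P ≤ A ^ n) :
    eLpNorm f n P ≤ A := by
  rw [eLpNorm_eq_lintegral_rpow_enorm_toReal (by simpa using hn) (by simp)]
  simp only [enorm_eq_self, ENNReal.toReal_natCast, ENNReal.rpow_natCast]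
  rw [one_div, ENNReal.rpow_inv_le_iff (by positivity), ENNReal.rpow_natCast]
  exact h

/-- Random matrix estimate: the moments of the operator norm of the renormalised bilinear form grow
at most linearly. -/
theorem exists_eLpNorm_opNorm_le
    (β : ℝ) (hβ₀ : 0 < β) (hβ₃ : β < 3)
    (V : Torus3 → ℝ) (hV : IsInteraction β V)
    (ρ : ℝ → ℝ) (hρ : IsCutoff ρ)
    (γ : ℝ) (hγ : max (1 - β) (1 / 2) < γ)
    (r r' : ℝ≥0∞) (hr : 1 ≤ r) (hrr' : r⁻¹ + r'⁻¹ = 1) :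
    ∃ C : ℝ, ∀ (Ω : Type*) [MeasurableSpace Ω] (P : Measure Ω) [IsProbabilityMeasure P]
      (W : ℝ≥0 → Freq → Ω → ℂ), IsFieldProcess ρ P W →
      ∀ (p : ℝ), 1 ≤ p → ∀ T t : ℝ≥0,
        AEMeasurable (opNorm ρ V γ r r' W T t) P ∧
        eLpNorm (opNorm ρ V γ r r' W T t) (ENNReal.ofReal p) P
          ≤ ENNReal.ofReal (C * p) := by
  have hVi := hV.integrable hβ₀ hβ₃
  have hγ₀ : 0 < γ := lt_trans (by norm_num) ((le_max_right _ _).trans_lt hγ)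
  have hr' : 1 ≤ r' := by
    rw [← ENNReal.inv_le_one, ← hrr']
    exact le_add_self
  obtain ⟨U, N, C, m₀, hC, hm₀, hU, hUN, hmom⟩ :=
    exists_lintegral_tsum_localizedBound_le hβ₀ hβ₃ hV hγ
  refine ⟨C * (2 + m₀), fun Ω _ P _ W hW p hp T t => ?_⟩
  have hmeas := hW.aemeasurable_opNorm hρ hVi hr hrr' γ T t
  refine ⟨hmeas, ?_⟩
  obtain ⟨R, hR⟩ := hρ.exists_trunc_eq_zero T
  -- The exponent `2m` exceeds `p` and the threshold for the moment bound, while `m` stays at most a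
  -- constant times `p`.
  set m := ⌈p⌉₊ + m₀ with hm
  have hmp : (m : ℝ) ≤ (2 + m₀) * p := by
    have h1 := Nat.ceil_lt_add_one (zero_le_one.trans hp)
    have h2 : (m₀ : ℝ) ≤ m₀ * p := le_mul_of_one_le_right (Nat.cast_nonneg _) hp
    rw [hm]; push_cast; linarith
  have hbound : ∀ᵐ ω ∂P, opNorm ρ V γ r r' W T t ω ≤
      ∑' q, localizedBound P (truncMode ρ W T t) (box R) γ U N m ω q := by
    filter_upwards [hW.ae_renormForm_eq hVi hr hrr' T t hR] with ω hω
    refine iSup_le fun f₁ => iSup_le fun f₂ => iSup_le fun h₁ => iSup_le fun h₂ => ?_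
    rw [hω f₁ f₂ h₁.1.1 h₂.1.1]
    refine le_trans ?_ (enorm_pairing_le_tsum hρ hVi hγ₀ hU hUN hr hr' hrr' h₁.1.1 h₂.1.1 h₁.2
      h₂.2 (by omega) ω)
    rw [← ofReal_norm]
    exact ENNReal.ofReal_le_ofReal (Complex.re_le_norm _)
  have hpow : ∫⁻ ω, opNorm ρ V γ r r' W T t ω ^ (2 * m) ∂P ≤ ENNReal.ofReal (C * m) ^ (2 * m) := by
    refine le_trans (lintegral_mono_ae ?_) (hmom Ω P (truncMode ρ W T t) (box R)
      (modeVariance ρ T t) (hW.hasGaussianLaw_truncMode T t _)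
      (fun n _ => hW.integral_truncMode T t n) (modeVariance_nonneg T t)
      (hρ.modeVariance_le T t) (fun n _ k _ => hW.integral_truncMode_mul_conj T t n k) m (by omega))
    filter_upwards [hbound] with ω hω
    gcongr
  have hexp : ENNReal.ofReal p ≤ ((2 * m : ℕ) : ℝ≥0∞) := by
    rw [← ENNReal.ofReal_natCast]
    refine ENNReal.ofReal_le_ofReal ?_
    have := Nat.le_ceil p
    rw [hm]; push_cast
    have h0 : (0 : ℝ) ≤ m₀ := Nat.cast_nonneg _
    linarith
  calc eLpNorm (opNorm ρ V γ r r' W T t) (ENNReal.ofReal p) P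
      ≤ eLpNorm (opNorm ρ V γ r r' W T t) ((2 * m : ℕ) : ℝ≥0∞) P :=
        eLpNorm_le_eLpNorm_of_exponent_le hexp hmeas.aestronglyMeasurable
    _ ≤ ENNReal.ofReal (C * m) := eLpNorm_le_of_lintegral_pow_le (by omega) hpow
    _ ≤ ENNReal.ofReal (C * (2 + m₀) * p) := by
        refine ENNReal.ofReal_le_ofReal ?_
        rw [mul_assoc]
        exact mul_le_mul_of_nonneg_left hmp hC

end OperatorNorm

end RandomMatrix

end

theorem proposition3p8
    (β : ℝ) (hβ₀ : 0 < β) (hβ₃ : β < 3)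
    (V : RandomMatrix.Torus3 → ℝ) (hV : RandomMatrix.IsInteraction β V)
    (ρ : ℝ → ℝ) (hρ : RandomMatrix.IsCutoff ρ)
    (γ : ℝ) (hγ : max (1 - β) (1 / 2) < γ)
    (r r' : ℝ≥0∞) (hr : 1 ≤ r) (hrr' : r⁻¹ + r'⁻¹ = 1) :
    ∃ C : ℝ, ∀ (Ω : Type*) [MeasurableSpace Ω] (P : Measure Ω) [IsProbabilityMeasure P]
      (W : ℝ≥0 → RandomMatrix.Freq → Ω → ℂ), RandomMatrix.IsFieldProcess ρ P W →
      ∀ (p : ℝ), 1 ≤ p → ∀ T t : ℝ≥0,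
        AEMeasurable (RandomMatrix.opNorm ρ V γ r r' W T t) P ∧
        eLpNorm (RandomMatrix.opNorm ρ V γ r r' W T t) (ENNReal.ofReal p) P
          ≤ ENNReal.ofReal (C * p) :=
  RandomMatrix.exists_eLpNorm_opNorm_le β hβ₀ hβ₃ V hV ρ hρ γ hγ r r' hr hrr'
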